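/- Let $d\ge 2$ be an integer and $s\in(\tfrac12,\tfrac d2)$. Let $\sigma$ be the surface measure on the unit sphere $\mathbb S^{d-1}\subset\mathbb R^d$ induced by Lebesgue measure, and for $G\in L^2(\mathbb S^{d-1})=L^2(\mathbb S^{d-1},\mathrm d\sigma;\mathbb C)$ put $\widehat{G\,\mathrm d\sigma}(\xi)=\int_{\mathbb S^{d-1}}G(\omega)e^{-i\omega\cdot\xi}\,\mathrm d\sigma(\omega)$, $\xi\in\mathbb R^d$. For $k\in\mathbb N_0=\{0,1,2,\dots\}$ let $H_k$ be the projection onto spherical harmonics of degree $k$, extended to functions $g$ on $\mathbb R^d$ by $$H_kg(x)=\frac{N_{k,d}}{|\mathbb S^{d-1}|}\int_{\mathbb S^{d-1}}g(|x|\varphi)\,P_{k,d}\big(\tfrac{x}{|x|}\cdot\varphi\big)\,\mathrm d\sigma(\varphi),$$ where $|\mathbb S^{d-1}|=\sigma(\mathbb S^{d-1})$, $N_{0,d}=1$, $N_{k,d}=\frac{(2k+d-2)(k+d-3)!}{k!\,(d-2)!}$ for $k\ge1$, and $P_{k,d}$ is the Legendre polynomial of degree $k$ in $d$ dimensions, that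 is, $P_{0,d}(t)=1$, $P_{1,d}(t)=t$ and $(k+d-1)P_{k+2,d}(t)=(2k+d)\,t\,P_{k+1,d}(t)-(k+1)P_{k,d}(t)$. Writing $-\Lambda$ for the Laplace–Beltrami operator on $\mathbb S^{d-1}$, whose eigenvalue on spherical harmonics of degree $k$ is $k(k+d-2)$, define accordingly, for functions $g$ on $\mathbb R^d$, $$(1-\Lambda)^{\frac{2s-1}{4}}g=\sum_{k=0}^\infty\big(1+k(k+d-2)\big)^{\frac{2s-1}{4}}H_kg .$$ Let $$\widetilde\lambda_k=(2\pi)^d\,2^{1-2s}\,\frac{\Gamma(2s-1)\,\Gamma(k+\frac d2-s)}{\Gamma(s)^2\,\Gamma(k+\frac d2-1+s)}\,\big(1+k(k+d-2)\big)^{s-\frac12}.$$ Then $\inf_{k}\widetilde\lambda_k>0$ and $\sup_{k}\widetilde\lambda_k<\infty$. For every $G\in L^2(\mathbb S^{d-1})$ the series defining $(1-\Lambda)^{\frac{2s-1}{4}}\widehat{G\,\mathrm d\sigma}$ converges absolutely almost everywhere on $\mathbb R^d$, the function $|\cdot|^{-s}(1-\Lambda)^{\frac{2s-1}{4}}\widehat{G\,\mathrm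 d\sigma}$ belongs to $L^2(\mathbb R^d)$, and $$\inf_{k\in\mathbb N_0}\widetilde\lambda_k\,\|G\|_{L^2(\mathbb S^{d-1})}^2\le\big\||\cdot|^{-s}(1-\Lambda)^{\frac{2s-1}{4}}\widehat{G\,\mathrm d\sigma}\big\|_{L^2(\mathbb R^d)}^2\le\sup_{k\in\mathbb N_0}\widetilde\lambda_k\,\|G\|_{L^2(\mathbb S^{d-1})}^2 .$$ Both constants are optimal: if $c\in\mathbb R$ can replace $\inf_k\widetilde\lambda_k$ in the lower bound for all $G\in L^2(\mathbb S^{d-1})$, then $c\le\inf_k\widetilde\lambda_k$, and if $C\in\mathbb R$ can replace $\sup_k\widetilde\lambda_k$ in the upper bound for all $G\in L^2(\mathbb S^{d-1})$, then $C\ge\sup_k\widetilde\lambda_k$. -/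

import Mathlib

open MeasureTheory Polynomial
open scoped Nat

noncomputable section

/-- The unit sphere `𝕊^{d-1}` of `ℝ^d`. -/
abbrev USphere (d : ℕ) : Type := Metric.sphere (0 : EuclideanSpace ℝ (Fin d)) 1

/-- The surface measure `dσ` on `𝕊^{d-1}` induced by Lebesgue measure on `ℝ^d`
(total mass `d` times the volume of the unit ball). -/
def surfaceMeasure (d : ℕ) : Measure (USphere d) :=
  (volume : Measure (EuclideanSpace ℝ (Fin d))).toSphere

/-- The Fourier extension `ξ ↦ (G dσ)^(ξ) = ∫ G(ω) exp(-i ω · ξ) dσ(ω)`. -/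
def fourierExtension {d : ℕ} (G : USphere d → ℂ) (ξ : EuclideanSpace ℝ (Fin d)) : ℂ :=
  ∫ ω, G ω * Complex.exp (-Complex.I * ((inner ℝ (ω : EuclideanSpace ℝ (Fin d)) ξ : ℝ) : ℂ))
    ∂(surfaceMeasure d)

/-- The Legendre polynomial `P_{k,d}` of degree `k` in `d` dimensions (normalised by
`P_{k,d}(1) = 1`, orthogonal on `[-1,1]` for the weight `(1-t²)^{(d-3)/2}`), given by its
three-term recurrence `(k+d-1) P_{k+2} = (2k+d) t P_{k+1} - (k+1) P_k`.
For `d = 2` these are the Chebyshev polynomials `T_k`, for `d = 3` the classical Legendre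
polynomials. -/
def legendrePoly (d : ℕ) : ℕ → ℝ[X]
  | 0 => 1
  | 1 => X
  | k + 2 => C (((k : ℝ) + d - 1)⁻¹) *
      (C (2 * (k : ℝ) + d) * X * legendrePoly d (k + 1) - C ((k : ℝ) + 1) * legendrePoly d k)

/-- The dimension `N_{k,d} = (2k+d-2) (k+d-3)! / (k! (d-2)!)` of the space of spherical harmonics
of degree `k` on `𝕊^{d-1}`, `d ≥ 2`; it is `1` for `k = 0` (where, if `d = 2`, the formula is to be
read as a limit). -/
def harmonicDim (d k : ℕ) : ℝ :=
  if k = 0 then 1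
  else (2 * (k : ℝ) + d - 2) * ((k + d - 3)! : ℝ) / ((k ! : ℝ) * ((d - 2)! : ℝ))

/-- The projection `H_k` onto spherical harmonics of degree `k`, extended homogeneously to
functions on `ℝ^d`:
`H_k g(x) = N_{k,d} / |𝕊^{d-1}| ∫ g(|x|η) P_{k,d}(x/|x| · η) dσ(η)`. -/
def harmonicProj {d : ℕ} (k : ℕ) (g : EuclideanSpace ℝ (Fin d) → ℂ)
    (x : EuclideanSpace ℝ (Fin d)) : ℂ :=
  ((harmonicDim d k / (surfaceMeasure d).real Set.univ : ℝ) : ℂ) *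
    ∫ η, g (‖x‖ • (η : EuclideanSpace ℝ (Fin d))) *
      (((legendrePoly d k).eval
        (inner ℝ (‖x‖⁻¹ • x) (η : EuclideanSpace ℝ (Fin d))) : ℝ) : ℂ) ∂(surfaceMeasure d)

/-- The `k`-th term `θ(k(k+d-2)) H_k g(x)` of the series for `θ(-Λ) g(x)`; here
`k(k+d-2)` is the eigenvalue of `-Λ` on spherical harmonics of degree `k`. -/
def angularTerm {d : ℕ} (θ : ℝ → ℝ) (g : EuclideanSpace ℝ (Fin d) → ℂ)
    (x : EuclideanSpace ℝ (Fin d)) (k : ℕ) : ℂ :=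
  ((θ ((k : ℝ) * ((k : ℝ) + d - 2)) : ℝ) : ℂ) * harmonicProj k g x

/-- The operator `θ(-Λ) = ∑_k θ(k(k+d-2)) H_k` on functions on `ℝ^d`. -/
def angularMultiplier {d : ℕ} (θ : ℝ → ℝ) (g : EuclideanSpace ℝ (Fin d) → ℂ)
    (x : EuclideanSpace ℝ (Fin d)) : ℂ :=
  ∑' k : ℕ, angularTerm θ g x k

/-- `θ(ϱ) = (1+ϱ)^{(2s-1)/4}`, so that `θ(-Λ) = (1-Λ)^{(2s-1)/4}`. -/
def fangWangSymbol (s : ℝ) (ϱ : ℝ) : ℝ := (1 + ϱ) ^ ((2 * s - 1) / 4)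

/-- The function `|·|^{-s} (1-Λ)^{(2s-1)/4} (G dσ)^` on `ℝ^d`. -/
def weightedExtension {d : ℕ} (s : ℝ) (G : USphere d → ℂ) (ξ : EuclideanSpace ℝ (Fin d)) : ℂ :=
  ((‖ξ‖ ^ (-s) : ℝ) : ℂ) * angularMultiplier (fangWangSymbol s) (fourierExtension G) ξ

/-- The sequence
`(2π)^d 2^{1-2s} Γ(2s-1) Γ(k+d/2-s) / (Γ(s)² Γ(k+d/2-1+s)) (1+k(k+d-2))^{s-1/2}`. -/
def lambdaTilde (d : ℕ) (s : ℝ) (k : ℕ) : ℝ :=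
  (2 * Real.pi) ^ d * (2 : ℝ) ^ (1 - 2 * s) *
    (Real.Gamma (2 * s - 1) * Real.Gamma ((k : ℝ) + (d : ℝ) / 2 - s) /
      (Real.Gamma s ^ 2 * Real.Gamma ((k : ℝ) + (d : ℝ) / 2 - 1 + s))) *
    (1 + (k : ℝ) * ((k : ℝ) + d - 2)) ^ (s - 1 / 2)

end

/-! The operator commutes with rotations, so spherical harmonics diagonalise it. By the Funk–Hecke
formula, the kernel exp(-i r x·y) acts on harmonics of degree k as a scalar a_k(r), here
`expMultiplier d k (-I * r)`. Thus on the sphere of radius r the degree-k part of the function is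
(1+k(k+d-2))^{(2s-1)/4} a_k(r) H_k G. Polar coordinates, Parseval on each sphere and Tonelli turn
the squared weighted norm into ∑ λ̃_k ‖H_k G‖², provided that ∫ r^{d-1-2s} |a_k(r)|² dr has the
value `besselConst d s k`. The two estimates are then Parseval once more, and the zonal harmonics
attain each λ̃_k, so the constants are optimal. Since λ̃_k tends to a positive limit, its infimum is
positive and its supremum finite.

Three ingredients are built from scratch. (1) Funk–Hecke (`zonalPairing_X_pow_legendrePoly`,
`integral_exp_mul_legendrePoly`): Gaussian integration by parts gives a recursion for mixed moments
over the sphere, which is matched with the recurrence and the derivative relation of the Legendre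
polynomials; orthogonality and norms of the zonal kernels follow. (2) The radial integral
(`lintegral_rpow_mul_expMultiplier`), a critical Weber–Schafheitlin integral: r^{-2s} is written as
a superposition of Gaussians e^{-t r²}. Each Gaussian-weighted integral is a modified Bessel
function of 1/(2t), because |ω-ω'|² = 2 - 2 ω·ω' on the sphere. Integrating its power series in t
leaves a ₂F₁ at 1, summed by Gauss's theorem. (3) Completeness of the harmonics
(`eq_zero_of_zonalProjLp_eq_zero`), by Stone–Weierstrass for the characters of the sphere.

Convergence questions are settled by the bound |a_k(r)| ≤ C e^r r^k / k!, whose factorial beats the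
exponential bounds used for all other factors. -/

instance surfaceMeasure.instIsFiniteMeasure (d : ℕ) : IsFiniteMeasure (surfaceMeasure d) := by
  unfold surfaceMeasure; infer_instance

/-! ### Polar coordinates and Gaussian radial moments. -/

theorem nontrivial_euclideanSpace {d : ℕ} (hd : 2 ≤ d) :
    Nontrivial (EuclideanSpace ℝ (Fin d)) := by
  have : Nonempty (Fin d) := ⟨⟨0, by omega⟩⟩
  infer_instance

theorem USphere.norm_coe {d : ℕ} (ω : USphere d) : ‖(ω : EuclideanSpace ℝ (Fin d))‖ = 1 := by
  simp

/-- Integration in polar coordinates, on the product of the sphere and the half-line. -/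
theorem integral_eq_integral_sphere_prod {d : ℕ} (hd : 2 ≤ d) {F : Type*} [NormedAddCommGroup F]
    [NormedSpace ℝ F] (f : EuclideanSpace ℝ (Fin d) → F) :
    ∫ x, f x = ∫ p : USphere d × Set.Ioi (0 : ℝ), f ((p.2 : ℝ) • (p.1 : EuclideanSpace ℝ (Fin d)))
      ∂((surfaceMeasure d).prod (Measure.volumeIoiPow (d - 1))) := by
  have := nontrivial_euclideanSpace hd
  have h := (volume : Measure (EuclideanSpace ℝ (Fin d))).measurePreserving_homeomorphUnitSphereProd
  rw [finrank_euclideanSpace_fin] at h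
  have h2 := h.symm (homeomorphUnitSphereProd _).toMeasurableEquiv
  have h3 := h2.integral_comp (MeasurableEquiv.measurableEmbedding _)
    (fun x : ({0}ᶜ : Set (EuclideanSpace ℝ (Fin d))) => f x)
  rw [integral_subtype_comap (measurableSet_singleton _).compl f, restrict_compl_singleton] at h3
  rw [← h3]
  rfl

/-- Integration of nonnegative functions in polar coordinates. -/
theorem lintegral_eq_lintegral_polar {d : ℕ} (hd : 2 ≤ d)
    (f : EuclideanSpace ℝ (Fin d) → ENNReal) (hf : Measurable f) :
    ∫⁻ x, f x = ∫⁻ r in Set.Ioi (0 : ℝ), ENNReal.ofReal (r ^ (d - 1)) *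
      ∫⁻ ω : USphere d, f (r • (ω : EuclideanSpace ℝ (Fin d))) ∂(surfaceMeasure d) := by
  have := nontrivial_euclideanSpace hd
  have h := (volume : Measure (EuclideanSpace ℝ (Fin d))).measurePreserving_homeomorphUnitSphereProd
  rw [finrank_euclideanSpace_fin] at h
  have h2 := h.symm (homeomorphUnitSphereProd _).toMeasurableEquiv
  have h3 := h2.lintegral_comp_emb (MeasurableEquiv.measurableEmbedding _)
    (fun x : ({0}ᶜ : Set (EuclideanSpace ℝ (Fin d))) => f x)
  rw [lintegral_subtype_comap (measurableSet_singleton _).compl f, restrict_compl_singleton] at h3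
  rw [← h3]
  change ∫⁻ p : USphere d × Set.Ioi (0 : ℝ), f ((p.2 : ℝ) • (p.1 : EuclideanSpace ℝ (Fin d)))
    ∂((surfaceMeasure d).prod _) = _
  have hm : Measurable (fun p : USphere d × Set.Ioi (0 : ℝ) =>
      f ((p.2 : ℝ) • (p.1 : EuclideanSpace ℝ (Fin d)))) := by
    apply hf.comp; fun_prop
  have hm' : Measurable (fun p : ℝ × USphere d =>
      f (p.1 • (p.2 : EuclideanSpace ℝ (Fin d)))) := by
    apply hf.comp; fun_prop
  rw [lintegral_prod_symm' _ hm, Measure.volumeIoiPow,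
    lintegral_withDensity_eq_lintegral_mul _ (by fun_prop)
      (hm.lintegral_prod_left')]
  exact lintegral_subtype_comap measurableSet_Ioi (fun r : ℝ => ENNReal.ofReal (r ^ (d - 1)) *
      ∫⁻ ω : USphere d, f (r • (ω : EuclideanSpace ℝ (Fin d))) ∂(surfaceMeasure d))

/-- The radial Gaussian moment `∫₀^∞ r^{N+d-1} e^{-r²/2} dr`. -/
noncomputable def radialMoment (d N : ℕ) : ℝ :=
  ∫ r in Set.Ioi (0 : ℝ), r ^ (N + d - 1) * Real.exp (-r ^ 2 / 2)

theorem radialMoment_eq {d : ℕ} (hd : 2 ≤ d) (N : ℕ) :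
    radialMoment d N = (1 / 2 : ℝ) ^ (-((N + d : ℕ) : ℝ) / 2) * (1 / 2) *
      Real.Gamma (((N + d : ℕ) : ℝ) / 2) := by
  have h := integral_rpow_mul_exp_neg_mul_rpow (p := 2) (q := ((N + d - 1 : ℕ) : ℝ)) (b := 1 / 2)
    (by norm_num) (by have := Nat.cast_nonneg (α := ℝ) (N + d - 1); linarith) (by norm_num)
  have e : ((N + d - 1 : ℕ) : ℝ) + 1 = ((N + d : ℕ) : ℝ) := by
    rw [Nat.cast_sub (by omega)]; simp
  rw [e] at h
  rw [← h, radialMoment]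
  refine setIntegral_congr_fun measurableSet_Ioi fun r hr => ?_
  simp only [Real.rpow_natCast, Real.rpow_two]
  congr 2
  ring

theorem radialMoment_pos {d : ℕ} (hd : 2 ≤ d) (N : ℕ) : 0 < radialMoment d N := by
  rw [radialMoment_eq hd]
  have : 0 < ((N + d : ℕ) : ℝ) := by exact_mod_cast (by omega)
  have := Real.Gamma_pos_of_pos (half_pos this)
  positivity

theorem radialMoment_add_two {d : ℕ} (hd : 2 ≤ d) (N : ℕ) :
    radialMoment d (N + 2) = (N + d) * radialMoment d N := by
  rw [radialMoment_eq hd, radialMoment_eq hd]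
  have h0 : 0 < ((N + d : ℕ) : ℝ) := by exact_mod_cast (by omega)
  have e1 : ((N + 2 + d : ℕ) : ℝ) / 2 = ((N + d : ℕ) : ℝ) / 2 + 1 := by push_cast; ring
  have e2 : -((N + 2 + d : ℕ) : ℝ) / 2 = -((N + d : ℕ) : ℝ) / 2 - 1 := by push_cast; ring
  rw [e1, e2, Real.Gamma_add_one (by positivity), Real.rpow_sub_one (by norm_num)]
  push_cast
  ring

/-- In polar coordinates homogeneity separates radius from angle. This trades integrals over the
sphere for Gaussian integrals over the whole space, where integration by parts has no boundary
terms. -/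
theorem integral_homogeneous_mul_gaussian {d : ℕ} (hd : 2 ≤ d) (N : ℕ)
    (f : EuclideanSpace ℝ (Fin d) → ℝ) (hf : ∀ (r : ℝ) x, f (r • x) = r ^ N * f x) :
    ∫ x, f x * Real.exp (-‖x‖ ^ 2 / 2) = (∫ ω : USphere d, f ω ∂(surfaceMeasure d)) *
      radialMoment d N := by
  rw [integral_eq_integral_sphere_prod hd]
  have : ∀ p : USphere d × Set.Ioi (0 : ℝ),
      f ((p.2 : ℝ) • (p.1 : EuclideanSpace ℝ (Fin d))) *
        Real.exp (-‖(p.2 : ℝ) • (p.1 : EuclideanSpace ℝ (Fin d))‖ ^ 2 / 2) =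
      f p.1 * (fun r : Set.Ioi (0 : ℝ) => (r : ℝ) ^ N * Real.exp (-(r : ℝ) ^ 2 / 2)) p.2 := by
    intro p
    rw [hf, norm_smul, USphere.norm_coe, mul_one, Real.norm_eq_abs, sq_abs]
    ring
  simp_rw [this]
  rw [integral_prod_mul (fun ω : USphere d => f ω)
    (fun r : Set.Ioi (0 : ℝ) => (r : ℝ) ^ N * Real.exp (-(r : ℝ) ^ 2 / 2))]
  congr 1
  simp only [Measure.volumeIoiPow, ENNReal.ofReal]
  rw [integral_withDensity_eq_integral_smul (measurable_subtype_coe.pow_const _).real_toNNReal,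
    integral_subtype_comap measurableSet_Ioi fun a : ℝ ↦ Real.toNNReal (a ^ (d - 1)) •
      (a ^ N * Real.exp (-a ^ 2 / 2)), radialMoment]
  refine setIntegral_congr_fun measurableSet_Ioi fun r hr => ?_
  rw [NNReal.smul_def, Real.coe_toNNReal _ (pow_nonneg hr.out.le _), smul_eq_mul, ← mul_assoc,
    ← pow_add]
  congr 2
  omega

theorem integrable_norm_pow_mul_gaussian {d : ℕ} (hd : 2 ≤ d) (N : ℕ) :
    Integrable (fun x : EuclideanSpace ℝ (Fin d) => ‖x‖ ^ N * Real.exp (-‖x‖ ^ 2 / 2)) := by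
  have := nontrivial_euclideanSpace hd
  rw [integrable_fun_norm_addHaar volume (f := fun r : ℝ => r ^ N * Real.exp (-r ^ 2 / 2)),
    finrank_euclideanSpace_fin]
  have h := integrableOn_rpow_mul_exp_neg_mul_rpow (p := 2) (s := ((d - 1 + N : ℕ) : ℝ))
    (b := 1 / 2) (by have := Nat.cast_nonneg (α := ℝ) (d - 1 + N); linarith)
    (by norm_num) (by norm_num)
  refine h.congr_fun (fun r hr => ?_) measurableSet_Ioi
  simp only [Real.rpow_natCast, Real.rpow_two, smul_eq_mul, pow_add, mul_assoc]
  congr 3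
  ring

/-! ### Mixed moments over the sphere, by Gaussian integration by parts. -/

/-- The mixed moments of two linear functionals over the unit sphere. -/
noncomputable def sphereMoment {d : ℕ} (x z : EuclideanSpace ℝ (Fin d)) (m n : ℕ) : ℝ :=
  ∫ ω : USphere d, inner ℝ x (ω : EuclideanSpace ℝ (Fin d)) ^ m *
    inner ℝ z (ω : EuclideanSpace ℝ (Fin d)) ^ n ∂(surfaceMeasure d)

/-- The mixed moments of two linear functionals under the Gaussian weight. -/
noncomputable def gaussMoment {d : ℕ} (x z : EuclideanSpace ℝ (Fin d)) (m n : ℕ) : ℝ :=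
  ∫ y : EuclideanSpace ℝ (Fin d), (inner ℝ x y ^ m * inner ℝ z y ^ n) * Real.exp (-‖y‖ ^ 2 / 2)

theorem gaussMoment_eq {d : ℕ} (hd : 2 ≤ d) (x z : EuclideanSpace ℝ (Fin d)) (m n : ℕ) :
    gaussMoment x z m n = sphereMoment x z m n * radialMoment d (m + n) := by
  rw [gaussMoment, integral_homogeneous_mul_gaussian hd (m + n)
    (fun y => inner ℝ x y ^ m * inner ℝ z y ^ n)]
  · rfl
  · intro r y
    rw [inner_smul_right, inner_smul_right]
    ring

theorem integrable_gaussMoment {d : ℕ} (hd : 2 ≤ d) (x z : EuclideanSpace ℝ (Fin d)) (m n : ℕ) :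
    Integrable (fun y : EuclideanSpace ℝ (Fin d) =>
      (inner ℝ x y ^ m * inner ℝ z y ^ n) * Real.exp (-‖y‖ ^ 2 / 2)) := by
  refine ((integrable_norm_pow_mul_gaussian hd (m + n)).const_mul (‖x‖ ^ m * ‖z‖ ^ n)).mono'
    (by fun_prop) (Filter.Eventually.of_forall fun y => ?_)
  rw [norm_mul, norm_mul, norm_pow, norm_pow, Real.norm_eq_abs (Real.exp _), Real.abs_exp]
  have h1 : ‖inner ℝ x y‖ ^ m ≤ (‖x‖ * ‖y‖) ^ m := by gcongr; exact norm_inner_le_norm _ _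
  have h2 : ‖inner ℝ z y‖ ^ n ≤ (‖z‖ * ‖y‖) ^ n := by gcongr; exact norm_inner_le_norm _ _
  calc _ ≤ ((‖x‖ * ‖y‖) ^ m * (‖z‖ * ‖y‖) ^ n) * Real.exp (-‖y‖ ^ 2 / 2) := by gcongr
    _ = _ := by rw [mul_pow, mul_pow, pow_add]; ring

/-- Integration by parts in the direction x: one factor x·y is absorbed as minus the derivative of
the Gaussian, and the derivative falls on the remaining product. -/
theorem gaussMoment_succ {d : ℕ} (hd : 2 ≤ d) (x z : EuclideanSpace ℝ (Fin d)) (m n : ℕ) :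
    gaussMoment x z (m + 1) n = m * ‖x‖ ^ 2 * gaussMoment x z (m - 1) n +
      n * inner ℝ x z * gaussMoment x z m (n - 1) := by
  have hL : ∀ (w y : EuclideanSpace ℝ (Fin d)), HasDerivAt (fun t : ℝ => inner ℝ w (y + t • x))
      (inner ℝ w x) 0 := by
    intro w y
    simp only [inner_add_right, inner_smul_right]
    simpa using ((hasDerivAt_id (0 : ℝ)).mul_const (inner ℝ w x)).const_add (inner ℝ w y)
  have hN : ∀ y : EuclideanSpace ℝ (Fin d), HasDerivAt
      (fun t : ℝ => Real.exp (-‖y + t • x‖ ^ 2 / 2))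
      (-(inner ℝ x y * Real.exp (-‖y‖ ^ 2 / 2))) 0 := by
    intro y
    have h1 : HasDerivAt (fun t : ℝ => y + t • x) x 0 := by
      simpa using ((hasDerivAt_id (0 : ℝ)).smul_const x).const_add y
    have h2 := ((h1.norm_sq.neg).div_const 2).exp
    refine h2.congr_deriv ?_
    change Real.exp (-‖y + (0 : ℝ) • x‖ ^ 2 / 2) * (-(2 * inner ℝ (y + (0 : ℝ) • x) x) / 2) = _
    rw [zero_smul, add_zero, real_inner_comm]
    ring
  have h := integral_bilinear_hasLineDerivAt_right_eq_neg_left_of_integrable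
    (μ := (volume : Measure (EuclideanSpace ℝ (Fin d))))
    (B := ContinuousLinearMap.mul ℝ ℝ) (v := x)
    (f := fun y => inner ℝ x y ^ m * inner ℝ z y ^ n)
    (f' := fun y => (m * ‖x‖ ^ 2) * (inner ℝ x y ^ (m - 1) * inner ℝ z y ^ n) +
      (n * inner ℝ x z) * (inner ℝ x y ^ m * inner ℝ z y ^ (n - 1)))
    (g := fun y => Real.exp (-‖y‖ ^ 2 / 2))
    (g' := fun y => -(inner ℝ x y * Real.exp (-‖y‖ ^ 2 / 2)))
    ?_ ?_ (integrable_gaussMoment hd x z m n) ?_ ?_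
  · simp only [ContinuousLinearMap.mul_apply'] at h
    have e1 : gaussMoment x z (m + 1) n = -∫ y : EuclideanSpace ℝ (Fin d),
        (inner ℝ x y ^ m * inner ℝ z y ^ n) * -(inner ℝ x y * Real.exp (-‖y‖ ^ 2 / 2)) := by
      rw [← integral_neg, gaussMoment]
      congr 1; ext y; ring
    rw [e1, h, neg_neg, gaussMoment, gaussMoment, ← integral_const_mul, ← integral_const_mul,
      ← integral_add ((integrable_gaussMoment hd _ _ _ _).const_mul _)
        ((integrable_gaussMoment hd _ _ _ _).const_mul _)]
    congr 1; ext y; ring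
  · simp only [ContinuousLinearMap.mul_apply', add_mul, mul_assoc]
    have := ((integrable_gaussMoment hd x z (m - 1) n).const_mul (m * ‖x‖ ^ 2)).add
      ((integrable_gaussMoment hd x z m (n - 1)).const_mul (n * inner ℝ x z))
    refine this.congr (Filter.Eventually.of_forall fun y => ?_)
    simp only [Pi.add_apply]; ring
  · refine (integrable_gaussMoment hd x z (m + 1) n).neg.congr
      (Filter.Eventually.of_forall fun y => ?_)
    simp only [Pi.neg_apply, ContinuousLinearMap.mul_apply']; ring
  · intro y _
    have := ((hL x y).pow m).mul ((hL z y).pow n)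
    refine HasDerivAt.congr_deriv (this) ?_
    simp only [zero_smul, add_zero, Pi.pow_apply]
    rw [real_inner_self_eq_norm_sq, real_inner_comm x z]
    ring
  · intro y _
    exact hN y

/-- The recursion for the mixed moments of two linear functionals over the sphere. -/
theorem sphereMoment_succ {d : ℕ} (hd : 2 ≤ d) (x z : EuclideanSpace ℝ (Fin d)) (hx : ‖x‖ = 1)
    (m n : ℕ) :
    (m + n + d - 1) * sphereMoment x z (m + 1) n = m * sphereMoment x z (m - 1) n +
      n * inner ℝ x z * sphereMoment x z m (n - 1) := by
  have h := gaussMoment_succ hd x z m n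
  simp only [gaussMoment_eq hd, hx] at h
  -- The terms on the right have degree m+n-1, which is not a natural number when m = n = 0; in that
  -- case the right-hand side vanishes. Otherwise the left has degree two more, and the ratio of
  -- radial moments supplies the factor m+n+d-1.
  rcases Nat.eq_zero_or_pos (m + n) with h0 | h0
  · obtain ⟨rfl, rfl⟩ : m = 0 ∧ n = 0 := by omega
    have := (radialMoment_pos hd (0 + 1 + 0)).ne'
    simp_all
  · obtain ⟨N, hN⟩ : ∃ N, m + n = N + 1 := ⟨m + n - 1, by omega⟩
    have hp := radialMoment_pos hd N
    have e1 : radialMoment d (m + 1 + n) = (N + d) * radialMoment d N := by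
      rw [show m + 1 + n = N + 2 by omega, radialMoment_add_two hd]
    -- Truncation in `m - 1` only occurs at m = 0, where the coefficient kills the term; `e3` is the
    -- same for n.
    have e2 : (m : ℝ) * (sphereMoment x z (m - 1) n * radialMoment d (m - 1 + n)) =
        m * sphereMoment x z (m - 1) n * radialMoment d N := by
      rcases m with _ | m
      · simp
      · rw [show m + 1 - 1 + n = N by omega]; ring
    have e3 : (n : ℝ) * (sphereMoment x z m (n - 1) * radialMoment d (m + (n - 1))) =
        n * sphereMoment x z m (n - 1) * radialMoment d N := by
      rcases n with _ | n
      · simp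
      · rw [show m + (n + 1 - 1) = N by omega]; ring
    have hN' : (m : ℝ) + n = N + 1 := by exact_mod_cast hN
    apply mul_right_cancel₀ hp.ne'
    rw [hN']
    rw [e1] at h
    linear_combination h + e2 + inner ℝ x z * e3

/-! ### Recurrence and derivative relation for Legendre polynomials. -/

section Legendre

variable {d : ℕ}

theorem legendrePoly_zero : legendrePoly d 0 = 1 := by rw [legendrePoly]

theorem legendrePoly_one : legendrePoly d 1 = X := by rw [legendrePoly]

/-- The index is shifted by one against the definition so that k = 0 is included: there the
coefficient of the junk term with index `k - 1` is zero. -/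
theorem legendrePoly_recurrence (hd : 2 ≤ d) (k : ℕ) :
    C ((k : ℝ) + d - 2) * legendrePoly d (k + 1) =
      C (2 * (k : ℝ) + d - 2) * X * legendrePoly d k - C (k : ℝ) * legendrePoly d (k - 1) := by
  rcases k with _ | k
  · rw [legendrePoly_zero, legendrePoly_one]; simp
  · have hd' : (2 : ℝ) ≤ d := by exact_mod_cast hd
    have h : (k : ℝ) + d - 1 ≠ 0 := by
      have := Nat.cast_nonneg (α := ℝ) k; linarith
    rw [show k + 1 + 1 = k + 2 from rfl, legendrePoly, ← mul_assoc, ← C_mul]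
    push_cast
    rw [show (k : ℝ) + 1 + d - 2 = k + d - 1 by ring, mul_inv_cancel₀ h,
      show 2 * ((k : ℝ) + 1) + d - 2 = 2 * k + d by ring]
    simp

/-- Here and in later lemmas, two consecutive indices are treated together because the recurrence
has two steps. -/
theorem natDegree_legendrePoly_le (k : ℕ) :
    (legendrePoly d k).natDegree ≤ k ∧ (legendrePoly d (k + 1)).natDegree ≤ k + 1 := by
  induction k with
  | zero => simp [legendrePoly_zero, legendrePoly_one]
  | succ k ih =>
    refine ⟨ih.2, ?_⟩
    rw [show k + 1 + 1 = k + 2 from rfl, legendrePoly]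
    refine (natDegree_C_mul_le _ _).trans ((natDegree_sub_le _ _).trans (max_le ?_ ?_))
    · rw [mul_assoc]
      refine (natDegree_C_mul_le _ _).trans (natDegree_mul_le.trans ?_)
      have := natDegree_X_le (R := ℝ)
      omega
    · exact (natDegree_C_mul_le _ _).trans (by omega)

theorem eval_one_legendrePoly (hd : 2 ≤ d) (k : ℕ) :
    (legendrePoly d k).eval 1 = 1 ∧ (legendrePoly d (k + 1)).eval 1 = 1 := by
  induction k with
  | zero => simp [legendrePoly_zero, legendrePoly_one]
  | succ k ih =>
    refine ⟨ih.2, ?_⟩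
    have hd' : (2 : ℝ) ≤ d := by exact_mod_cast hd
    have h : (k : ℝ) + d - 1 ≠ 0 := by
      have := Nat.cast_nonneg (α := ℝ) k; linarith
    have := congrArg (eval 1) (legendrePoly_recurrence hd (k + 1))
    simp only [eval_mul, eval_sub, eval_C, eval_X, ih.2, Nat.add_sub_cancel, ih.1] at this
    push_cast at this
    apply mul_left_cancel₀ h
    linear_combination this

/-- Differentiate the three-term recurrence, multiply by 1 - X² and eliminate with the two previous
cases. The relation removes the derivative from `zonalPairing_recursion` when g is a Legendre
polynomial. -/
theorem legendrePoly_derivative (hd : 2 ≤ d) (k : ℕ) :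
    (1 - X ^ 2) * derivative (legendrePoly d k) =
        C (k : ℝ) * (legendrePoly d (k - 1) - X * legendrePoly d k) ∧
      (1 - X ^ 2) * derivative (legendrePoly d (k + 1)) =
        C ((k : ℝ) + 1) * (legendrePoly d k - X * legendrePoly d (k + 1)) := by
  induction k with
  | zero => simp [legendrePoly_zero, legendrePoly_one, sq]
  | succ k ih =>
    refine ⟨by simpa using ih.2, ?_⟩
    have hd' : (2 : ℝ) ≤ d := by exact_mod_cast hd
    have h : (k : ℝ) + d - 1 ≠ 0 := by
      have := Nat.cast_nonneg (α := ℝ) k; linarith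
    have hC : (C ((k : ℝ) + d - 1) : ℝ[X]) ≠ 0 := C_ne_zero.mpr h
    have h1 := legendrePoly_recurrence hd (k + 1)
    have h0 := legendrePoly_recurrence hd k
    have h2 := congrArg derivative h1
    simp only [derivative_mul, derivative_sub, derivative_C, derivative_X, zero_mul, zero_add,
      mul_one, Nat.add_sub_cancel] at h2 h1
    obtain ⟨ih1, ih2⟩ := ih
    apply mul_left_cancel₀ hC
    simp only [C_add, C_sub, C_mul, C_1, Nat.cast_add, Nat.cast_one, C_ofNat] at *
    set K : ℝ[X] := C (k : ℝ)
    set D : ℝ[X] := C (d : ℝ)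
    linear_combination (1 - X ^ 2) * h2 + (2 * (K + 1) + D - 2) * X * ih2 - (K + 1) * ih1
      - (K + 1) * h0 + X * (K + 2) * h1

end Legendre

/-! ### The Funk–Hecke formula for monomials and its coefficients. -/

section Moments

variable {d : ℕ}

theorem integrable_of_continuous {F : Type*} [NormedAddCommGroup F] {f : USphere d → F}
    (hf : Continuous f) : Integrable f (surfaceMeasure d) :=
  hf.integrable_of_hasCompactSupport (HasCompactSupport.of_compactSpace f)

/-- The bilinear form `(f, g) ↦ ∫ f(x · ω) g(z · ω) dσ(ω)` on polynomials. -/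
noncomputable def zonalPairing (x z : EuclideanSpace ℝ (Fin d)) : ℝ[X] →ₗ[ℝ] ℝ[X] →ₗ[ℝ] ℝ :=
  LinearMap.mk₂ ℝ (fun f g => ∫ ω : USphere d, f.eval (inner ℝ x (ω : EuclideanSpace ℝ (Fin d))) *
      g.eval (inner ℝ z (ω : EuclideanSpace ℝ (Fin d))) ∂(surfaceMeasure d))
    (fun f f' g => by
      simp only [eval_add, add_mul]
      exact integral_add (integrable_of_continuous (by fun_prop))
        (integrable_of_continuous (by fun_prop)))
    (fun c f g => by
      simp only [eval_smul, smul_eq_mul, mul_assoc]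
      exact integral_const_mul _ _)
    (fun f g g' => by
      simp only [eval_add, mul_add]
      exact integral_add (integrable_of_continuous (by fun_prop))
        (integrable_of_continuous (by fun_prop)))
    (fun c f g => by
      simp only [eval_smul, smul_eq_mul, mul_left_comm _ c]
      exact integral_const_mul _ _)

theorem zonalPairing_apply (x z : EuclideanSpace ℝ (Fin d)) (f g : ℝ[X]) :
    zonalPairing x z f g = ∫ ω : USphere d, f.eval (inner ℝ x (ω : EuclideanSpace ℝ (Fin d))) *
      g.eval (inner ℝ z (ω : EuclideanSpace ℝ (Fin d))) ∂(surfaceMeasure d) := rfl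

theorem zonalPairing_comm (x z : EuclideanSpace ℝ (Fin d)) (f g : ℝ[X]) :
    zonalPairing x z f g = zonalPairing z x g f := by
  simp only [zonalPairing_apply, mul_comm]

theorem zonalPairing_C_mul_left (x z : EuclideanSpace ℝ (Fin d)) (c : ℝ) (f g : ℝ[X]) :
    zonalPairing x z (C c * f) g = c * zonalPairing x z f g := by
  rw [← smul_eq_C_mul, map_smul, LinearMap.smul_apply, smul_eq_mul]

theorem zonalPairing_C_mul_right (x z : EuclideanSpace ℝ (Fin d)) (c : ℝ) (f g : ℝ[X]) :
    zonalPairing x z f (C c * g) = c * zonalPairing x z f g := by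
  rw [← smul_eq_C_mul, map_smul, smul_eq_mul]

theorem zonalPairing_X_mul (x : EuclideanSpace ℝ (Fin d)) (f g : ℝ[X]) :
    zonalPairing x x (X * f) g = zonalPairing x x f (X * g) := by
  simp only [zonalPairing_apply, eval_mul, eval_X]
  congr 1; ext ω; ring

theorem zonalPairing_X_pow (x z : EuclideanSpace ℝ (Fin d)) (m n : ℕ) :
    zonalPairing x z (X ^ m) (X ^ n) = sphereMoment x z m n := by
  simp [zonalPairing_apply, sphereMoment]

/-- Linear extension of `sphereMoment_succ` from monomials in the z-variable to arbitrary
polynomials g; lowering an exponent becomes differentiation. -/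
theorem zonalPairing_recursion (hd : 2 ≤ d) (x z : EuclideanSpace ℝ (Fin d)) (hz : ‖z‖ = 1) (m : ℕ)
    (g : ℝ[X]) :
    zonalPairing x z (X ^ m) (X * (X * derivative g + C ((m : ℝ) + d - 1) * g)) =
      zonalPairing x z (X ^ m) (derivative g) +
        m * inner ℝ x z * zonalPairing x z (X ^ (m - 1)) g := by
  induction g using Polynomial.induction_on' with
  | add p q hp hq =>
    have e : X * (X * derivative (p + q) + C ((m : ℝ) + d - 1) * (p + q)) =
        X * (X * derivative p + C ((m : ℝ) + d - 1) * p) +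
        X * (X * derivative q + C ((m : ℝ) + d - 1) * q) := by
      rw [derivative_add]; ring
    rw [e, map_add, hp, hq, derivative_add, map_add, map_add]
    ring
  | monomial n a =>
    have h := sphereMoment_succ hd z x hz n m
    have hs : ∀ i j, sphereMoment z x i j = zonalPairing x z (X ^ j) (X ^ i) := fun i j => by
      rw [zonalPairing_comm, zonalPairing_X_pow]
    simp only [hs] at h
    have e1 : X * (X * derivative (monomial n a) + C ((m : ℝ) + d - 1) * monomial n a) =
        C (a * (n + m + d - 1)) * X ^ (n + 1) := by
      rw [derivative_monomial, ← C_mul_X_pow_eq_monomial, ← C_mul_X_pow_eq_monomial]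
      rcases n with _ | n
      · simp; ring
      · simp only [Nat.add_sub_cancel, C_add, C_sub, C_mul, C_1, Nat.cast_add, Nat.cast_one]
        ring
    have e2 : derivative (monomial n a) = C (a * n) * X ^ (n - 1) := by
      rw [derivative_monomial, C_mul_X_pow_eq_monomial]
    rw [e1, e2, ← C_mul_X_pow_eq_monomial, zonalPairing_C_mul_right, zonalPairing_C_mul_right,
      zonalPairing_C_mul_right]
    rw [real_inner_comm] at h
    linear_combination a * h

/-- The moments `∫ (e · ω)^n dσ(ω)`, `e` a unit vector. -/
noncomputable def axialMoment (d : ℕ) : ℕ → ℝ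
  | 0 => (surfaceMeasure d).real Set.univ
  | 1 => 0
  | n + 2 => (n + 1) / (n + d) * axialMoment d n

/-- The Funk–Hecke coefficients `∫ (e · ω)^n P_{k,d}(e · ω) dσ(ω)`, `e` a unit vector. -/
noncomputable def funkHeckeCoef (d : ℕ) : ℕ → ℕ → ℝ
  | n, 0 => axialMoment d n
  | n, k + 1 => (n + 1 - k) / (n + 1) * funkHeckeCoef d (n + 1) k

theorem sphereMoment_zero_right (hd : 2 ≤ d) (x z : EuclideanSpace ℝ (Fin d)) (hx : ‖x‖ = 1) (m : ℕ) :
    sphereMoment x z m 0 = axialMoment d m ∧ sphereMoment x z (m + 1) 0 = axialMoment d (m + 1) := by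
  have hd' : (2 : ℝ) ≤ d := by exact_mod_cast hd
  induction m with
  | zero =>
    constructor
    · simp [sphereMoment, axialMoment]
    · have := sphereMoment_succ hd x z hx 0 0
      simp only [Nat.cast_zero, zero_mul, add_zero, zero_add] at this
      rcases mul_eq_zero.mp this with h | h
      · linarith
      · simpa [axialMoment] using h
  | succ m ih =>
    refine ⟨ih.2, ?_⟩
    have := sphereMoment_succ hd x z hx (m + 1) 0
    simp only [Nat.cast_zero, zero_mul, add_zero, Nat.add_sub_cancel, ih.1, Nat.cast_add,
      Nat.cast_one] at this
    rw [axialMoment]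
    have h0 : (m : ℝ) + d ≠ 0 := by have := Nat.cast_nonneg (α := ℝ) m; linarith
    rw [div_mul_eq_mul_div, eq_div_iff h0]
    linear_combination this

/-- A second relation between neighbouring coefficients, raising both indices. Together with the
defining one it expresses everything in the moment recursion through a single coefficient. -/
theorem funkHeckeCoef_eq_mul_succ (hd : 2 ≤ d) (k n : ℕ) :
    funkHeckeCoef d n k = (n + k + d) / (n + 1) * funkHeckeCoef d (n + 1) (k + 1) := by
  have hd' : (2 : ℝ) ≤ d := by exact_mod_cast hd
  induction k generalizing n with
  | zero =>
    have h0 : (n : ℝ) + d ≠ 0 := by have := Nat.cast_nonneg (α := ℝ) n; linarith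
    have h1 : (n : ℝ) + 1 ≠ 0 := by positivity
    have h2 : (n : ℝ) + 1 + 1 ≠ 0 := by positivity
    simp only [funkHeckeCoef, axialMoment, Nat.cast_add, Nat.cast_one, Nat.cast_zero]
    field_simp
    ring
  | succ k ih =>
    have h1 : (n : ℝ) + 1 ≠ 0 := by positivity
    have h2 : (n : ℝ) + 1 + 1 ≠ 0 := by positivity
    have e := ih (n + 1)
    rw [funkHeckeCoef, e, funkHeckeCoef.eq_2 d (n + 1) (k + 1)]
    push_cast
    field_simp
    ring

theorem axialMoment_two_mul (hd : 2 ≤ d) (j : ℕ) :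
    axialMoment d (2 * j) = (surfaceMeasure d).real Set.univ * Real.Gamma (d / 2) * (2 * j)! /
      (2 ^ (2 * j) * j ! * Real.Gamma (j + d / 2)) := by
  have hd' : (2 : ℝ) ≤ d := by exact_mod_cast hd
  induction j with
  | zero =>
    have := (Real.Gamma_pos_of_pos (s := (d : ℝ) / 2) (by linarith)).ne'
    simp [axialMoment]
    field_simp
  | succ j ih =>
    have h0 : 0 < (j : ℝ) + d / 2 := by positivity
    have h1 := (Real.Gamma_pos_of_pos h0).ne'
    rw [show 2 * (j + 1) = 2 * j + 2 by ring, axialMoment, ih, Nat.factorial_succ,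
      Nat.factorial_succ (2 * j), Nat.factorial_succ j]
    push_cast
    rw [show (j : ℝ) + 1 + d / 2 = j + d / 2 + 1 by ring, Real.Gamma_add_one h0.ne']
    have h2 : (2 * j + d : ℝ) ≠ 0 := by positivity
    field_simp
    ring

theorem axialMoment_odd (j : ℕ) : axialMoment d (2 * j + 1) = 0 := by
  induction j with
  | zero => simp [axialMoment]
  | succ j ih => rw [show 2 * (j + 1) + 1 = (2 * j + 1) + 2 by ring, axialMoment, ih, mul_zero]

/-- Only n = k, k+2, k+4, … survive: smaller n by orthogonality to lower degrees, the wrong parity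
by symmetry. In the recursion the former comes from the factor n+1-k, the latter from the odd axial
moments. -/
theorem funkHeckeCoef_eq_zero {n k : ℕ} (h : ∀ j, n ≠ k + 2 * j) : funkHeckeCoef d n k = 0 := by
  induction k generalizing n with
  | zero =>
    rw [funkHeckeCoef]
    obtain ⟨j, hj⟩ : ∃ j, n = 2 * j + 1 := by
      rcases Nat.even_or_odd' n with ⟨j, hj | hj⟩
      · exact absurd (by omega) (h j)
      · exact ⟨j, hj⟩
    rw [hj, axialMoment_odd]
  | succ k ih =>
    rw [funkHeckeCoef]
    by_cases hk : n + 1 = k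
    · rw [← hk]; simp
    · rw [ih, mul_zero]
      intro j hj
      rcases j with _ | j
      · omega
      · exact h j (by omega)

/-- The factorial in the numerator cancels the one of the exponential series, which leaves the power
series of a Bessel function. -/
theorem funkHeckeCoef_add_two_mul (hd : 2 ≤ d) (k j : ℕ) :
    funkHeckeCoef d (k + 2 * j) k = (surfaceMeasure d).real Set.univ * Real.Gamma (d / 2) *
      (k + 2 * j)! / (2 ^ (k + 2 * j) * j ! * Real.Gamma (j + k + d / 2)) := by
  have hd' : (2 : ℝ) ≤ d := by exact_mod_cast hd
  induction k generalizing j with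
  | zero => simpa [funkHeckeCoef] using axialMoment_two_mul hd j
  | succ k ih =>
    rw [funkHeckeCoef, show k + 1 + 2 * j + 1 = k + 2 * (j + 1) by ring, ih,
      show k + 2 * (j + 1) = (k + 1 + 2 * j) + 1 by ring, Nat.factorial_succ,
      Nat.factorial_succ j]
    push_cast
    have h0 : 0 < (j : ℝ) + (k + 1) + d / 2 := by positivity
    rw [show (j : ℝ) + 1 + k + d / 2 = j + (k + 1) + d / 2 by ring]
    have h1 := (Real.Gamma_pos_of_pos h0).ne'
    have h2 : (k + 1 + 2 * j + 1 : ℝ) ≠ 0 := by positivity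
    field_simp
    ring

/-- The Funk–Hecke formula for monomials. -/
theorem zonalPairing_X_pow_legendrePoly (hd : 2 ≤ d) (x z : EuclideanSpace ℝ (Fin d)) (hx : ‖x‖ = 1)
    (hz : ‖z‖ = 1) (k : ℕ) :
    (∀ m, zonalPairing x z (X ^ m) (legendrePoly d k) =
        funkHeckeCoef d m k * (legendrePoly d k).eval (inner ℝ x z)) ∧
    (∀ m, zonalPairing x z (X ^ m) (legendrePoly d (k + 1)) =
        funkHeckeCoef d m (k + 1) * (legendrePoly d (k + 1)).eval (inner ℝ x z)) := by
  have hd' : (2 : ℝ) ≤ d := by exact_mod_cast hd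
  -- two expressions for the coefficients that occur in the recursion
  have hA : ∀ m k : ℕ, (m : ℝ) * funkHeckeCoef d (m - 1) k =
      (m + k + d - 1) * funkHeckeCoef d m (k + 1) := by
    intro m k
    rcases m with _ | m
    · simp [funkHeckeCoef_eq_zero (n := 0) (k := k + 1) (by omega)]
    · rw [Nat.add_sub_cancel, funkHeckeCoef_eq_mul_succ hd k m]
      have h1 : (m : ℝ) + 1 ≠ 0 := by positivity
      push_cast
      field_simp
      ring
  have hB : ∀ m k : ℕ, ((m : ℝ) - k) * funkHeckeCoef d m k =
      (m + k + d) * funkHeckeCoef d m (k + 2) := by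
    intro m k
    rw [funkHeckeCoef_eq_mul_succ hd k m, funkHeckeCoef.eq_2 d m (k + 1)]
    push_cast
    field_simp
    ring
  induction k with
  | zero =>
    constructor
    · intro m
      rw [legendrePoly_zero, ← pow_zero X, zonalPairing_X_pow,
        (sphereMoment_zero_right hd x z hx m).1]
      simp [funkHeckeCoef]
    · intro m
      have h := zonalPairing_recursion hd x z hz m 1
      rw [derivative_one, map_zero, mul_zero, zero_add, mul_one, mul_comm X,
        zonalPairing_C_mul_right, ← pow_zero X, zonalPairing_X_pow,
        (sphereMoment_zero_right hd x z hx _).1, zero_add] at h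
      rw [legendrePoly_one, eval_X]
      have h0 : (m : ℝ) + d - 1 ≠ 0 := by have := Nat.cast_nonneg (α := ℝ) m; linarith
      apply mul_left_cancel₀ h0
      have hA' := hA m 0
      rw [funkHeckeCoef] at hA'
      push_cast at hA'
      linear_combination h + inner ℝ x z * hA'
  | succ k ih =>
    refine ⟨ih.2, fun m => ?_⟩
    have h := zonalPairing_recursion hd x z hz m (legendrePoly d (k + 1))
    have hD := (legendrePoly_derivative hd k).2
    have hR := legendrePoly_recurrence hd (k + 1)
    rw [Nat.add_sub_cancel] at hR
    -- The derivative relation and the recurrence reduce the operator of `zonalPairing_recursion`,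
    -- applied to the polynomial of index k+1, to a combination of those of indices k+2 and k. The
    -- formula for k+2 thus follows from the two already known.
    have e : C ((2 * (k : ℝ) + d)) * (X * (X * derivative (legendrePoly d (k + 1)) +
          C ((m : ℝ) + d - 1) * legendrePoly d (k + 1)) - derivative (legendrePoly d (k + 1))) =
        C (((m : ℝ) + k + d) * (k + d - 1)) * legendrePoly d (k + 2) +
        C (((k : ℝ) + 1) * (m - k)) * legendrePoly d k := by
      simp only [C_add, C_sub, C_mul, C_1, Nat.cast_add, Nat.cast_one, C_ofNat] at *
      linear_combination (- (2 * C (k : ℝ) + C (d : ℝ))) * hD -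
        (C (m : ℝ) + C (k : ℝ) + C (d : ℝ)) * hR
    have h2 := congrArg (zonalPairing x z (X ^ m)) e
    rw [zonalPairing_C_mul_right, map_sub, map_add, zonalPairing_C_mul_right,
      zonalPairing_C_mul_right, h, ih.1, ih.2] at h2
    have hRe := congrArg (eval (inner ℝ x z)) hR
    simp only [eval_mul, eval_sub, eval_C, eval_X] at hRe
    have h0 : ((m : ℝ) + k + d) * (k + d - 1) ≠ 0 := by
      have h1 := Nat.cast_nonneg (α := ℝ) m
      have h2 := Nat.cast_nonneg (α := ℝ) k
      have : 0 < (m : ℝ) + k + d := by linarith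
      have : 0 < (k : ℝ) + d - 1 := by linarith
      positivity
    apply mul_left_cancel₀ h0
    have hA' := hA m (k + 1)
    have hB' := hB m k
    push_cast at hA' hB' hRe
    rw [show k + 1 + 1 = k + 2 from rfl] at *
    linear_combination -h2 + (2 * k + d) * inner ℝ x z * (legendrePoly d (k + 1)).eval (inner ℝ x z) * hA'
      - (k + 1) * (legendrePoly d k).eval (inner ℝ x z) * hB'
      - (m + k + d) * funkHeckeCoef d m (k + 2) * hRe

end Moments

/-! ### Orthogonality and norms of the zonal kernels. -/

section ZonalOrthogonality

variable {d : ℕ}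

theorem surfaceMeasure_real_univ_pos (hd : 2 ≤ d) : 0 < (surfaceMeasure d).real Set.univ := by
  have := nontrivial_euclideanSpace hd
  have h : surfaceMeasure d ≠ 0 := Measure.toSphere_ne_zero _
  exact ENNReal.toReal_pos (by simpa using h) (measure_ne_top _ _)

theorem harmonicDim_zero : harmonicDim d 0 = 1 := by simp [harmonicDim]

theorem harmonicDim_one (hd : 2 ≤ d) : harmonicDim d 1 = d := by
  have := Nat.factorial_ne_zero (d - 2)
  rw [harmonicDim, if_neg one_ne_zero, show 1 + d - 3 = d - 2 by omega]
  simp only [Nat.factorial_one, Nat.cast_one]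
  field_simp
  ring

theorem harmonicDim_add_two (hd : 2 ≤ d) (k : ℕ) :
    (2 * k + d) * (k + 2) * harmonicDim d (k + 2) =
      (2 * k + 2 + d) * (k + d - 1) * harmonicDim d (k + 1) := by
  have h := Nat.factorial_ne_zero (d - 2)
  have h2 := Nat.factorial_ne_zero k
  obtain ⟨e, rfl⟩ := Nat.exists_eq_add_of_le' hd
  rw [harmonicDim, if_neg (by omega), harmonicDim, if_neg (by omega),
    show k + 2 + (e + 2) - 3 = (k + e) + 1 by omega, show k + 1 + (e + 2) - 3 = k + e by omega,
    Nat.factorial_succ, Nat.factorial_succ (k + 1), Nat.factorial_succ k]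
  push_cast
  field_simp
  ring

theorem harmonicDim_pos (hd : 2 ≤ d) (k : ℕ) : 0 < harmonicDim d k := by
  have hd' : (2 : ℝ) ≤ d := by exact_mod_cast hd
  unfold harmonicDim
  split_ifs with h
  · exact one_pos
  · have : (1 : ℝ) ≤ k := by exact_mod_cast Nat.one_le_iff_ne_zero.mpr h
    have : 0 < 2 * (k : ℝ) + d - 2 := by linarith
    positivity

/-- Linearity extends Funk–Hecke from monomials to all g. The scalar is identified by taking x = z,
since the Legendre polynomial is 1 at 1. -/
theorem zonalPairing_legendrePoly_right (hd : 2 ≤ d) (x z : EuclideanSpace ℝ (Fin d))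
    (hx : ‖x‖ = 1) (hz : ‖z‖ = 1) (k : ℕ) (g : ℝ[X]) :
    zonalPairing x z g (legendrePoly d k) =
      zonalPairing z z g (legendrePoly d k) * (legendrePoly d k).eval (inner ℝ x z) := by
  induction g using Polynomial.induction_on' with
  | add p q hp hq => simp only [map_add, LinearMap.add_apply, hp, hq, add_mul]
  | monomial n a =>
    rw [← C_mul_X_pow_eq_monomial, zonalPairing_C_mul_left, zonalPairing_C_mul_left,
      (zonalPairing_X_pow_legendrePoly hd x z hx hz k).1,
      (zonalPairing_X_pow_legendrePoly hd z z hz hz k).1, real_inner_self_eq_norm_sq, hz, one_pow,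
      (eval_one_legendrePoly hd k).1, mul_one, mul_assoc]

theorem zonalPairing_self_X_pow (hd : 2 ≤ d) (z : EuclideanSpace ℝ (Fin d)) (hz : ‖z‖ = 1)
    (n k : ℕ) : zonalPairing z z (X ^ n) (legendrePoly d k) = funkHeckeCoef d n k := by
  rw [(zonalPairing_X_pow_legendrePoly hd z z hz hz k).1, real_inner_self_eq_norm_sq, hz, one_pow,
      (eval_one_legendrePoly hd k).1, mul_one]

/-- The first factor is a combination of powers below k, and their Funk–Hecke coefficients of degree
k vanish. -/
theorem zonalPairing_self_eq_zero_of_lt (hd : 2 ≤ d) (z : EuclideanSpace ℝ (Fin d)) (hz : ‖z‖ = 1)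
    {j k : ℕ} (h : j < k) : zonalPairing z z (legendrePoly d j) (legendrePoly d k) = 0 := by
  have hdeg := (natDegree_legendrePoly_le (d := d) j).1
  rw [(legendrePoly d j).as_sum_range_C_mul_X_pow' (n := k) (by omega), map_sum,
    LinearMap.sum_apply]
  refine Finset.sum_eq_zero fun i hi => ?_
  rw [zonalPairing_C_mul_left, zonalPairing_self_X_pow hd z hz, funkHeckeCoef_eq_zero, mul_zero]
  intro j hj
  have := Finset.mem_range.mp hi
  omega

theorem zonalPairing_self_eq_zero (hd : 2 ≤ d) (z : EuclideanSpace ℝ (Fin d)) (hz : ‖z‖ = 1)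
    {j k : ℕ} (h : j ≠ k) : zonalPairing z z (legendrePoly d j) (legendrePoly d k) = 0 := by
  rcases lt_or_gt_of_ne h with h | h
  · exact zonalPairing_self_eq_zero_of_lt hd z hz h
  · rw [zonalPairing_comm]; exact zonalPairing_self_eq_zero_of_lt hd z hz h

/-- Pair the recurrence at k+1 with the polynomial of index k+2, and the recurrence at k+2 with that
of index k+1. By orthogonality and symmetry of multiplication by X, both leave the same cross term;
eliminating it gives the ratio of consecutive norms, which is the inverse ratio of the dimensions.
-/
theorem zonalPairing_self_legendrePoly (hd : 2 ≤ d) (z : EuclideanSpace ℝ (Fin d)) (hz : ‖z‖ = 1)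
    (k : ℕ) :
    zonalPairing z z (legendrePoly d k) (legendrePoly d k) =
        (surfaceMeasure d).real Set.univ / harmonicDim d k ∧
      zonalPairing z z (legendrePoly d (k + 1)) (legendrePoly d (k + 1)) =
        (surfaceMeasure d).real Set.univ / harmonicDim d (k + 1) := by
  have hd' : (2 : ℝ) ≤ d := by exact_mod_cast hd
  induction k with
  | zero =>
    constructor
    · nth_rewrite 1 [legendrePoly_zero]
      rw [← pow_zero X, zonalPairing_self_X_pow hd z hz, funkHeckeCoef, axialMoment,
        harmonicDim_zero, div_one]
    · nth_rewrite 1 [zero_add, legendrePoly_one]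
      rw [← pow_one X, zonalPairing_self_X_pow hd z hz, harmonicDim_one hd]
      simp only [funkHeckeCoef, axialMoment, Nat.cast_one, Nat.cast_zero]
      field_simp
      ring
  | succ k ih =>
    refine ⟨ih.2, ?_⟩
    have hk := Nat.cast_nonneg (α := ℝ) k
    have h1 := congrArg (fun p => zonalPairing z z p (legendrePoly d (k + 2)))
      (legendrePoly_recurrence hd (k + 1))
    have h2 := congrArg (fun p => zonalPairing z z p (legendrePoly d (k + 1)))
      (legendrePoly_recurrence hd (k + 2))
    simp only [LinearMap.map_sub, LinearMap.sub_apply, mul_assoc, zonalPairing_C_mul_left,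
      Nat.add_sub_cancel] at h1 h2
    rw [show k + 2 - 1 = k + 1 by omega] at h2
    rw [zonalPairing_self_eq_zero hd z hz (show k ≠ k + 2 by omega)] at h1
    rw [zonalPairing_X_mul, zonalPairing_comm z z (legendrePoly d (k + 2)),
      zonalPairing_self_eq_zero hd z hz (show k + 2 + 1 ≠ k + 1 by omega), ih.2] at h2
    have hN1 := harmonicDim_pos hd (k + 1)
    have hN2 := harmonicDim_pos hd (k + 2)
    have hN := harmonicDim_add_two hd k
    have e0 : ((k : ℝ) + d - 1) * (2 * k + d + 2) ≠ 0 := by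
      have : 0 < (k : ℝ) + d - 1 := by linarith
      positivity
    rw [show k + 1 + 1 = k + 2 from rfl] at *
    rw [eq_div_iff hN2.ne']
    apply mul_left_cancel₀ e0
    have e1 := eq_div_iff hN1.ne' |>.mp (show (surfaceMeasure d).real Set.univ /
      harmonicDim d (k + 1) = _ from rfl)
    set B := zonalPairing z z (X * legendrePoly d (k + 1)) (legendrePoly d (k + 2))
    set q := (surfaceMeasure d).real Set.univ / harmonicDim d (k + 1)
    push_cast at h1 h2
    have e2 : ((k : ℝ) + d - 1) * (2 * k + d + 2) *
        zonalPairing z z (legendrePoly d (k + 2)) (legendrePoly d (k + 2)) =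
        (2 * k + d) * (k + 2) * q := by
      linear_combination (2 * k + d + 2) * h1 - (2 * k + d) * h2
    linear_combination harmonicDim d (k + 2) * e2 + q * hN + (2 * k + 2 + d) * (k + d - 1) * e1

/-- Convolution of two zonal kernels; this is what makes the operators H_k mutually orthogonal
projections. -/
theorem zonalPairing_legendrePoly (hd : 2 ≤ d) (x z : EuclideanSpace ℝ (Fin d))
    (hx : ‖x‖ = 1) (hz : ‖z‖ = 1) (j k : ℕ) :
    zonalPairing x z (legendrePoly d j) (legendrePoly d k) =
      if j = k then (surfaceMeasure d).real Set.univ / harmonicDim d k *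
        (legendrePoly d k).eval (inner ℝ x z) else 0 := by
  rw [zonalPairing_legendrePoly_right hd x z hx hz]
  split_ifs with h
  · rw [h, (zonalPairing_self_legendrePoly hd z hz k).1]
  · rw [zonalPairing_self_eq_zero hd z hz h, zero_mul]

end ZonalOrthogonality

/-! ### The Funk–Hecke formula for exponentials. -/

section Exponential

variable {d : ℕ}

theorem axialMoment_mem_Icc (hd : 2 ≤ d) (n : ℕ) :
    axialMoment d n ∈ Set.Icc 0 ((surfaceMeasure d).real Set.univ) ∧
      axialMoment d (n + 1) ∈ Set.Icc 0 ((surfaceMeasure d).real Set.univ) := by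
  have hd' : (2 : ℝ) ≤ d := by exact_mod_cast hd
  have hS := (surfaceMeasure_real_univ_pos hd).le
  induction n with
  | zero => simp [axialMoment, hS]
  | succ n ih =>
    refine ⟨ih.2, ?_⟩
    rw [axialMoment]
    have h1 : ((n : ℝ) + 1) / (n + d) ≤ 1 := by
      rw [div_le_one (by positivity)]; linarith
    exact ⟨mul_nonneg (by positivity) ih.1.1,
      (mul_le_of_le_one_left ih.1.1 h1).trans ih.1.2⟩

/-- Each step of the recursion multiplies by a factor in [0,1], unless k > n+1, where the
coefficient is zero. -/
theorem funkHeckeCoef_mem_Icc (hd : 2 ≤ d) (n k : ℕ) :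
    funkHeckeCoef d n k ∈ Set.Icc 0 ((surfaceMeasure d).real Set.univ) := by
  induction k generalizing n with
  | zero => exact (axialMoment_mem_Icc hd n).1
  | succ k ih =>
    rw [funkHeckeCoef]
    by_cases h : k ≤ n + 1
    · have h' : (k : ℝ) ≤ n + 1 := by exact_mod_cast h
      have hk := Nat.cast_nonneg (α := ℝ) k
      have h0 : 0 ≤ ((n : ℝ) + 1 - k) / (n + 1) := div_nonneg (by linarith) (by positivity)
      have h1 : ((n : ℝ) + 1 - k) / (n + 1) ≤ 1 := by
        rw [div_le_one (by positivity)]; linarith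
      exact ⟨mul_nonneg h0 (ih _).1, (mul_le_of_le_one_left (ih _).1 h1).trans (ih _).2⟩
    · rw [funkHeckeCoef_eq_zero (by omega), mul_zero]
      exact ⟨le_rfl, (surfaceMeasure_real_univ_pos hd).le⟩

/-- The eigenvalue of the kernel `exp(z x · y)` on spherical harmonics of degree `k`; up to
normalisation, a Bessel function. -/
noncomputable def expMultiplier (d k : ℕ) (z : ℂ) : ℂ :=
  ∑' n : ℕ, z ^ n / n ! * (funkHeckeCoef d n k : ℂ)

theorem norm_expMultiplier_term_le (hd : 2 ≤ d) (k : ℕ) (z : ℂ) (n : ℕ) :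
    ‖z ^ n / n ! * (funkHeckeCoef d n k : ℂ)‖ ≤
      ‖z‖ ^ n / n ! * (surfaceMeasure d).real Set.univ := by
  have h := funkHeckeCoef_mem_Icc hd n k
  rw [norm_mul, norm_div, norm_pow, Complex.norm_natCast, Complex.norm_real, Real.norm_eq_abs,
    abs_of_nonneg h.1]
  gcongr
  exact h.2

theorem summable_expMultiplier (hd : 2 ≤ d) (k : ℕ) (z : ℂ) :
    Summable fun n : ℕ => z ^ n / n ! * (funkHeckeCoef d n k : ℂ) :=
  .of_norm_bounded ((Real.summable_pow_div_factorial ‖z‖).mul_right _)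
    (norm_expMultiplier_term_le hd k z)

/-- The first k terms vanish, and n! k! ≤ (n+k)! splits |z|^k / k! off the rest. This factorial
decay in k gives absolute convergence of every expansion below. -/
theorem norm_expMultiplier_le (hd : 2 ≤ d) (k : ℕ) (z : ℂ) :
    ‖expMultiplier d k z‖ ≤
      (surfaceMeasure d).real Set.univ * Real.exp ‖z‖ * (‖z‖ ^ k / k !) := by
  have hs := summable_expMultiplier hd k z
  have h0 : ∑ i ∈ Finset.range k, z ^ i / i ! * (funkHeckeCoef d i k : ℂ) = 0 :=
    Finset.sum_eq_zero fun i hi => by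
      have := Finset.mem_range.mp hi
      rw [funkHeckeCoef_eq_zero (by omega)]; simp
  have hE : HasSum (fun n : ℕ => ‖z‖ ^ n / n !) (Real.exp ‖z‖) := by
    rw [Real.exp_eq_exp_ℝ]; exact NormedSpace.expSeries_div_hasSum_exp _
  rw [expMultiplier, ← hs.sum_add_tsum_nat_add k, h0, zero_add]
  have hb := hE.mul_left ((surfaceMeasure d).real Set.univ * (‖z‖ ^ k / k !))
  refine (tsum_of_norm_bounded hb fun n => ?_).trans (le_of_eq (by ring))
  refine (norm_expMultiplier_term_le hd k z (n + k)).trans ?_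
  have hf : ((n ! * k ! : ℕ) : ℝ) ≤ (n + k)! := by
    exact_mod_cast Nat.le_of_dvd (Nat.factorial_pos _) (Nat.factorial_mul_factorial_dvd_factorial_add n k)
  have hS := (surfaceMeasure_real_univ_pos hd).le
  calc ‖z‖ ^ (n + k) / (n + k)! * (surfaceMeasure d).real Set.univ
      ≤ ‖z‖ ^ (n + k) / ((n ! * k ! : ℕ) : ℝ) * (surfaceMeasure d).real Set.univ := by
        gcongr
    _ = _ := by push_cast; rw [pow_add]; field_simp

theorem abs_inner_coe_le_one (x : EuclideanSpace ℝ (Fin d)) (hx : ‖x‖ ≤ 1) (ω : USphere d) :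
    |inner ℝ x (ω : EuclideanSpace ℝ (Fin d))| ≤ 1 := by
  have := abs_real_inner_le_norm x (ω : EuclideanSpace ℝ (Fin d))
  rw [USphere.norm_coe, mul_one] at this
  exact this.trans hx

/-- The Funk–Hecke formula for exponentials. -/
theorem integral_exp_mul_legendrePoly (hd : 2 ≤ d) (x y : EuclideanSpace ℝ (Fin d))
    (hx : ‖x‖ = 1) (hy : ‖y‖ = 1) (k : ℕ) (z : ℂ) :
    ∫ ω : USphere d, Complex.exp (z * ((inner ℝ x (ω : EuclideanSpace ℝ (Fin d)) : ℝ) : ℂ)) *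
      (((legendrePoly d k).eval (inner ℝ y (ω : EuclideanSpace ℝ (Fin d))) : ℝ) : ℂ)
      ∂(surfaceMeasure d) =
    expMultiplier d k z * (((legendrePoly d k).eval (inner ℝ x y) : ℝ) : ℂ) := by
  have hE : ∀ w : ℝ, HasSum (fun n : ℕ => w ^ n / n !) (Real.exp w) := fun w => by
    rw [Real.exp_eq_exp_ℝ]; exact NormedSpace.expSeries_div_hasSum_exp w
  have hEc : ∀ w : ℂ, HasSum (fun n : ℕ => w ^ n / n !) (Complex.exp w) := fun w => by
    rw [Complex.exp_eq_exp_ℂ]; exact NormedSpace.expSeries_div_hasSum_exp w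
  set t : USphere d → ℝ := fun ω => inner ℝ x (ω : EuclideanSpace ℝ (Fin d)) with ht
  set p : USphere d → ℝ := fun ω =>
    (legendrePoly d k).eval (inner ℝ y (ω : EuclideanSpace ℝ (Fin d))) with hp
  have htc : Continuous t := by fun_prop
  have hpc : Continuous p := by fun_prop
  have h1 := hasSum_integral_of_dominated_convergence (μ := surfaceMeasure d)
    (F := fun n ω => z ^ n / n ! * ((t ω ^ n * p ω : ℝ) : ℂ))
    (f := fun ω => Complex.exp (z * (t ω : ℂ)) * (p ω : ℂ))
    (fun n ω => ‖z‖ ^ n / n ! * |p ω|)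
    (fun n => Continuous.aestronglyMeasurable (by fun_prop))
    (fun n => Filter.Eventually.of_forall fun ω => by
      rw [norm_mul, norm_div, norm_pow, Complex.norm_natCast, Complex.norm_real, Real.norm_eq_abs,
        abs_mul, abs_pow]
      gcongr
      exact mul_le_of_le_one_left (abs_nonneg _)
        (pow_le_one₀ (abs_nonneg _) (abs_inner_coe_le_one x hx.le ω)))
    (Filter.Eventually.of_forall fun ω => ((hE ‖z‖).mul_right _).summable)
    (by
      simp_rw [fun ω => ((hE ‖z‖).mul_right |p ω|).tsum_eq]
      exact integrable_of_continuous (by fun_prop))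
    (Filter.Eventually.of_forall fun ω => by
      refine ((hEc (z * t ω)).mul_right (p ω : ℂ)).congr_fun fun n => ?_
      push_cast
      rw [mul_pow]; ring)
  have h2 := (summable_expMultiplier hd k z).hasSum.mul_right
    (((legendrePoly d k).eval (inner ℝ x y) : ℝ) : ℂ)
  refine h1.unique (h2.congr_fun fun n => ?_)
  have h3 := (zonalPairing_X_pow_legendrePoly hd x y hx hy k).1 n
  rw [zonalPairing_apply] at h3
  simp only [eval_pow, eval_X] at h3
  rw [integral_const_mul, integral_complex_ofReal, h3]
  push_cast
  ring

end Exponential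

/-! ### Gamma and Beta integrals, Gauss summation, and the value of the constant. -/

section GammaIntegrals

/-- Integrability is automatic, because the integral of a non-integrable function is 0 by convention
while c > 0. Passing to `lintegral` makes the later interchanges of sums and integrals
unconditional. -/
theorem lintegral_ofReal_of_integral_eq {f : ℝ → ℝ} {s : Set ℝ} (hs : MeasurableSet s)
    (hf : ∀ x ∈ s, 0 ≤ f x) {c : ℝ} (hc : 0 < c) (h : ∫ x in s, f x = c) :
    ∫⁻ x in s, ENNReal.ofReal (f x) = ENNReal.ofReal c := by
  have hi : IntegrableOn f s := by
    by_contra hi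
    exact hc.ne' (by rw [← h, integral_undef hi])
  rw [← h, ofReal_integral_eq_lintegral_ofReal hi
    ((ae_restrict_iff' hs).mpr (Filter.Eventually.of_forall hf))]

theorem lintegral_rpow_mul_exp_neg {a b : ℝ} (ha : 0 < a) (hb : 0 < b) :
    ∫⁻ t in Set.Ioi (0 : ℝ), ENNReal.ofReal (t ^ (a - 1) * Real.exp (-(b * t))) =
      ENNReal.ofReal ((1 / b) ^ a * Real.Gamma a) := by
  have := Real.Gamma_pos_of_pos ha
  exact lintegral_ofReal_of_integral_eq measurableSet_Ioi
    (fun t ht => mul_nonneg (Real.rpow_nonneg (le_of_lt ht) _) (Real.exp_nonneg _))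
    (by positivity) (Real.integral_rpow_mul_exp_neg_mul_Ioi ha hb)

/-- The Gamma integral after the substitution t ↦ 1/t. -/
theorem lintegral_rpow_mul_exp_neg_div {a b : ℝ} (ha : 0 < a) (hb : 0 < b) :
    ∫⁻ t in Set.Ioi (0 : ℝ), ENNReal.ofReal (t ^ (-a - 1) * Real.exp (-(b / t))) =
      ENNReal.ofReal ((1 / b) ^ a * Real.Gamma a) := by
  have := Real.Gamma_pos_of_pos ha
  refine lintegral_ofReal_of_integral_eq measurableSet_Ioi
    (fun t ht => mul_nonneg (Real.rpow_nonneg (le_of_lt ht) _) (Real.exp_nonneg _))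
    (by positivity) ?_
  rw [← Real.integral_rpow_mul_exp_neg_mul_Ioi ha hb, ← integral_comp_rpow_Ioi _ (p := -1)
    (by norm_num)]
  refine setIntegral_congr_fun measurableSet_Ioi fun t ht => ?_
  have ht : 0 < t := ht
  simp only [abs_neg, abs_one, one_mul, smul_eq_mul]
  rw [← mul_assoc, ← Real.rpow_mul ht.le, ← Real.rpow_add ht, Real.rpow_neg_one]
  congr 2
  · ring
  · rw [div_inv_eq_mul]

theorem lintegral_beta {p q : ℝ} (hp : 0 < p) (hq : 0 < q) :
    ∫⁻ x in Set.Ioo (0 : ℝ) 1, ENNReal.ofReal (x ^ (p - 1) * (1 - x) ^ (q - 1)) =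
      ENNReal.ofReal (Real.Gamma p * Real.Gamma q / Real.Gamma (p + q)) := by
  have h := ProbabilityTheory.lintegral_betaPDF_eq_one hp hq
  have hB := ProbabilityTheory.beta_pos hp hq
  rw [ProbabilityTheory.lintegral_betaPDF] at h
  simp_rw [mul_assoc, ENNReal.ofReal_mul (one_div_pos.mpr hB).le] at h
  rw [lintegral_const_mul' _ _ ENNReal.ofReal_ne_top] at h
  change _ = ENNReal.ofReal (ProbabilityTheory.beta p q)
  rw [← mul_one (ENNReal.ofReal (ProbabilityTheory.beta p q)), ← h, ← mul_assoc,
    ← ENNReal.ofReal_mul hB.le, mul_one_div_cancel hB.ne', ENNReal.ofReal_one, one_mul]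

/-- The binomial series: insert the Gamma integral for Γ(j+a) and sum the exponential series under
the integral. -/
theorem tsum_Gamma_mul_pow {a x : ℝ} (ha : 0 < a) (hx : x ∈ Set.Ioo (0 : ℝ) 1) :
    ∑' j : ℕ, ENNReal.ofReal (Real.Gamma (j + a) / j ! * x ^ j) =
      ENNReal.ofReal (Real.Gamma a * (1 - x) ^ (-a)) := by
  have hx0 : 0 < x := hx.1
  have hx1 : 0 < 1 - x := by linarith [hx.2]
  have h1 : ∀ j : ℕ, ENNReal.ofReal (Real.Gamma (j + a) / j ! * x ^ j) =
      ∫⁻ t in Set.Ioi (0 : ℝ), ENNReal.ofReal ((x * t) ^ j / j ! * (t ^ (a - 1) * Real.exp (-t))) := by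
    intro j
    have h := lintegral_rpow_mul_exp_neg (a := j + a) (b := 1) (by positivity) one_pos
    rw [div_one, Real.one_rpow, one_mul] at h
    rw [show Real.Gamma (j + a) / j ! * x ^ j = (x ^ j / j !) * Real.Gamma (j + a) by ring,
      ENNReal.ofReal_mul (by positivity), ← h, ← lintegral_const_mul' _ _ ENNReal.ofReal_ne_top]
    refine setLIntegral_congr_fun measurableSet_Ioi fun t ht => ?_
    have ht : 0 < t := ht
    rw [← ENNReal.ofReal_mul (by positivity), one_mul,
      show (j : ℝ) + a - 1 = j + (a - 1) by ring, Real.rpow_add ht, Real.rpow_natCast, mul_pow]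
    congr 1; ring
  simp_rw [h1]
  rw [← lintegral_tsum (fun j => by fun_prop)]
  have h2 := lintegral_rpow_mul_exp_neg ha hx1
  rw [show Real.Gamma a * (1 - x) ^ (-a) = (1 / (1 - x)) ^ a * Real.Gamma a by
    rw [one_div, Real.inv_rpow hx1.le, Real.rpow_neg hx1.le]; ring, ← h2]
  refine setLIntegral_congr_fun measurableSet_Ioi fun t ht => ?_
  have ht : 0 < t := ht
  have hE : HasSum (fun j : ℕ => (x * t) ^ j / j !) (Real.exp (x * t)) := by
    rw [Real.exp_eq_exp_ℝ]; exact NormedSpace.expSeries_div_hasSum_exp _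
  have hE' := hE.mul_right (t ^ (a - 1) * Real.exp (-t))
  rw [← ENNReal.ofReal_tsum_of_nonneg (fun j => by positivity) hE'.summable, hE'.tsum_eq]
  congr 1
  rw [mul_left_comm, ← Real.exp_add]
  congr 2; ring

/-- Gauss's summation theorem for `₂F₁` at `1`. -/
theorem tsum_Gamma_mul_Gamma_div {a b c : ℝ} (ha : 0 < a) (hb : 0 < b) (hc : 0 < c - a - b) :
    ∑' j : ℕ, ENNReal.ofReal (Real.Gamma (j + a) * Real.Gamma (j + b) /
        (j ! * Real.Gamma (j + c))) =
      ENNReal.ofReal (Real.Gamma a * Real.Gamma b * Real.Gamma (c - a - b) /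
        (Real.Gamma (c - a) * Real.Gamma (c - b))) := by
  have hcb : 0 < c - b := by linarith
  have hca : 0 < c - a := by linarith
  have g1 := Real.Gamma_pos_of_pos hcb
  have g2 := Real.Gamma_pos_of_pos ha
  -- Euler's integral representation: Γ(j+b)/Γ(j+c) is a Beta integral with parameters j+b and c-b.
  -- Summing over j by the binomial series leaves a Beta integral with parameters b and c-a-b.
  have h1 : ∀ j : ℕ, ENNReal.ofReal (Real.Gamma (j + a) * Real.Gamma (j + b) /
        (j ! * Real.Gamma (j + c))) = ∫⁻ x in Set.Ioo (0 : ℝ) 1,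
          ENNReal.ofReal (1 / Real.Gamma (c - b) * (x ^ (b - 1) * (1 - x) ^ (c - b - 1))) *
            ENNReal.ofReal (Real.Gamma (j + a) / j ! * x ^ j) := by
    intro j
    have h := lintegral_beta (p := j + b) (by positivity) hcb
    have g3 := Real.Gamma_pos_of_pos (show 0 < (j : ℝ) + a by positivity)
    rw [show (j : ℝ) + b + (c - b) = j + c by ring] at h
    rw [show Real.Gamma (j + a) * Real.Gamma (j + b) / (j ! * Real.Gamma (j + c)) =
        (1 / Real.Gamma (c - b) * (Real.Gamma (j + a) / j !)) *
          (Real.Gamma (j + b) * Real.Gamma (c - b) / Real.Gamma (j + c)) by field_simp,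
      ENNReal.ofReal_mul (by positivity), ← h, ← lintegral_const_mul' _ _ ENNReal.ofReal_ne_top]
    refine setLIntegral_congr_fun measurableSet_Ioo fun x hx => ?_
    have hx0 : 0 < x := hx.1
    have hx1 : 0 < 1 - x := by linarith [hx.2]
    rw [← ENNReal.ofReal_mul (by positivity), ← ENNReal.ofReal_mul (by positivity),
      show (j : ℝ) + b - 1 = j + (b - 1) by ring, Real.rpow_add hx0, Real.rpow_natCast]
    congr 1; ring
  simp_rw [h1]
  rw [← lintegral_tsum (fun j => by fun_prop)]
  have h2 := lintegral_beta hb hc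
  have g4 : Real.Gamma a * Real.Gamma b * Real.Gamma (c - a - b) /
        (Real.Gamma (c - a) * Real.Gamma (c - b)) = (Real.Gamma a / Real.Gamma (c - b)) *
        (Real.Gamma b * Real.Gamma (c - a - b) / Real.Gamma (b + (c - a - b))) := by
    rw [show b + (c - a - b) = c - a by ring]
    field_simp
  rw [g4, ENNReal.ofReal_mul (by positivity), ← h2, ← lintegral_const_mul' _ _ ENNReal.ofReal_ne_top]
  refine setLIntegral_congr_fun measurableSet_Ioo fun x hx => ?_
  have hx0 : 0 < x := hx.1
  have hx1 : 0 < 1 - x := by linarith [hx.2]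
  rw [ENNReal.tsum_mul_left, tsum_Gamma_mul_pow ha hx, ← ENNReal.ofReal_mul (by positivity),
    ← ENNReal.ofReal_mul (by positivity)]
  congr 1
  rw [show c - a - b - 1 = (c - b - 1) + -a by ring, Real.rpow_add hx1]
  ring

theorem surfaceMeasure_real_univ_mul_Gamma {d : ℕ} (hd : 2 ≤ d) :
    (surfaceMeasure d).real Set.univ * Real.Gamma (d / 2) = 2 * Real.pi ^ ((d : ℝ) / 2) := by
  have : Nonempty (Fin d) := ⟨⟨0, by omega⟩⟩
  have := nontrivial_euclideanSpace hd
  have hd' : (2 : ℝ) ≤ d := by exact_mod_cast hd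
  have h0 : 0 < (d : ℝ) / 2 := by positivity
  have hG := Real.Gamma_pos_of_pos h0
  rw [surfaceMeasure, Measure.toSphere_real_apply_univ, finrank_euclideanSpace_fin, Measure.real,
    EuclideanSpace.volume_ball, ENNReal.ofReal_one, one_pow, one_mul, Fintype.card_fin,
    Real.Gamma_add_one h0.ne', ENNReal.toReal_ofReal (by positivity), Real.sqrt_eq_rpow,
    ← Real.rpow_natCast, ← Real.rpow_mul Real.pi_pos.le]
  rw [show 1 / 2 * (d : ℝ) = d / 2 by ring]
  field_simp

/-- The value of the integral `∫₀^∞ r^{d-1-2s} |a_k(r)|² dr`, where `a_k(r)` is the eigenvalue of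
`exp(-i r x · y)` on spherical harmonics of degree `k`. -/
noncomputable def besselConst (d : ℕ) (s : ℝ) (k : ℕ) : ℝ :=
  (2 * Real.pi) ^ d * (2 : ℝ) ^ (1 - 2 * s) *
    (Real.Gamma (2 * s - 1) * Real.Gamma ((k : ℝ) + (d : ℝ) / 2 - s) /
      (Real.Gamma s ^ 2 * Real.Gamma ((k : ℝ) + (d : ℝ) / 2 - 1 + s)))

/-- Legendre's duplication formula three times: for the pairs Γ(a)Γ(b) and Γ(c-b)Γ(c-a), and for
Γ(c-a-b) = Γ(s-1/2) against Γ(s). The rest is bookkeeping of powers of 2 and π. -/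
theorem besselConst_eq {d : ℕ} (hd : 2 ≤ d) {s : ℝ} (hs : s ∈ Set.Ioo (1 / 2 : ℝ) ((d : ℝ) / 2))
    (k : ℕ) {α a b c : ℝ} (hα : α = d / 2 - s) (ha : a = (k + α) / 2) (hb : b = a + 1 / 2)
    (hc : c = k + d / 2) :
    Real.pi ^ ((d : ℝ) / 2) * (2 * Real.pi ^ ((d : ℝ) / 2)) * 2 ^ α / Real.Gamma s *
      (2 ^ (α - 1) / √Real.pi) * (Real.Gamma a * Real.Gamma b * Real.Gamma (c - a - b) /
        (Real.Gamma (c - a) * Real.Gamma (c - b))) = besselConst d s k := by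
  obtain ⟨hs1, hs2⟩ := hs
  have hk := Nat.cast_nonneg (α := ℝ) k
  have hs0 : 0 < s := by linarith
  have hα0 : 0 < α := by linarith
  have ha0 : 0 < a := by rw [ha]; positivity
  have hcb : 0 < c - b := by rw [hc, hb, ha, hα]; linarith
  have hs' : 0 < s - 1 / 2 := by linarith
  have e1 := Real.Gamma_mul_Gamma_add_half_of_pos ha0
  have e2 := Real.Gamma_mul_Gamma_add_half_of_pos hcb
  have e3 := Real.Gamma_mul_Gamma_add_half_of_pos hs'
  rw [← hb, show 2 * a = k + d / 2 - s by rw [ha, hα]; ring] at e1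
  rw [show c - b + 1 / 2 = c - a by rw [hb]; ring,
    show 2 * (c - b) = k + d / 2 - 1 + s by rw [hc, hb, ha, hα]; ring] at e2
  rw [show s - 1 / 2 + 1 / 2 = s by ring, show 2 * (s - 1 / 2) = 2 * s - 1 by ring,
    show s - 1 / 2 = c - a - b by rw [hc, hb, ha, hα]; ring] at e3
  rw [besselConst, mul_comm (Real.Gamma (c - a)), e1, e2]
  have g1 := Real.Gamma_pos_of_pos hs0
  have g2 := Real.Gamma_pos_of_pos (show 0 < (k : ℝ) + d / 2 - 1 + s by
    have : (2 : ℝ) ≤ d := by exact_mod_cast hd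
    linarith)
  have g3 : Real.Gamma (c - a - b) =
      Real.Gamma (2 * s - 1) * 2 ^ (1 - (2 * s - 1)) * √Real.pi / Real.Gamma s := by
    rw [eq_div_iff g1.ne', e3]
  rw [g3, mul_pow]
  have hpi : Real.pi ^ d = Real.pi ^ ((d : ℝ) / 2) * Real.pi ^ ((d : ℝ) / 2) := by
    rw [← Real.rpow_add Real.pi_pos, ← Real.rpow_natCast]; congr 1; ring
  have h2 : (2 : ℝ) ^ d * 2 ^ (1 - 2 * s) * 2 ^ (1 - (k + (d : ℝ) / 2 - 1 + s)) =
      2 * 2 ^ α * 2 ^ (α - 1) * 2 ^ (1 - (k + (d : ℝ) / 2 - s)) * 2 ^ (1 - (2 * s - 1)) := by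
    rw [show (2 : ℝ) * 2 ^ α = 2 ^ (1 + α) by rw [Real.rpow_add two_pos, Real.rpow_one],
      ← Real.rpow_natCast, ← Real.rpow_add two_pos, ← Real.rpow_add two_pos,
      ← Real.rpow_add two_pos, ← Real.rpow_add two_pos, ← Real.rpow_add two_pos]
    congr 1
    rw [hα]; ring
  have hpi' : 0 < √Real.pi := Real.sqrt_pos.mpr Real.pi_pos
  have h2' : (0 : ℝ) < 2 ^ (1 - ((k : ℝ) + d / 2 - 1 + s)) := by positivity
  rw [hpi]
  generalize (2 : ℝ) ^ (1 - ((k : ℝ) + d / 2 - 1 + s)) = u at *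
  generalize Real.pi ^ ((d : ℝ) / 2) = P at *
  generalize Real.Gamma ((k : ℝ) + d / 2 - 1 + s) = G at *
  generalize Real.Gamma ((k : ℝ) + d / 2 - s) = G' at *
  generalize (2 : ℝ) ^ α = w₁ at *
  generalize (2 : ℝ) ^ (α - 1) = w₂ at *
  generalize (2 : ℝ) ^ (1 - ((k : ℝ) + d / 2 - s)) = w₃ at *
  generalize (2 : ℝ) ^ (1 - (2 * s - 1)) = w₄ at *
  generalize (2 : ℝ) ^ (1 - 2 * s) = w₅ at *
  field_simp
  linear_combination (-P ^ 2 * G' * Real.Gamma (2 * s - 1)) * h2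

end GammaIntegrals

/-! ### The radial integral by Gaussian subordination. -/

section BesselIntegral

variable {d : ℕ}

theorem exists_unit_vector (hd : 2 ≤ d) : ∃ e : EuclideanSpace ℝ (Fin d), ‖e‖ = 1 := by
  have := nontrivial_euclideanSpace hd
  exact exists_norm_eq _ zero_le_one

theorem measurable_expMultiplier (hd : 2 ≤ d) (k : ℕ) : Measurable (expMultiplier d k) :=
  measurable_of_tendsto_metrizable (f := fun N z => ∑ n ∈ Finset.range N,
      z ^ n / n ! * (funkHeckeCoef d n k : ℂ)) (fun N => by fun_prop)
    (tendsto_pi_nhds.mpr fun z => (summable_expMultiplier hd k z).hasSum.tendsto_sum_nat)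

/-- Only the indices k+2j contribute. The sum is, up to a power of u and a constant, the modified
Bessel function of order k+d/2-1; for u ≥ 0 its terms are nonnegative, unlike those at imaginary
argument. -/
theorem hasSum_expMultiplier_ofReal (hd : 2 ≤ d) (k : ℕ) (u : ℝ) :
    HasSum (fun j : ℕ => (((2 * Real.pi ^ ((d : ℝ) / 2)) * (u / 2) ^ (k + 2 * j) /
      (j ! * Real.Gamma (j + k + d / 2)) : ℝ) : ℂ)) (expMultiplier d k u) := by
  have h := (summable_expMultiplier hd k u).hasSum
  have hinj : Function.Injective (fun j : ℕ => k + 2 * j) := fun i j h => by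
    simp only at h; omega
  rw [← hinj.hasSum_iff] at h
  · refine h.congr_fun fun j => ?_
    simp only [Function.comp_apply]
    rw [funkHeckeCoef_add_two_mul hd, surfaceMeasure_real_univ_mul_Gamma hd]
    have h1 : ((k + 2 * j)! : ℂ) ≠ 0 := by exact_mod_cast Nat.factorial_ne_zero _
    push_cast
    rw [div_pow]
    field_simp
  · intro n hn
    rw [funkHeckeCoef_eq_zero (fun j hj => hn ⟨j, hj.symm⟩)]
    simp

/-- The function `u ↦ ∫ exp(u e · ω) P_{k,d}(e · ω) dσ(ω)`, a modified Bessel function. -/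
noncomputable def modifiedMultiplier (d k : ℕ) (u : ℝ) : ℝ :=
  ∑' j : ℕ, (2 * Real.pi ^ ((d : ℝ) / 2)) * (u / 2) ^ (k + 2 * j) /
      (j ! * Real.Gamma (j + k + d / 2))

theorem hasSum_modifiedMultiplier (hd : 2 ≤ d) (k : ℕ) (u : ℝ) :
    HasSum (fun j : ℕ => (2 * Real.pi ^ ((d : ℝ) / 2)) * (u / 2) ^ (k + 2 * j) /
      (j ! * Real.Gamma (j + k + d / 2))) (modifiedMultiplier d k u) :=
  (Complex.summable_ofReal.mp (hasSum_expMultiplier_ofReal hd k u).summable).hasSum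

theorem expMultiplier_ofReal (hd : 2 ≤ d) (k : ℕ) (u : ℝ) :
    expMultiplier d k u = (modifiedMultiplier d k u : ℂ) :=
  (hasSum_expMultiplier_ofReal hd k u).unique
    (Complex.hasSum_ofReal.mpr (hasSum_modifiedMultiplier hd k u))

theorem ofReal_modifiedMultiplier (hd : 2 ≤ d) (k : ℕ) {u : ℝ} (hu : 0 ≤ u) :
    ENNReal.ofReal (modifiedMultiplier d k u) = ∑' j : ℕ, ENNReal.ofReal
      ((2 * Real.pi ^ ((d : ℝ) / 2)) * (u / 2) ^ (k + 2 * j) /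
        (j ! * Real.Gamma (j + k + d / 2))) := by
  rw [modifiedMultiplier, ENNReal.ofReal_tsum_of_nonneg _ (hasSum_modifiedMultiplier hd k u).summable]
  intro j
  have hd' : (2 : ℝ) ≤ d := by exact_mod_cast hd
  have := Real.Gamma_pos_of_pos (show 0 < (j : ℝ) + k + d / 2 by positivity)
  positivity

/-- The Fourier extension of the zonal function `P_{k,d}(e · ω)`. -/
theorem fourierExtension_zonal (hd : 2 ≤ d) (k : ℕ) (e : EuclideanSpace ℝ (Fin d)) (he : ‖e‖ = 1)
    (r : ℝ) (η : EuclideanSpace ℝ (Fin d)) (hη : ‖η‖ = 1) :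
    fourierExtension (fun ω : USphere d =>
      (((legendrePoly d k).eval (inner ℝ e (ω : EuclideanSpace ℝ (Fin d))) : ℝ) : ℂ)) (r • η) =
    expMultiplier d k (-Complex.I * r) * (((legendrePoly d k).eval (inner ℝ e η) : ℝ) : ℂ) := by
  rw [← real_inner_comm e η, ← integral_exp_mul_legendrePoly hd η e hη he, fourierExtension]
  congr 1; ext ω
  rw [mul_comm, inner_smul_right, real_inner_comm]
  push_cast
  ring_nf

theorem measurable_fourierExtension_of_continuous (p : USphere d → ℂ) (hp : Continuous p) :
    Measurable (fourierExtension p) := by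
  have : StronglyMeasurable (fun q : EuclideanSpace ℝ (Fin d) × USphere d =>
      p q.2 * Complex.exp (-Complex.I *
        ((inner ℝ (q.2 : EuclideanSpace ℝ (Fin d)) q.1 : ℝ) : ℂ))) :=
    Continuous.stronglyMeasurable (by fun_prop)
  exact this.integral_prod_right.measurable

theorem integral_gaussian_mul_exp_inner {t : ℝ} (ht : 0 < t) (w : EuclideanSpace ℝ (Fin d)) :
    ∫ ξ : EuclideanSpace ℝ (Fin d), (Real.exp (-t * ‖ξ‖ ^ 2) : ℂ) *
        Complex.exp (-Complex.I * ((inner ℝ w ξ : ℝ) : ℂ)) =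
      (((Real.pi / t) ^ ((d : ℝ) / 2) * Real.exp (-‖w‖ ^ 2 / (4 * t)) : ℝ) : ℂ) := by
  have h := GaussianFourier.integral_cexp_neg_mul_sq_norm_add (V := EuclideanSpace ℝ (Fin d)) (b := (t : ℂ))
    (by simpa using ht) (-Complex.I) w
  have h1 : ∀ ξ : EuclideanSpace ℝ (Fin d), (Real.exp (-t * ‖ξ‖ ^ 2) : ℂ) *
      Complex.exp (-Complex.I * ((inner ℝ w ξ : ℝ) : ℂ)) =
      Complex.exp (-(t : ℂ) * (‖ξ‖ : ℂ) ^ 2 + -Complex.I * ((inner ℝ w ξ : ℝ) : ℂ)) := by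
    intro ξ
    rw [Complex.exp_add]
    push_cast
    rfl
  simp_rw [h1]
  rw [h, finrank_euclideanSpace_fin, neg_sq, Complex.I_sq]
  push_cast
  rw [Complex.ofReal_cpow (by positivity)]
  push_cast
  congr 2
  ring

theorem integrable_gaussian {t : ℝ} (ht : 0 < t) :
    Integrable (fun ξ : EuclideanSpace ℝ (Fin d) => Real.exp (-t * ‖ξ‖ ^ 2)) := by
  by_contra h
  have h1 := GaussianFourier.integral_rexp_neg_mul_sq_norm (V := EuclideanSpace ℝ (Fin d)) ht
  rw [integral_undef h] at h1
  have : 0 < (Real.pi / t) ^ ((Module.finrank ℝ (EuclideanSpace ℝ (Fin d)) : ℝ) / 2) := by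
    have := Real.pi_pos
    positivity
  linarith

/-- The Gaussian-weighted `L²` norm of the Fourier extension of a zonal harmonic. -/
theorem integral_gaussian_mul_normSq_fourierExtension (hd : 2 ≤ d) (k : ℕ)
    (e : EuclideanSpace ℝ (Fin d)) (he : ‖e‖ = 1) {t : ℝ} (ht : 0 < t) :
    ∫ ξ : EuclideanSpace ℝ (Fin d), Real.exp (-t * ‖ξ‖ ^ 2) * ‖fourierExtension
      (fun ω : USphere d => (((legendrePoly d k).eval
        (inner ℝ e (ω : EuclideanSpace ℝ (Fin d))) : ℝ) : ℂ)) ξ‖ ^ 2 =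
    (Real.pi / t) ^ ((d : ℝ) / 2) * Real.exp (-(1 / 2 / t)) * modifiedMultiplier d k (1 / (2 * t)) *
      ((surfaceMeasure d).real Set.univ / harmonicDim d k) := by
  set p : USphere d → ℝ := fun ω =>
    (legendrePoly d k).eval (inner ℝ e (ω : EuclideanSpace ℝ (Fin d))) with hp
  have hpc : Continuous p := by fun_prop
  -- As a double integral over the sphere, the squared modulus involves ξ only through
  -- exp(-i(ω-ω')·ξ), whose Gaussian integral is explicit.
  have hsq : ∀ ξ : EuclideanSpace ℝ (Fin d),
      ((‖fourierExtension (fun ω => (p ω : ℂ)) ξ‖ ^ 2 : ℝ) : ℂ) =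
      ∫ q : USphere d × USphere d, ((p q.1 * p q.2 : ℝ) : ℂ) * Complex.exp (-Complex.I *
        ((inner ℝ ((q.1 : EuclideanSpace ℝ (Fin d)) - q.2) ξ : ℝ) : ℂ))
        ∂((surfaceMeasure d).prod (surfaceMeasure d)) := by
    intro ξ
    have h1 := RCLike.mul_conj (K := ℂ) (fourierExtension (fun ω => (p ω : ℂ)) ξ)
    have h2 : (starRingEnd ℂ) (fourierExtension (fun ω => (p ω : ℂ)) ξ) =
        ∫ ω : USphere d, (p ω : ℂ) * Complex.exp (Complex.I *
          ((inner ℝ (ω : EuclideanSpace ℝ (Fin d)) ξ : ℝ) : ℂ)) ∂(surfaceMeasure d) := by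
      rw [fourierExtension, ← integral_conj]
      congr 1; ext ω
      rw [map_mul, Complex.conj_ofReal, ← Complex.exp_conj, map_mul, map_neg, Complex.conj_I,
        Complex.conj_ofReal, neg_neg]
    rw [Complex.ofReal_pow]
    refine h1.symm.trans ?_
    rw [h2, fourierExtension, ← integral_prod_mul]
    congr 1; ext q
    rw [inner_sub_left, mul_mul_mul_comm, ← Complex.exp_add]
    push_cast
    congr 2
    ring
  have hint : Integrable (Function.uncurry fun (ξ : EuclideanSpace ℝ (Fin d))
      (q : USphere d × USphere d) => (Real.exp (-t * ‖ξ‖ ^ 2) : ℂ) * (((p q.1 * p q.2 : ℝ) : ℂ) *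
        Complex.exp (-Complex.I * ((inner ℝ ((q.1 : EuclideanSpace ℝ (Fin d)) - q.2) ξ : ℝ) : ℂ))))
      (volume.prod ((surfaceMeasure d).prod (surfaceMeasure d))) := by
    have hb : Integrable (fun q : USphere d × USphere d => p q.1 * p q.2)
        ((surfaceMeasure d).prod (surfaceMeasure d)) :=
      (integrable_of_continuous hpc).mul_prod (integrable_of_continuous hpc)
    refine ((integrable_gaussian ht).mul_prod hb).mono
      (Continuous.aestronglyMeasurable (by unfold Function.uncurry; fun_prop))
      (Filter.Eventually.of_forall fun z => ?_)
    simp only [Function.uncurry]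
    rw [norm_mul, norm_mul, norm_mul, Complex.norm_real, Complex.norm_real, Complex.norm_exp]
    simp
  have h3 := integral_integral_swap hint
  have key : ((∫ ξ : EuclideanSpace ℝ (Fin d), Real.exp (-t * ‖ξ‖ ^ 2) *
      ‖fourierExtension (fun ω => (p ω : ℂ)) ξ‖ ^ 2 : ℝ) : ℂ) =
      (((Real.pi / t) ^ ((d : ℝ) / 2) * Real.exp (-(1 / 2 / t)) *
        modifiedMultiplier d k (1 / (2 * t)) *
        ((surfaceMeasure d).real Set.univ / harmonicDim d k) : ℝ) : ℂ) := by
    rw [← integral_complex_ofReal]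
    simp_rw [Complex.ofReal_mul _ (‖_‖ ^ 2), hsq, ← integral_const_mul]
    rw [h3]
    -- For unit vectors |ω-ω'|²/(4t) = 1/(2t) - ω·ω'/(2t), so the transformed Gaussian is again an
    -- exponential kernel in ω·ω', now with real parameter 1/(2t), and Funk–Hecke applies once more.
    have h4 : ∀ q : USphere d × USphere d,
        ∫ ξ : EuclideanSpace ℝ (Fin d), (Real.exp (-t * ‖ξ‖ ^ 2) : ℂ) * (((p q.1 * p q.2 : ℝ) : ℂ) *
          Complex.exp (-Complex.I * ((inner ℝ ((q.1 : EuclideanSpace ℝ (Fin d)) - q.2) ξ : ℝ) : ℂ))) =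
        (((Real.pi / t) ^ ((d : ℝ) / 2) * Real.exp (-(1 / 2 / t)) : ℝ) : ℂ) *
          ((p q.1 : ℂ) * (Complex.exp (((1 / (2 * t) : ℝ) : ℂ) *
            ((inner ℝ (q.1 : EuclideanSpace ℝ (Fin d)) (q.2 : EuclideanSpace ℝ (Fin d)) : ℝ) : ℂ))
              * (p q.2 : ℂ))) := by
      intro q
      simp_rw [mul_left_comm _ ((p q.1 * p q.2 : ℝ) : ℂ)]
      rw [integral_const_mul, integral_gaussian_mul_exp_inner ht, norm_sub_sq_real,
        USphere.norm_coe, USphere.norm_coe]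
      rw [show -(1 ^ 2 - 2 * inner ℝ (q.1 : EuclideanSpace ℝ (Fin d)) (q.2 : EuclideanSpace ℝ (Fin d))
        + 1 ^ 2) / (4 * t) = -(1 / 2 / t) + 1 / (2 * t) *
          inner ℝ (q.1 : EuclideanSpace ℝ (Fin d)) (q.2 : EuclideanSpace ℝ (Fin d)) by
            field_simp; ring, Real.exp_add]
      push_cast
      ring
    simp_rw [h4]
    rw [integral_const_mul, integral_prod]
    · have h5 : ∀ x : USphere d, ∫ y : USphere d, (p x : ℂ) * (Complex.exp (((1 / (2 * t) : ℝ) : ℂ) *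
            ((inner ℝ (x : EuclideanSpace ℝ (Fin d)) (y : EuclideanSpace ℝ (Fin d)) : ℝ) : ℂ))
              * (p y : ℂ)) ∂(surfaceMeasure d) = (modifiedMultiplier d k (1 / (2 * t)) : ℂ) *
              ((p x * p x : ℝ) : ℂ) := by
        intro x
        rw [integral_const_mul, integral_exp_mul_legendrePoly hd x e (USphere.norm_coe x) he,
          expMultiplier_ofReal hd, real_inner_comm]
        push_cast
        simp only [hp]
        ring
      simp_rw [h5]
      have h6 := (zonalPairing_self_legendrePoly hd e he k).1
      rw [zonalPairing_apply] at h6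
      rw [integral_const_mul, integral_complex_ofReal, h6]
      push_cast
      ring
    · refine Continuous.integrable_of_hasCompactSupport (by fun_prop)
        (HasCompactSupport.of_compactSpace _)
  exact_mod_cast key

/-- In polar coordinates the preceding norm factors into this radial integral and the squared norm
of the zonal harmonic, which cancels. -/
theorem lintegral_gaussian_mul_expMultiplier (hd : 2 ≤ d) (k : ℕ) {t : ℝ} (ht : 0 < t) :
    ∫⁻ r in Set.Ioi (0 : ℝ), ENNReal.ofReal (r ^ (d - 1)) * (ENNReal.ofReal (Real.exp (-t * r ^ 2)) *
        ‖expMultiplier d k (-Complex.I * r)‖ₑ ^ 2) =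
      ENNReal.ofReal ((Real.pi / t) ^ ((d : ℝ) / 2) * Real.exp (-(1 / 2 / t)) *
        modifiedMultiplier d k (1 / (2 * t))) := by
  obtain ⟨e, he⟩ := exists_unit_vector hd
  set p : USphere d → ℝ := fun ω =>
    (legendrePoly d k).eval (inner ℝ e (ω : EuclideanSpace ℝ (Fin d))) with hp
  have hpc : Continuous p := by fun_prop
  set U := fourierExtension (fun ω => (p ω : ℂ)) with hU
  have hUm : Measurable U := measurable_fourierExtension_of_continuous _ (by fun_prop)
  set h := (surfaceMeasure d).real Set.univ / harmonicDim d k with hh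
  have hh0 : 0 < h := div_pos (surfaceMeasure_real_univ_pos hd) (harmonicDim_pos hd k)
  have h1 := integral_gaussian_mul_normSq_fourierExtension hd k e he ht
  have hb : ∀ ξ, ‖U ξ‖ ≤ ∫ ω, |p ω| ∂(surfaceMeasure d) := by
    intro ξ
    refine (norm_integral_le_integral_norm _).trans (le_of_eq ?_)
    congr 1; ext ω
    rw [norm_mul, Complex.norm_exp]
    simp
  have hi : Integrable (fun ξ : EuclideanSpace ℝ (Fin d) => Real.exp (-t * ‖ξ‖ ^ 2) * ‖U ξ‖ ^ 2) := by
    refine ((integrable_gaussian ht).mul_const ((∫ ω, |p ω| ∂(surfaceMeasure d)) ^ 2)).mono'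
      (by fun_prop) (Filter.Eventually.of_forall fun ξ => ?_)
    rw [norm_mul, norm_pow, norm_norm, Real.norm_eq_abs, Real.abs_exp]
    gcongr
    exact hb ξ
  have h2 := ofReal_integral_eq_lintegral_ofReal hi
    (Filter.Eventually.of_forall fun ξ => by positivity)
  rw [h1, lintegral_eq_lintegral_polar hd _ (by fun_prop), ENNReal.ofReal_mul' hh0.le] at h2
  have h3 : ∀ r ∈ Set.Ioi (0 : ℝ), ENNReal.ofReal (r ^ (d - 1)) * ∫⁻ ω : USphere d, ENNReal.ofReal
      (Real.exp (-t * ‖r • (ω : EuclideanSpace ℝ (Fin d))‖ ^ 2) *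
        ‖U (r • (ω : EuclideanSpace ℝ (Fin d)))‖ ^ 2) ∂(surfaceMeasure d) =
      (ENNReal.ofReal (r ^ (d - 1)) * (ENNReal.ofReal (Real.exp (-t * r ^ 2)) *
        ‖expMultiplier d k (-Complex.I * r)‖ₑ ^ 2)) * ENNReal.ofReal h := by
    intro r hr
    have hr : 0 < r := hr
    have h4 : ∀ ω : USphere d, ENNReal.ofReal
        (Real.exp (-t * ‖r • (ω : EuclideanSpace ℝ (Fin d))‖ ^ 2) *
          ‖U (r • (ω : EuclideanSpace ℝ (Fin d)))‖ ^ 2) =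
        (ENNReal.ofReal (Real.exp (-t * r ^ 2)) * ‖expMultiplier d k (-Complex.I * r)‖ₑ ^ 2) *
          ENNReal.ofReal (p ω * p ω) := by
      intro ω
      rw [hU, fourierExtension_zonal hd k e he r _ (USphere.norm_coe ω), norm_smul, USphere.norm_coe,
        mul_one, Real.norm_eq_abs, sq_abs, norm_mul, mul_pow, Complex.norm_real, Real.norm_eq_abs,
        sq_abs, ← mul_assoc, ENNReal.ofReal_mul (by positivity), ENNReal.ofReal_mul (by positivity),
        ENNReal.ofReal_pow (norm_nonneg _), ofReal_norm, sq (eval _ _)]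
    simp_rw [h4]
    have h6 := (zonalPairing_self_legendrePoly hd e he k).1
    rw [zonalPairing_apply] at h6
    rw [lintegral_const_mul _ (by fun_prop), ← ofReal_integral_eq_lintegral_ofReal
      (integrable_of_continuous (by fun_prop))
      (Filter.Eventually.of_forall fun ω => mul_self_nonneg _), h6, ← hh]
    ring
  rw [setLIntegral_congr_fun measurableSet_Ioi h3] at h2
  have hm := measurable_expMultiplier hd k
  rw [lintegral_mul_const _ (by fun_prop)] at h2
  exact ((ENNReal.mul_left_inj (by simpa using hh0) ENNReal.ofReal_ne_top).mp h2).symm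

/-- The critical Weber–Schafheitlin integral. -/
theorem lintegral_rpow_mul_expMultiplier (hd : 2 ≤ d) {s : ℝ}
    (hs : s ∈ Set.Ioo (1 / 2 : ℝ) ((d : ℝ) / 2)) (k : ℕ) :
    ∫⁻ r in Set.Ioi (0 : ℝ), ENNReal.ofReal (r ^ (d - 1)) * (ENNReal.ofReal (r ^ (-s)) ^ 2 *
        ‖expMultiplier d k (-Complex.I * r)‖ₑ ^ 2) = ENNReal.ofReal (besselConst d s k) := by
  have hs0 : 0 < s := by linarith [hs.1]
  have hα : 0 < (d : ℝ) / 2 - s := by linarith [hs.2]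
  have hΓ := Real.Gamma_pos_of_pos hs0
  have hpi := Real.pi_pos
  have hm := measurable_expMultiplier hd k
  -- The t-integral will produce Γ(k+2j+α), and duplication splits it as Γ(2(j+a)) into
  -- Γ(j+a)Γ(j+b). Here s < d/2 gives α > 0, and c-a-b = s-1/2 > 0 is Gauss's convergence condition.
  set α : ℝ := (d : ℝ) / 2 - s with hαdef
  set a : ℝ := (k + α) / 2 with ha
  set b : ℝ := a + 1 / 2 with hb
  set c : ℝ := k + d / 2 with hc
  have ha0 : 0 < a := by positivity
  have hb0 : 0 < b := by positivity
  have hc0 : 0 < c - a - b := by rw [hc, hb, ha, hαdef]; linarith [hs.1]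
  -- the Gaussian subordination of the power weight
  have h1 : ∀ r ∈ Set.Ioi (0 : ℝ), ENNReal.ofReal (r ^ (d - 1)) * (ENNReal.ofReal (r ^ (-s)) ^ 2 *
        ‖expMultiplier d k (-Complex.I * r)‖ₑ ^ 2) = ENNReal.ofReal (1 / Real.Gamma s) *
        ∫⁻ t in Set.Ioi (0 : ℝ), ENNReal.ofReal (t ^ (s - 1)) * (ENNReal.ofReal (r ^ (d - 1)) *
          (ENNReal.ofReal (Real.exp (-t * r ^ 2)) * ‖expMultiplier d k (-Complex.I * r)‖ₑ ^ 2)) := by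
    intro r hr
    have hr : 0 < r := hr
    have h := lintegral_rpow_mul_exp_neg hs0 (show 0 < r ^ 2 by positivity)
    have h2 : ENNReal.ofReal (r ^ (-s)) ^ 2 = ENNReal.ofReal (1 / Real.Gamma s) *
        ∫⁻ t in Set.Ioi (0 : ℝ), ENNReal.ofReal (t ^ (s - 1)) *
          ENNReal.ofReal (Real.exp (-t * r ^ 2)) := by
      rw [← ENNReal.ofReal_pow (by positivity)]
      have e1 : (r ^ (-s)) ^ 2 = 1 / Real.Gamma s * ((1 / r ^ 2) ^ s * Real.Gamma s) := by
        rw [one_div (r ^ 2), Real.inv_rpow (by positivity), ← Real.rpow_natCast r 2,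
          ← Real.rpow_mul hr.le, ← Real.rpow_neg hr.le, ← Real.rpow_natCast, ← Real.rpow_mul hr.le]
        field_simp
      rw [e1, ENNReal.ofReal_mul (by positivity), ← h]
      congr 1
      refine setLIntegral_congr_fun measurableSet_Ioi fun t ht => ?_
      rw [ENNReal.ofReal_mul (Real.rpow_nonneg (le_of_lt ht) _)]
      congr 3; ring
    rw [h2, mul_assoc (ENNReal.ofReal (1 / Real.Gamma s)), mul_left_comm, mul_left_comm,
      mul_left_comm (ENNReal.ofReal (r ^ (d - 1))), ← lintegral_mul_const _ (by fun_prop),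
      ← lintegral_const_mul _ (by fun_prop)]
    congr 1
    refine lintegral_congr fun t => ?_
    ring
  rw [setLIntegral_congr_fun measurableSet_Ioi h1,
    lintegral_const_mul _ (by
      refine Measurable.lintegral_prod_right' (f := fun q : ℝ × ℝ => ENNReal.ofReal (q.2 ^ (s - 1)) *
        (ENNReal.ofReal (q.1 ^ (d - 1)) * (ENNReal.ofReal (Real.exp (-q.2 * q.1 ^ 2)) *
          ‖expMultiplier d k (-Complex.I * q.1)‖ₑ ^ 2))) (by fun_prop)),
    lintegral_lintegral_swap (by fun_prop)]
  -- The r-integral is done first, and the modified Bessel function is expanded in powers of 1/t.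
  have h2 : ∀ t ∈ Set.Ioi (0 : ℝ), ∫⁻ r in Set.Ioi (0 : ℝ), ENNReal.ofReal (t ^ (s - 1)) *
      (ENNReal.ofReal (r ^ (d - 1)) * (ENNReal.ofReal (Real.exp (-t * r ^ 2)) *
        ‖expMultiplier d k (-Complex.I * r)‖ₑ ^ 2)) =
      ∑' j : ℕ, ENNReal.ofReal (Real.pi ^ ((d : ℝ) / 2) * (2 * Real.pi ^ ((d : ℝ) / 2)) /
        (4 ^ (k + 2 * j) * (j ! * Real.Gamma (j + c)))) *
        ENNReal.ofReal (t ^ (-(k + 2 * j + α) - 1) * Real.exp (-(1 / 2 / t))) := by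
    intro t ht
    have ht : 0 < t := ht
    rw [lintegral_const_mul _ (by fun_prop), lintegral_gaussian_mul_expMultiplier hd k ht,
      ENNReal.ofReal_mul (by positivity), ofReal_modifiedMultiplier hd k (by positivity),
      ← mul_assoc, ← ENNReal.tsum_mul_left]
    congr 1; ext j
    have hg := Real.Gamma_pos_of_pos (show 0 < (j : ℝ) + k + d / 2 by positivity)
    rw [show (j : ℝ) + c = j + k + d / 2 by rw [hc]; ring]
    rw [← ENNReal.ofReal_mul (by positivity), ← ENNReal.ofReal_mul (by positivity),
      ← ENNReal.ofReal_mul (by positivity)]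
    congr 1
    rw [Real.div_rpow hpi.le ht.le, show -((k : ℝ) + 2 * j + α) - 1 =
      (s - 1) - d / 2 - ((k + 2 * j : ℕ) : ℝ) by rw [hαdef]; push_cast; ring, Real.rpow_sub ht _ ((k + 2 * j : ℕ) : ℝ),
      Real.rpow_sub ht (s - 1), Real.rpow_natCast]
    generalize t ^ (s - 1) = v
    rw [show 1 / (2 * t) / 2 = 1 / (4 * t) by field_simp; norm_num, div_pow, one_pow, mul_pow]
    field_simp
  rw [setLIntegral_congr_fun measurableSet_Ioi h2, lintegral_tsum (fun j => by fun_prop)]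
  -- Each power of 1/t against exp(-1/(2t)) is a Gamma integral; after duplication all powers of 2
  -- depending on j cancel.
  have h3 : ∀ j : ℕ, ∫⁻ t in Set.Ioi (0 : ℝ),
      ENNReal.ofReal (Real.pi ^ ((d : ℝ) / 2) * (2 * Real.pi ^ ((d : ℝ) / 2)) /
        (4 ^ (k + 2 * j) * (j ! * Real.Gamma (j + c)))) *
        ENNReal.ofReal (t ^ (-(k + 2 * j + α) - 1) * Real.exp (-(1 / 2 / t))) =
      ENNReal.ofReal (Real.pi ^ ((d : ℝ) / 2) * (2 * Real.pi ^ ((d : ℝ) / 2)) * 2 ^ α *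
        (2 ^ (α - 1) / √Real.pi)) *
      ENNReal.ofReal (Real.Gamma (j + a) * Real.Gamma (j + b) / (j ! * Real.Gamma (j + c))) := by
    intro j
    have hja : 0 < (j : ℝ) + a := by positivity
    have hg := Real.Gamma_pos_of_pos (show 0 < (j : ℝ) + c by rw [hc]; positivity)
    rw [lintegral_const_mul' _ _ ENNReal.ofReal_ne_top,
      lintegral_rpow_mul_exp_neg_div (by positivity) (by norm_num),
      ← ENNReal.ofReal_mul (by positivity), ← ENNReal.ofReal_mul (by positivity)]
    congr 1
    have e1 := Real.Gamma_mul_Gamma_add_half_of_pos hja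
    rw [show (j : ℝ) + a + 1 / 2 = j + b by rw [hb]; ring,
      show 2 * ((j : ℝ) + a) = k + 2 * j + α by rw [ha]; ring] at e1
    rw [e1, show (1 : ℝ) / (1 / 2) = 2 by norm_num]
    have e2 : (2 : ℝ) ^ ((k : ℝ) + 2 * j + α) = 2 ^ (k + 2 * j) * 2 ^ α := by
      rw [Real.rpow_add two_pos, ← Real.rpow_natCast]; push_cast; rfl
    have e3 : (2 : ℝ) ^ (α - 1) * 2 ^ (1 - ((k : ℝ) + 2 * j + α)) * 2 ^ (k + 2 * j) = 1 := by
      rw [← Real.rpow_natCast, ← Real.rpow_add two_pos, ← Real.rpow_add two_pos]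
      push_cast
      rw [show α - 1 + (1 - ((k : ℝ) + 2 * j + α)) + (k + 2 * j) = 0 by ring, Real.rpow_zero]
    have e4 : (4 : ℝ) ^ (k + 2 * j) = 2 ^ (k + 2 * j) * 2 ^ (k + 2 * j) := by
      rw [← mul_pow]; norm_num
    rw [e2, e4]
    have hpi' : 0 < √Real.pi := Real.sqrt_pos.mpr hpi
    have h2n : (0 : ℝ) < 2 ^ (k + 2 * j) := by positivity
    generalize (2 : ℝ) ^ (k + 2 * j) = w at *
    generalize (2 : ℝ) ^ (α - 1) = w₁ at *
    generalize (2 : ℝ) ^ (1 - ((k : ℝ) + 2 * j + α)) = w₂ at *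
    field_simp
    linear_combination (-1 : ℝ) * e3
  simp_rw [h3]
  rw [ENNReal.tsum_mul_left, tsum_Gamma_mul_Gamma_div ha0 hb0 hc0,
    ← besselConst_eq hd hs k hαdef ha hb hc]
  have g1 := Real.Gamma_pos_of_pos ha0
  rw [← ENNReal.ofReal_mul (by positivity), ← ENNReal.ofReal_mul (by positivity)]
  congr 1
  ring

end BesselIntegral

/-! ### Parseval for a complete sequence of orthogonal projections. -/

section Hilbert

variable {E : Type*} [NormedAddCommGroup E] [InnerProductSpace ℂ E]

/-- Parseval's identity for an orthogonal series. -/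
theorem hasSum_norm_sq_of_orthogonal {f : ℕ → E} {g : E} (hf : HasSum f g)
    (ho : ∀ i j, i ≠ j → inner ℂ (f i) (f j) = 0) : HasSum (fun k => ‖f k‖ ^ 2) (‖g‖ ^ 2) := by
  have h1 : ∀ i, inner ℂ (f i) g = ((‖f i‖ ^ 2 : ℝ) : ℂ) := by
    intro i
    have h := hf.mapL (innerSL ℂ (f i))
    simp only [innerSL_apply_apply] at h
    have h2 : HasSum (fun j => inner ℂ (f i) (f j)) (inner ℂ (f i) (f i)) :=
      hasSum_single i fun j hj => ho i j hj.symm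
    rw [h.unique h2, inner_self_eq_norm_sq_to_K]
    push_cast; rfl
  have h3 := hf.mapL (innerSL ℂ g)
  simp only [innerSL_apply_apply] at h3
  rw [inner_self_eq_norm_sq_to_K] at h3
  have h4 : ∀ i, inner ℂ g (f i) = ((‖f i‖ ^ 2 : ℝ) : ℂ) := by
    intro i
    rw [← inner_conj_symm, h1, Complex.conj_ofReal]
  simp_rw [h4] at h3
  apply Complex.hasSum_ofReal.mp
  rw [Complex.ofReal_pow]
  exact h3

/-- A complete sequence of mutually orthogonal, self-adjoint projections satisfies Parseval's
identity. -/
theorem hasSum_norm_sq_projections [CompleteSpace E] (P : ℕ → E → E)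
    (hadj : ∀ k x y, inner ℂ (P k x) y = inner ℂ x (P k y))
    (hproj : ∀ j k x, P j (P k x) = if j = k then P k x else 0)
    (hcomplete : ∀ x, (∀ k, P k x = 0) → x = 0) (x : E) :
    HasSum (fun k => ‖P k x‖ ^ 2) (‖x‖ ^ 2) := by
  have horth : ∀ i j, i ≠ j → inner ℂ (P i x) (P j x) = 0 := by
    intro i j hij
    rw [hadj, hproj, if_neg hij, inner_zero_right]
  have hself : ∀ i, inner ℂ (P i x) x = inner ℂ (P i x) (P i x) := by
    intro i
    rw [hadj i x (P i x), hproj, if_pos rfl, hadj]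
  -- Bessel's inequality: the partial sum y satisfies ⟨y, x⟩ = ⟨y, y⟩, so Cauchy–Schwarz gives ‖y‖ ≤
  -- ‖x‖.
  have hbessel : ∀ s : Finset ℕ, ∑ k ∈ s, ‖P k x‖ ^ 2 ≤ ‖x‖ ^ 2 := by
    intro s
    set y := ∑ k ∈ s, P k x with hy
    have h1 : inner ℂ y x = inner ℂ y y := by
      rw [hy, sum_inner, sum_inner]
      refine Finset.sum_congr rfl fun i hi => ?_
      rw [inner_sum, Finset.sum_eq_single i (fun j _ hj => horth i j hj.symm)
        (fun h => absurd hi h), hself]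
    have h2 : ‖y‖ ^ 2 = ∑ k ∈ s, ‖P k x‖ ^ 2 := by
      have h3 : ((‖y‖ ^ 2 : ℝ) : ℂ) = ((∑ k ∈ s, ‖P k x‖ ^ 2 : ℝ) : ℂ) := by
        have := inner_self_eq_norm_sq_to_K (𝕜 := ℂ) y
        push_cast
        refine this.symm.trans ?_
        rw [← h1, hy, sum_inner]
        refine Finset.sum_congr rfl fun i hi => ?_
        rw [hself, inner_self_eq_norm_sq_to_K]
        rfl
      exact_mod_cast h3
    have h4 : ‖y‖ ^ 2 ≤ ‖y‖ * ‖x‖ := by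
      have := norm_inner_le_norm (𝕜 := ℂ) y x
      rw [h1, inner_self_eq_norm_sq_to_K] at this
      simpa using this
    rw [← h2]
    have h5 : ‖y‖ ≤ ‖x‖ := by
      by_contra! h
      have := norm_nonneg x
      nlinarith
    gcongr
  have hsq : Summable fun k => ‖P k x‖ ^ 2 :=
    summable_of_sum_le (fun k => sq_nonneg _) hbessel
  have hsum : Summable fun k => P k x := by
    -- Orthogonal vectors are viewed as members of the lines they span, so that square summability
    -- yields summability.
    have hV : OrthogonalFamily ℂ (fun k => (Submodule.span ℂ {P k x} : Submodule ℂ E))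
        (fun k => (Submodule.span ℂ {P k x}).subtypeₗᵢ) := by
      refine OrthogonalFamily.of_pairwise fun i j hij => ?_
      change Submodule.span ℂ _ ⟂ Submodule.span ℂ _
      rw [Submodule.isOrtho_span]
      rintro u hu v hv
      rw [Set.mem_singleton_iff.mp hu, Set.mem_singleton_iff.mp hv]
      exact horth i j hij
    exact (hV.summable_iff_norm_sq_summable (fun k => ⟨P k x, Submodule.mem_span_singleton_self _⟩)).mpr
      hsq
  -- The remainder is killed by every P k. Linearity of P k is not assumed; moving it to the other
  -- side of the inner product replaces it.
  have hx : x - ∑' k, P k x = 0 := by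
    refine hcomplete _ fun k => ?_
    refine ext_inner_right ℂ fun w => ?_
    rw [hadj, inner_sub_left, inner_zero_left, ← hadj, sub_eq_zero]
    have h := hsum.hasSum.mapL (innerSL ℂ (P k w))
    simp only [innerSL_apply_apply] at h
    have h2 : HasSum (fun j => inner ℂ (P k w) (P j x)) (inner ℂ (P k w) (P k x)) := by
      refine hasSum_single k fun j hj => ?_
      rw [hadj, hproj, if_neg hj.symm, inner_zero_right]
    rw [← inner_conj_symm, ← inner_conj_symm (𝕜 := ℂ) _ (P k w), h.unique h2, inner_conj_symm,
      inner_conj_symm, hadj k x (P k w), hproj, if_pos rfl,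
      hadj k x w]
  have h := hsum.hasSum
  rw [← sub_eq_zero.mp hx] at h
  exact hasSum_norm_sq_of_orthogonal h horth

end Hilbert

/-! ### The projections H_k on the sphere and on L². -/

section ZonalProjection

variable {d : ℕ}

instance surfaceMeasure.instIsOpenPosMeasure (d : ℕ) : (surfaceMeasure d).IsOpenPosMeasure := by
  unfold surfaceMeasure; infer_instance

theorem integrable_Lp (G : Lp ℂ 2 (surfaceMeasure d)) : Integrable G (surfaceMeasure d) :=
  (Lp.memLp G).integrable one_le_two

/-- The projection of a function on the sphere onto spherical harmonics of degree `k`, as a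
function on the ambient space. -/
noncomputable def zonalProj (k : ℕ) (G : USphere d → ℂ) (x : EuclideanSpace ℝ (Fin d)) : ℂ :=
  ((harmonicDim d k / (surfaceMeasure d).real Set.univ : ℝ) : ℂ) *
    ∫ η, G η * (((legendrePoly d k).eval (inner ℝ x (η : EuclideanSpace ℝ (Fin d))) : ℝ) : ℂ)
      ∂(surfaceMeasure d)

theorem zonalProj_congr_ae (k : ℕ) {G F : USphere d → ℂ} (h : G =ᵐ[surfaceMeasure d] F)
    (x : EuclideanSpace ℝ (Fin d)) : zonalProj k G x = zonalProj k F x := by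
  unfold zonalProj
  congr 1
  refine integral_congr_ae (h.mono fun η hη => ?_)
  simp only [hη]

/-- Exchange of integrals against a continuous kernel on the sphere. -/
theorem integral_kernel_swap {F G : USphere d → ℂ} (hF : Integrable F (surfaceMeasure d))
    (hG : Integrable G (surfaceMeasure d)) {K : USphere d → USphere d → ℂ}
    (hK : Continuous (Function.uncurry K)) :
    ∫ x, (∫ y, G y * K x y ∂(surfaceMeasure d)) * F x ∂(surfaceMeasure d) =
      ∫ y, G y * (∫ x, K x y * F x ∂(surfaceMeasure d)) ∂(surfaceMeasure d) := by
  obtain ⟨M, hM⟩ := isCompact_univ.exists_bound_of_continuousOn hK.continuousOn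
  have hint : Integrable (Function.uncurry fun x y => F x * G y * K x y)
      ((surfaceMeasure d).prod (surfaceMeasure d)) :=
    (hF.mul_prod hG).mul_bdd (c := M) hK.aestronglyMeasurable
      (Filter.Eventually.of_forall fun p => hM p (Set.mem_univ _))
  have h := integral_integral_swap hint
  simp_rw [← integral_mul_const, ← integral_const_mul]
  refine Eq.trans ?_ (h.trans ?_)
  · refine integral_congr_ae (Filter.Eventually.of_forall fun x => ?_)
    refine integral_congr_ae (Filter.Eventually.of_forall fun y => ?_)
    ring
  · refine integral_congr_ae (Filter.Eventually.of_forall fun y => ?_)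
    refine integral_congr_ae (Filter.Eventually.of_forall fun x => ?_)
    ring

/-- A crude bound from the recurrence, using 2k+d ≤ 2(k+d-1) and k+1 ≤ k+d-1. Exponential growth is
harmless against the factorial in `norm_expMultiplier_le`. -/
theorem abs_legendrePoly_le (hd : 2 ≤ d) (k : ℕ) {t : ℝ} (ht : |t| ≤ 1) :
    |(legendrePoly d k).eval t| ≤ 3 ^ k ∧ |(legendrePoly d (k + 1)).eval t| ≤ 3 ^ (k + 1) := by
  have hd' : (2 : ℝ) ≤ d := by exact_mod_cast hd
  induction k with
  | zero =>
    simp only [legendrePoly_zero, legendrePoly_one, eval_one, eval_X, zero_add]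
    norm_num
    linarith
  | succ k ih =>
    refine ⟨ih.2, ?_⟩
    have hk := Nat.cast_nonneg (α := ℝ) k
    have h0 : 0 < (k : ℝ) + d - 1 := by linarith
    have h := congrArg (eval t) (legendrePoly_recurrence hd (k + 1))
    simp only [eval_mul, eval_sub, eval_C, eval_X, Nat.add_sub_cancel] at h
    push_cast at h
    set p := (legendrePoly d k).eval t
    set q := (legendrePoly d (k + 1)).eval t
    set r := (legendrePoly d (k + 1 + 1)).eval t
    have h1 : (k + d - 1) * |r| ≤ (2 * k + d) * |q| + (k + 1) * |p| := by
      have e : (k + d - 1) * |r| = |(2 * k + d) * t * q - (k + 1) * p| := by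
        rw [show (2 * k + d) * t * q - (k + 1) * p = (k + d - 1) * r by linear_combination -h,
          abs_mul, abs_of_pos h0]
      rw [e]
      refine (abs_sub _ _).trans ?_
      rw [abs_mul, abs_mul, abs_mul, abs_of_nonneg (show 0 ≤ 2 * (k : ℝ) + d by positivity),
        abs_of_nonneg (show 0 ≤ (k : ℝ) + 1 by positivity)]
      have : |t| * |q| ≤ 1 * |q| := mul_le_mul_of_nonneg_right ht (abs_nonneg _)
      nlinarith
    have h2 : (2 * k + d) * |q| ≤ (k + d - 1) * 2 * 3 ^ (k + 1) :=
      mul_le_mul (by linarith) ih.2 (abs_nonneg _) (by linarith)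
    have h3 : (k + 1) * |p| ≤ (k + d - 1) * 3 ^ k :=
      mul_le_mul (by linarith) ih.1 (abs_nonneg _) (by linarith)
    have h4 : (k + d - 1) * |r| ≤ (k + d - 1) * 3 ^ (k + 1 + 1) := by
      refine h1.trans ((add_le_add h2 h3).trans ?_)
      have : (0 : ℝ) ≤ (k + d - 1) * 3 ^ k := by positivity
      simp only [pow_succ]
      linarith
    exact le_of_mul_le_mul_left h4 h0

theorem norm_zonalProj_le (hd : 2 ≤ d) (k : ℕ) {G : USphere d → ℂ}
    (hG : Integrable G (surfaceMeasure d)) (x : EuclideanSpace ℝ (Fin d)) (hx : ‖x‖ ≤ 1) :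
    ‖zonalProj k G x‖ ≤ harmonicDim d k / (surfaceMeasure d).real Set.univ *
      (3 ^ k * ∫ η, ‖G η‖ ∂(surfaceMeasure d)) := by
  have h0 := div_pos (harmonicDim_pos hd k) (surfaceMeasure_real_univ_pos hd)
  rw [zonalProj, norm_mul, Complex.norm_real, Real.norm_eq_abs, abs_of_pos h0]
  gcongr
  rw [← integral_const_mul]
  refine norm_integral_le_of_norm_le (hG.norm.const_mul _)
    (Filter.Eventually.of_forall fun η => ?_)
  rw [norm_mul, Complex.norm_real, Real.norm_eq_abs, mul_comm]
  gcongr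
  exact (abs_legendrePoly_le hd k (abs_inner_coe_le_one x hx η)).1

theorem continuous_zonalProj (hd : 2 ≤ d) (k : ℕ) {G : USphere d → ℂ}
    (hG : Integrable G (surfaceMeasure d)) :
    Continuous fun ω : USphere d => zonalProj k G ω := by
  refine continuous_const.mul (continuous_of_dominated (bound := fun η => ‖G η‖ * 3 ^ k)
    (fun ω => hG.aestronglyMeasurable.mul (Continuous.aestronglyMeasurable (by fun_prop)))
    (fun ω => Filter.Eventually.of_forall fun η => ?_) (hG.norm.mul_const _)
    (Filter.Eventually.of_forall fun η => by fun_prop))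
  rw [norm_mul, Complex.norm_real, Real.norm_eq_abs]
  gcongr
  exact (abs_legendrePoly_le hd k (abs_inner_coe_le_one _ (USphere.norm_coe ω).le η)).1

theorem measurable_zonalProj (k : ℕ) {G : USphere d → ℂ} (hG : StronglyMeasurable G) :
    Measurable (zonalProj k G) := by
  have : StronglyMeasurable (fun q : EuclideanSpace ℝ (Fin d) × USphere d =>
      G q.2 * (((legendrePoly d k).eval (inner ℝ q.1 (q.2 : EuclideanSpace ℝ (Fin d))) : ℝ) : ℂ)) :=
    (hG.comp_measurable measurable_snd).mul (Continuous.stronglyMeasurable (by fun_prop))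
  exact this.integral_prod_right.measurable.const_mul _

/-- By Fubini the composed operator has the convolution of the two kernels as its kernel, and
`zonalPairing_legendrePoly` evaluates it. -/
theorem zonalProj_zonalProj (hd : 2 ≤ d) (j k : ℕ) {G : USphere d → ℂ}
    (hG : Integrable G (surfaceMeasure d)) (x : EuclideanSpace ℝ (Fin d)) (hx : ‖x‖ = 1) :
    zonalProj j (fun ω => zonalProj k G ω) x = if j = k then zonalProj k G x else 0 := by
  have hS := surfaceMeasure_real_univ_pos hd
  have hN := harmonicDim_pos hd k
  have h := integral_kernel_swap (F := fun ω : USphere d =>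
      (((legendrePoly d j).eval (inner ℝ x (ω : EuclideanSpace ℝ (Fin d))) : ℝ) : ℂ))
    (K := fun ω η : USphere d => (((legendrePoly d k).eval
      (inner ℝ (ω : EuclideanSpace ℝ (Fin d)) (η : EuclideanSpace ℝ (Fin d))) : ℝ) : ℂ))
    (integrable_of_continuous (by fun_prop)) hG (by unfold Function.uncurry; fun_prop)
  have h1 : ∀ η : USphere d, ∫ ω : USphere d, (((legendrePoly d k).eval
      (inner ℝ (ω : EuclideanSpace ℝ (Fin d)) (η : EuclideanSpace ℝ (Fin d))) : ℝ) : ℂ) *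
      (((legendrePoly d j).eval (inner ℝ x (ω : EuclideanSpace ℝ (Fin d))) : ℝ) : ℂ)
        ∂(surfaceMeasure d) = (if j = k then ((surfaceMeasure d).real Set.univ / harmonicDim d k : ℝ)
          else 0 : ℝ) * (((legendrePoly d k).eval
            (inner ℝ x (η : EuclideanSpace ℝ (Fin d))) : ℝ) : ℂ) := by
    intro η
    have h2 := zonalPairing_legendrePoly hd x η hx (USphere.norm_coe η) j k
    rw [zonalPairing_apply] at h2
    simp_rw [← Complex.ofReal_mul]
    rw [integral_complex_ofReal]
    congr 1
    rw [ite_mul, zero_mul, ← h2]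
    congr 1; ext ω
    rw [mul_comm, real_inner_comm (ω : EuclideanSpace ℝ (Fin d)) η]
  simp_rw [h1] at h
  unfold zonalProj
  simp_rw [mul_assoc]
  rw [integral_const_mul, h]
  split_ifs with hjk
  · subst hjk
    simp_rw [mul_left_comm (G _)]
    rw [integral_const_mul, ← mul_assoc
      ((harmonicDim d j / (surfaceMeasure d).real Set.univ : ℝ) : ℂ)
      (((surfaceMeasure d).real Set.univ / harmonicDim d j : ℝ) : ℂ), ← Complex.ofReal_mul, div_mul_div_cancel₀ hS.ne', div_self hN.ne', Complex.ofReal_one, one_mul]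
  · simp

/-- The diagonalisation: Fubini lets H_k act on the exponential kernel, where Funk–Hecke extracts
the scalar. -/
theorem harmonicProj_fourierExtension (hd : 2 ≤ d) (k : ℕ) {G : USphere d → ℂ}
    (hG : Integrable G (surfaceMeasure d)) (x : EuclideanSpace ℝ (Fin d)) (hx : x ≠ 0) :
    harmonicProj k (fourierExtension G) x =
      expMultiplier d k (-Complex.I * ‖x‖) * zonalProj k G (‖x‖⁻¹ • x) := by
  have hω : ‖‖x‖⁻¹ • x‖ = 1 := by
    rw [norm_smul, norm_inv, norm_norm, inv_mul_cancel₀ (norm_ne_zero_iff.mpr hx)]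
  set w := ‖x‖⁻¹ • x with hw
  have h := integral_kernel_swap (F := fun η : USphere d =>
      (((legendrePoly d k).eval (inner ℝ w (η : EuclideanSpace ℝ (Fin d))) : ℝ) : ℂ))
    (K := fun η ω : USphere d => Complex.exp (-Complex.I *
      ((inner ℝ (ω : EuclideanSpace ℝ (Fin d)) (‖x‖ • (η : EuclideanSpace ℝ (Fin d))) : ℝ) : ℂ)))
    (integrable_of_continuous (by fun_prop)) hG (by unfold Function.uncurry; fun_prop)
  have h1 : ∀ ω : USphere d, ∫ η : USphere d, Complex.exp (-Complex.I *
      ((inner ℝ (ω : EuclideanSpace ℝ (Fin d)) (‖x‖ • (η : EuclideanSpace ℝ (Fin d))) : ℝ) : ℂ)) *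
      (((legendrePoly d k).eval (inner ℝ w (η : EuclideanSpace ℝ (Fin d))) : ℝ) : ℂ)
        ∂(surfaceMeasure d) = expMultiplier d k (-Complex.I * ‖x‖) * (((legendrePoly d k).eval
            (inner ℝ w (ω : EuclideanSpace ℝ (Fin d))) : ℝ) : ℂ) := by
    intro ω
    rw [real_inner_comm (ω : EuclideanSpace ℝ (Fin d)) w,
      ← integral_exp_mul_legendrePoly hd ω w (USphere.norm_coe ω) hω]
    congr 1; ext η
    rw [inner_smul_right]
    push_cast
    ring_nf
  simp_rw [h1, mul_left_comm (G _)] at h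
  rw [integral_const_mul] at h
  unfold harmonicProj zonalProj fourierExtension
  rw [h]
  ring

/-- The projection onto spherical harmonics of degree `k`, as a continuous function. -/
noncomputable def zonalProjC (hd : 2 ≤ d) (k : ℕ) (G : Lp ℂ 2 (surfaceMeasure d)) :
    C(USphere d, ℂ) :=
  ⟨fun ω => zonalProj k G ω, continuous_zonalProj hd k (integrable_Lp G)⟩

/-- The projection onto spherical harmonics of degree `k` on `L²` of the sphere. -/
noncomputable def zonalProjLp (hd : 2 ≤ d) (k : ℕ) (G : Lp ℂ 2 (surfaceMeasure d)) :
    Lp ℂ 2 (surfaceMeasure d) :=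
  ContinuousMap.toLp 2 (surfaceMeasure d) ℂ (zonalProjC hd k G)

theorem coeFn_zonalProjLp (hd : 2 ≤ d) (k : ℕ) (G : Lp ℂ 2 (surfaceMeasure d)) :
    zonalProjLp hd k G =ᵐ[surfaceMeasure d] fun ω => zonalProj k G ω :=
  ContinuousMap.coeFn_toLp _ _

theorem zonalProjLp_zonalProjLp (hd : 2 ≤ d) (j k : ℕ) (G : Lp ℂ 2 (surfaceMeasure d)) :
    zonalProjLp hd j (zonalProjLp hd k G) = if j = k then zonalProjLp hd k G else 0 := by
  have h : ∀ ω : USphere d, zonalProjC hd j (zonalProjLp hd k G) ω =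
      if j = k then zonalProj k G ω else 0 := by
    intro ω
    rw [← zonalProj_zonalProj hd j k (integrable_Lp G) ω (USphere.norm_coe ω)]
    exact zonalProj_congr_ae j (coeFn_zonalProjLp hd k G) ω
  split_ifs with hjk
  · have : zonalProjC hd j (zonalProjLp hd k G) = zonalProjC hd k G := by
      ext ω; rw [h, if_pos hjk]; rfl
    rw [zonalProjLp, this]; rfl
  · have : zonalProjC hd j (zonalProjLp hd k G) = 0 := by
      ext ω; rw [h, if_neg hjk]; rfl
    rw [zonalProjLp, this, map_zero]

/-- The kernel is real and symmetric in its two arguments. -/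
theorem inner_zonalProjLp (hd : 2 ≤ d) (k : ℕ) (G F : Lp ℂ 2 (surfaceMeasure d)) :
    inner ℂ (zonalProjLp hd k G) F = inner ℂ G (zonalProjLp hd k F) := by
  have e1 : inner ℂ (zonalProjLp hd k G) F = ∫ ω : USphere d,
      F ω * (starRingEnd ℂ) (zonalProj k G ω) ∂(surfaceMeasure d) := by
    rw [L2.inner_def]
    refine integral_congr_ae ((coeFn_zonalProjLp hd k G).mono fun ω hω => ?_)
    simp only [hω, RCLike.inner_apply]
  have e2 : inner ℂ G (zonalProjLp hd k F) = ∫ ω : USphere d,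
      zonalProj k F ω * (starRingEnd ℂ) (G ω) ∂(surfaceMeasure d) := by
    rw [L2.inner_def]
    refine integral_congr_ae ((coeFn_zonalProjLp hd k F).mono fun ω hω => ?_)
    simp only [hω, RCLike.inner_apply]
  have hGc : Integrable (fun ω => (starRingEnd ℂ) (G ω)) (surfaceMeasure d) :=
    (RCLike.conjLIE (K := ℂ)).toContinuousLinearEquiv.toContinuousLinearMap.integrable_comp
      (integrable_Lp G)
  have h := integral_kernel_swap (F := fun ω => (starRingEnd ℂ) (G ω)) hGc (integrable_Lp F)
    (K := fun ω η : USphere d => (((legendrePoly d k).eval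
      (inner ℝ (ω : EuclideanSpace ℝ (Fin d)) (η : EuclideanSpace ℝ (Fin d))) : ℝ) : ℂ))
    (by unfold Function.uncurry; fun_prop)
  rw [e1, e2]
  unfold zonalProj
  simp_rw [map_mul, Complex.conj_ofReal, ← integral_conj, map_mul, Complex.conj_ofReal, mul_assoc,
    mul_left_comm (F _) (((harmonicDim d k / (surfaceMeasure d).real Set.univ : ℝ) : ℂ))]
  rw [integral_const_mul, integral_const_mul, h]
  congr 2; ext y
  congr 2; ext x
  rw [mul_comm, real_inner_comm]

end ZonalProjection

/-! ### Completeness of the spherical harmonics. -/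

section Completeness

variable {d : ℕ}

/-- By the recurrence, X times a Legendre polynomial is a combination of its neighbours, so
induction on n extends the vanishing to all products with X^n; index 0 gives the pure powers. -/
theorem integral_mul_inner_pow_eq_zero (hd : 2 ≤ d) {G : USphere d → ℂ}
    (hG : Integrable G (surfaceMeasure d)) (x : EuclideanSpace ℝ (Fin d))
    (h : ∀ k, ∫ η, G η * (((legendrePoly d k).eval
      (inner ℝ x (η : EuclideanSpace ℝ (Fin d))) : ℝ) : ℂ) ∂(surfaceMeasure d) = 0) (n : ℕ) :
    ∫ η : USphere d, G η * ((inner ℝ x (η : EuclideanSpace ℝ (Fin d)) ^ n : ℝ) : ℂ)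
      ∂(surfaceMeasure d) = 0 := by
  have hd' : (2 : ℝ) ≤ d := by exact_mod_cast hd
  have hint : ∀ p : ℝ[X], Integrable (fun η : USphere d => G η *
      ((p.eval (inner ℝ x (η : EuclideanSpace ℝ (Fin d))) : ℝ) : ℂ)) (surfaceMeasure d) := by
    intro p
    have hc : Continuous fun η : USphere d =>
      ((p.eval (inner ℝ x (η : EuclideanSpace ℝ (Fin d))) : ℝ) : ℂ) := by fun_prop
    obtain ⟨M, hM⟩ := isCompact_univ.exists_bound_of_continuousOn hc.continuousOn
    exact hG.mul_bdd (c := M) hc.aestronglyMeasurable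
      (Filter.Eventually.of_forall fun p => hM p (Set.mem_univ _))
  let Λ : ℝ[X] →ₗ[ℝ] ℂ :=
    { toFun := fun p => ∫ η : USphere d, G η *
        ((p.eval (inner ℝ x (η : EuclideanSpace ℝ (Fin d))) : ℝ) : ℂ) ∂(surfaceMeasure d)
      map_add' := fun p q => by
        simp only [eval_add, Complex.ofReal_add, mul_add]
        exact integral_add (hint p) (hint q)
      map_smul' := fun c p => by
        simp only [eval_smul, smul_eq_mul, Complex.ofReal_mul, mul_left_comm (G _),
          RingHom.id_apply, Complex.real_smul]
        exact integral_const_mul _ _ }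
  have hX : ∀ n k, Λ (X ^ n * legendrePoly d k) = 0 := by
    intro n
    induction n with
    | zero => intro k; rw [pow_zero, one_mul]; exact h k
    | succ n ih =>
      intro k
      rcases k with _ | k
      -- Index 0 is separate because the coefficient 2k+d-2 of the recurrence vanishes for k = 0, d
      -- = 2; instead, X is itself the polynomial of index 1.
      · have := ih 1
        rw [legendrePoly_one] at this
        rw [legendrePoly_zero, mul_one, pow_succ, this]
      · have hr := legendrePoly_recurrence hd (k + 1)
        have hk := Nat.cast_nonneg (α := ℝ) k
        have h0 : 2 * ((k + 1 : ℕ) : ℝ) + d - 2 ≠ 0 := by push_cast; linarith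
        have e : (2 * ((k + 1 : ℕ) : ℝ) + d - 2) • (X ^ (n + 1) * legendrePoly d (k + 1)) =
            (((k + 1 : ℕ) : ℝ) + d - 2) • (X ^ n * legendrePoly d (k + 1 + 1)) +
            ((k + 1 : ℕ) : ℝ) • (X ^ n * legendrePoly d (k + 1 - 1)) := by
          simp only [smul_eq_C_mul]
          linear_combination (-X ^ n) * hr
        have e2 := congrArg Λ e
        rw [map_smul, map_add, map_smul, map_smul, ih, ih, smul_zero, smul_zero, add_zero] at e2
        exact (smul_eq_zero.mp e2).resolve_left h0
  have := hX n 0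
  rw [legendrePoly_zero, mul_one] at this
  simpa [Λ] using this

/-- Expand the exponential: each term is a moment in the direction of ξ, and all of these vanish. -/
theorem integral_mul_exp_inner_eq_zero (hd : 2 ≤ d) {G : USphere d → ℂ}
    (hG : Integrable G (surfaceMeasure d)) (h : ∀ k (ω : USphere d), zonalProj k G ω = 0)
    (ξ : EuclideanSpace ℝ (Fin d)) : fourierExtension G ξ = 0 := by
  have hpow : ∀ n, ∫ η : USphere d, G η * ((inner ℝ ξ (η : EuclideanSpace ℝ (Fin d)) ^ n : ℝ) : ℂ)
      ∂(surfaceMeasure d) = 0 := by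
    intro n
    obtain ⟨e, he, r, hr⟩ : ∃ e : EuclideanSpace ℝ (Fin d), ‖e‖ = 1 ∧ ∃ r : ℝ, ξ = r • e := by
      by_cases h0 : ξ = 0
      · obtain ⟨e, he⟩ := exists_unit_vector hd
        exact ⟨e, he, 0, by simp [h0]⟩
      · have h0' := norm_ne_zero_iff.mpr h0
        exact ⟨‖ξ‖⁻¹ • ξ, by rw [norm_smul, norm_inv, norm_norm, inv_mul_cancel₀ h0'], ‖ξ‖,
          by rw [smul_smul, mul_inv_cancel₀ h0', one_smul]⟩
    have h1 := integral_mul_inner_pow_eq_zero hd hG e (fun k => by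
      have h2 := h k ⟨e, by simpa using he⟩
      have h3 := div_pos (harmonicDim_pos hd k) (surfaceMeasure_real_univ_pos hd)
      rw [zonalProj] at h2
      exact (mul_eq_zero.mp h2).resolve_left (by exact_mod_cast h3.ne')) n
    rw [hr]
    simp_rw [real_inner_smul_left, mul_pow, Complex.ofReal_mul, mul_left_comm (G _)]
    rw [integral_const_mul, h1, mul_zero]
  have hEc : ∀ w : ℂ, HasSum (fun n : ℕ => w ^ n / n !) (Complex.exp w) := fun w => by
    rw [Complex.exp_eq_exp_ℂ]; exact NormedSpace.expSeries_div_hasSum_exp w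
  have hE : HasSum (fun n : ℕ => ‖ξ‖ ^ n / n !) (Real.exp ‖ξ‖) := by
    rw [Real.exp_eq_exp_ℝ]; exact NormedSpace.expSeries_div_hasSum_exp _
  set t : USphere d → ℝ := fun η => inner ℝ ξ (η : EuclideanSpace ℝ (Fin d)) with ht
  have htb : ∀ η, |t η| ≤ ‖ξ‖ := fun η => by
    have := abs_real_inner_le_norm ξ (η : EuclideanSpace ℝ (Fin d))
    rwa [USphere.norm_coe, mul_one] at this
  have h1 := hasSum_integral_of_dominated_convergence (μ := surfaceMeasure d)
    (F := fun n η => (-Complex.I) ^ n / n ! * (G η * ((t η ^ n : ℝ) : ℂ)))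
    (f := fun η => G η * Complex.exp (-Complex.I * (t η : ℂ)))
    (fun n η => ‖ξ‖ ^ n / n ! * ‖G η‖)
    (fun n => (hG.aestronglyMeasurable.mul
      (Continuous.aestronglyMeasurable (by fun_prop))).const_mul _)
    (fun n => Filter.Eventually.of_forall fun η => by
      rw [norm_mul, norm_div, norm_pow, norm_neg, Complex.norm_I, one_pow, Complex.norm_natCast,
        norm_mul, Complex.norm_real, norm_pow, Real.norm_eq_abs, one_div, div_eq_mul_inv,
        mul_comm (‖ξ‖ ^ n), mul_assoc, mul_comm ‖G η‖]
      gcongr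
      exact htb η)
    (Filter.Eventually.of_forall fun η => (hE.mul_right _).summable)
    (by
      simp_rw [fun η => (hE.mul_right ‖G η‖).tsum_eq]
      exact hG.norm.const_mul _)
    (Filter.Eventually.of_forall fun η => by
      refine ((hEc (-Complex.I * t η)).mul_left (G η)).congr_fun fun n => ?_
      push_cast
      rw [mul_pow]; ring)
  have h2 := h1.congr_fun (g := fun _ => 0) fun n => by
    rw [integral_const_mul, hpow, mul_zero]
  rw [fourierExtension, ← h2.unique hasSum_zero]
  congr 1; ext η
  rw [ht, real_inner_comm]

/-- The character `η ↦ exp(i ξ · η)` on the sphere. -/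
noncomputable def sphereChar (ξ : EuclideanSpace ℝ (Fin d)) : C(USphere d, ℂ) :=
  ⟨fun η => Complex.exp (Complex.I * ((inner ℝ ξ (η : EuclideanSpace ℝ (Fin d)) : ℝ) : ℂ)),
    by fun_prop⟩

theorem sphereChar_apply (ξ : EuclideanSpace ℝ (Fin d)) (η : USphere d) : sphereChar ξ η =
    Complex.exp (Complex.I * ((inner ℝ ξ (η : EuclideanSpace ℝ (Fin d)) : ℝ) : ℂ)) := rfl

/-- Stone–Weierstrass: characters are closed under products and conjugation, so their span is
already a star subalgebra. -/
theorem span_sphereChar_closure_eq_top :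
    (Submodule.span ℂ (Set.range (sphereChar (d := d)))).topologicalClosure = ⊤ := by
  let A : StarSubalgebra ℂ C(USphere d, ℂ) :=
    { toSubalgebra := Algebra.adjoin ℂ (Set.range (sphereChar (d := d)))
      star_mem' := by
        change Algebra.adjoin ℂ (Set.range (sphereChar (d := d))) ≤
          star (Algebra.adjoin ℂ (Set.range (sphereChar (d := d))))
        refine Algebra.adjoin_le ?_
        rintro - ⟨ξ, rfl⟩
        refine Algebra.subset_adjoin ⟨-ξ, ContinuousMap.ext fun η => ?_⟩
        rw [ContinuousMap.star_apply, sphereChar_apply, sphereChar_apply, RCLike.star_def,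
          ← Complex.exp_conj, map_mul, Complex.conj_I, Complex.conj_ofReal, inner_neg_left]
        push_cast; ring_nf }
  have hcoe : Subalgebra.toSubmodule A.toSubalgebra =
      Submodule.span ℂ (Set.range (sphereChar (d := d))) := by
    refine Algebra.adjoin_eq_span_of_subset _ ?_
    refine Set.Subset.trans ?_ Submodule.subset_span
    intro x hx
    refine Submonoid.closure_induction (fun _ => id) ⟨0, ?_⟩ ?_ hx
    · ext η; simp [sphereChar_apply]
    · rintro - - - - ⟨ξ, rfl⟩ ⟨ζ, rfl⟩
      refine ⟨ξ + ζ, ?_⟩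
      ext η
      rw [ContinuousMap.mul_apply, sphereChar_apply, sphereChar_apply, sphereChar_apply,
        ← Complex.exp_add, inner_add_left]
      push_cast; ring_nf
  have hsep : A.SeparatesPoints := by
    intro x y hxy
    set v : EuclideanSpace ℝ (Fin d) := (x : EuclideanSpace ℝ (Fin d)) - y with hv
    have hv0 : v ≠ 0 := fun h => hxy (Subtype.ext (sub_eq_zero.mp h))
    have hv1 : ‖v‖ ^ 2 ≠ 0 := by positivity
    -- With this scaling the phases at x and y differ by exactly 1, which is not an integer multiple
    -- of 2π.
    refine ⟨_, ⟨sphereChar ((1 / ‖v‖ ^ 2) • v), Algebra.subset_adjoin ⟨_, rfl⟩, rfl⟩, ?_⟩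
    dsimp only
    rw [sphereChar_apply, sphereChar_apply]
    intro h
    obtain ⟨n, hn⟩ := Complex.exp_eq_exp_iff_exists_int.mp h
    have h1 : inner ℝ ((1 / ‖v‖ ^ 2) • v) (x : EuclideanSpace ℝ (Fin d)) =
        inner ℝ ((1 / ‖v‖ ^ 2) • v) (y : EuclideanSpace ℝ (Fin d)) + n * (2 * Real.pi) := by
      have := congrArg Complex.im hn
      simpa using this
    have h2 : inner ℝ ((1 / ‖v‖ ^ 2) • v) (x : EuclideanSpace ℝ (Fin d)) -
        inner ℝ ((1 / ‖v‖ ^ 2) • v) (y : EuclideanSpace ℝ (Fin d)) = 1 := by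
      rw [← inner_sub_right, ← hv, real_inner_smul_left, real_inner_self_eq_norm_sq,
        one_div, inv_mul_cancel₀ hv1]
    have h3 : (n : ℝ) * (2 * Real.pi) = 1 := by linarith
    have hpi := Real.pi_gt_three
    rcases lt_trichotomy n 0 with hn0 | hn0 | hn0
    · have : (n : ℝ) < 0 := by exact_mod_cast hn0
      nlinarith
    · rw [hn0] at h3; simp at h3
    · have : (1 : ℝ) ≤ n := by exact_mod_cast hn0
      nlinarith
  rw [← hcoe]
  exact congr_arg (Subalgebra.toSubmodule <| StarSubalgebra.toSubalgebra ·)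
    (ContinuousMap.starSubalgebra_topologicalClosure_eq_top_of_separatesPoints A hsep)

/-- The functional ⟨G, ·⟩ vanishes on characters, hence on all continuous functions, which are dense
in L². -/
theorem Lp_eq_zero_of_fourierExtension_eq_zero (G : Lp ℂ 2 (surfaceMeasure d))
    (h : ∀ ξ, fourierExtension G ξ = 0) : G = 0 := by
  let L : C(USphere d, ℂ) →L[ℂ] ℂ :=
    (innerSL ℂ G).comp (ContinuousMap.toLp 2 (surfaceMeasure d) ℂ)
  have hL : ∀ f, L f = inner ℂ G (ContinuousMap.toLp 2 (surfaceMeasure d) ℂ f) := fun f => rfl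
  have hker : Submodule.span ℂ (Set.range (sphereChar (d := d))) ≤ LinearMap.ker L.toLinearMap := by
    rw [Submodule.span_le]
    rintro - ⟨ξ, rfl⟩
    rw [SetLike.mem_coe, LinearMap.mem_ker]
    change L (sphereChar ξ) = 0
    rw [hL, L2.inner_def]
    have h1 := congrArg (starRingEnd ℂ) (h ξ)
    rw [fourierExtension, ← integral_conj, map_zero] at h1
    rw [← h1]
    refine integral_congr_ae ((ContinuousMap.coeFn_toLp (𝕜 := ℂ) (p := 2) (surfaceMeasure d)
      (sphereChar ξ)).mono fun η hη => ?_)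
    simp only [hη, RCLike.inner_apply, sphereChar_apply]
    rw [map_mul, ← Complex.exp_conj, map_mul, map_neg, Complex.conj_I, Complex.conj_ofReal, neg_neg,
      mul_comm, real_inner_comm]
  have hall : ∀ f, L f = 0 := by
    intro f
    have h1 : f ∈ (Submodule.span ℂ (Set.range (sphereChar (d := d)))).topologicalClosure := by
      rw [span_sphereChar_closure_eq_top]; trivial
    exact Submodule.topologicalClosure_minimal _ hker L.isClosed_ker h1
  exact (ContinuousMap.toLp_denseRange ℂ (surfaceMeasure d) ℂ (by norm_num)).eq_zero_of_inner_left ℂ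
    hall

theorem eq_zero_of_zonalProjLp_eq_zero (hd : 2 ≤ d) (G : Lp ℂ 2 (surfaceMeasure d))
    (h : ∀ k, zonalProjLp hd k G = 0) : G = 0 := by
  refine Lp_eq_zero_of_fourierExtension_eq_zero G fun ξ =>
    integral_mul_exp_inner_eq_zero hd (integrable_Lp G) (fun k ω => ?_) ξ
  -- Vanishing in L² becomes vanishing everywhere: the surface measure charges every nonempty open
  -- set, so continuous functions embed injectively.
  have h1 : zonalProjC hd k G = 0 := by
    refine ContinuousMap.toLp_injective (p := 2) (𝕜 := ℂ) (surfaceMeasure d) ?_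
    rw [map_zero]; exact h k
  exact congrArg (fun f : C(USphere d, ℂ) => f ω) h1

/-- Parseval's identity for the expansion into spherical harmonics. -/
theorem hasSum_norm_sq_zonalProjLp (hd : 2 ≤ d) (G : Lp ℂ 2 (surfaceMeasure d)) :
    HasSum (fun k => ‖zonalProjLp hd k G‖ ^ 2) (‖G‖ ^ 2) :=
  hasSum_norm_sq_projections (zonalProjLp hd) (inner_zonalProjLp hd) (zonalProjLp_zonalProjLp hd)
    (eq_zero_of_zonalProjLp_eq_zero hd) G

end Completeness

/-! ### Asymptotics and bounds for λ̃_k. -/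

section Eigenvalues

open Filter Topology

theorem Gamma_add_succ_eq_prod {x : ℝ} (hx : 0 < x) (n : ℕ) :
    Real.Gamma (n + 1 + x) = (∏ j ∈ Finset.range (n + 1), (x + j)) * Real.Gamma x := by
  induction n with
  | zero => simp [add_comm (1 : ℝ), Real.Gamma_add_one hx.ne']
  | succ n ih =>
    rw [Finset.prod_range_succ, mul_right_comm, ← ih]
    have h : (n : ℝ) + 1 + x ≠ 0 := by positivity
    push_cast
    rw [show (n : ℝ) + 1 + 1 + x = n + 1 + x + 1 by ring, Real.Gamma_add_one h]
    ring

/-- Euler's limit formula for Γ(x), inverted. -/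
theorem tendsto_Gamma_add_div {x : ℝ} (hx : 0 < x) :
    Tendsto (fun n : ℕ => Real.Gamma (n + 1 + x) / ((n : ℝ) ^ x * n !)) atTop (𝓝 1) := by
  have hG := Real.Gamma_pos_of_pos hx
  have h := (tendsto_const_nhds (x := Real.Gamma x)).div (Real.GammaSeq_tendsto_Gamma x) hG.ne'
  rw [div_self hG.ne'] at h
  refine h.congr fun n => ?_
  have hp : 0 < ∏ j ∈ Finset.range (n + 1), (x + j) := Finset.prod_pos fun j _ => by positivity
  rw [Gamma_add_succ_eq_prod hx]
  change Real.Gamma x / ((n : ℝ) ^ x * n ! / ∏ j ∈ Finset.range (n + 1), (x + j)) = _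
  rw [div_div_eq_mul_div, mul_comm]

theorem tendsto_Gamma_div_Gamma_mul_rpow {x y : ℝ} (hx : 0 < x) (hy : 0 < y) :
    Tendsto (fun n : ℕ => Real.Gamma (n + x) / Real.Gamma (n + y) * (n : ℝ) ^ (y - x)) atTop
      (𝓝 1) := by
  have h1 := (tendsto_Gamma_add_div hx).div (tendsto_Gamma_add_div hy) one_ne_zero
  -- Correction for passing from n+1+x, n+1+y to n+x, n+y by the functional equation.
  have h2 : Tendsto (fun n : ℕ => ((n : ℝ) + y) / (n + x)) atTop (𝓝 1) := by
    have h3 : Tendsto (fun n : ℕ => 1 + (y - x) * ((n : ℝ) + x)⁻¹) atTop (𝓝 (1 + (y - x) * 0)) :=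
      tendsto_const_nhds.add (tendsto_const_nhds.mul (tendsto_inv_atTop_zero.comp
        (tendsto_atTop_add_const_right _ _ tendsto_natCast_atTop_atTop)))
    rw [mul_zero, add_zero] at h3
    refine h3.congr fun n => ?_
    have : (n : ℝ) + x ≠ 0 := by positivity
    field_simp
    ring
  have h4 := h1.mul h2
  rw [div_one, one_mul] at h4
  refine h4.congr' ((eventually_gt_atTop 0).mono fun n hn => ?_)
  have hn' : (0 : ℝ) < n := by exact_mod_cast hn
  have hnx : 0 < (n : ℝ) + x := by positivity
  have hny : 0 < (n : ℝ) + y := by positivity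
  have g1 := Real.Gamma_pos_of_pos hnx
  have g2 := Real.Gamma_pos_of_pos hny
  have f := Nat.factorial_pos n
  simp only [Pi.div_apply]
  rw [show (n : ℝ) + 1 + x = n + x + 1 by ring, show (n : ℝ) + 1 + y = n + y + 1 by ring,
    Real.Gamma_add_one hnx.ne', Real.Gamma_add_one hny.ne', Real.rpow_sub hn']
  have p1 : 0 < (n : ℝ) ^ x := by positivity
  have p2 : 0 < (n : ℝ) ^ y := by positivity
  generalize (n : ℝ) ^ x = u at *
  generalize (n : ℝ) ^ y = v at *
  field_simp

variable {d : ℕ} {s : ℝ}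

theorem besselConst_pos (hd : 2 ≤ d) (hs : s ∈ Set.Ioo (1 / 2 : ℝ) ((d : ℝ) / 2)) (k : ℕ) :
    0 < besselConst d s k := by
  have hd' : (2 : ℝ) ≤ d := by exact_mod_cast hd
  have hk := Nat.cast_nonneg (α := ℝ) k
  obtain ⟨h1, h2⟩ := hs
  have := Real.pi_pos
  have := Real.Gamma_pos_of_pos (show 0 < 2 * s - 1 by linarith)
  have := Real.Gamma_pos_of_pos (show 0 < s by linarith)
  have := Real.Gamma_pos_of_pos (show 0 < (k : ℝ) + d / 2 - s by linarith)
  have := Real.Gamma_pos_of_pos (show 0 < (k : ℝ) + d / 2 - 1 + s by linarith)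
  unfold besselConst
  positivity

theorem one_add_eigenvalue_pos (hd : 2 ≤ d) (k : ℕ) :
    0 < 1 + (k : ℝ) * ((k : ℝ) + d - 2) := by
  have hd' : (2 : ℝ) ≤ d := by exact_mod_cast hd
  have hk := Nat.cast_nonneg (α := ℝ) k
  have : 0 ≤ (k : ℝ) * ((k : ℝ) + d - 2) := mul_nonneg hk (by linarith)
  linarith

theorem lambdaTilde_eq (d : ℕ) (s : ℝ) (k : ℕ) : lambdaTilde d s k =
    besselConst d s k * (1 + (k : ℝ) * ((k : ℝ) + d - 2)) ^ (s - 1 / 2) := rfl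

theorem lambdaTilde_pos (hd : 2 ≤ d) (hs : s ∈ Set.Ioo (1 / 2 : ℝ) ((d : ℝ) / 2)) (k : ℕ) :
    0 < lambdaTilde d s k :=
  mul_pos (besselConst_pos hd hs k) (Real.rpow_pos_of_pos (one_add_eigenvalue_pos hd k) _)

/-- The Gamma quotient decays like k^{1-2s} and the angular factor grows like k^{2s-1}; the order of
the angular derivative is the one for which they balance. -/
theorem tendsto_lambdaTilde (hd : 2 ≤ d) (hs : s ∈ Set.Ioo (1 / 2 : ℝ) ((d : ℝ) / 2)) :
    Tendsto (lambdaTilde d s) atTop (𝓝 ((2 * Real.pi) ^ d * (2 : ℝ) ^ (1 - 2 * s) *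
      (Real.Gamma (2 * s - 1) / Real.Gamma s ^ 2))) := by
  have hd' : (2 : ℝ) ≤ d := by exact_mod_cast hd
  have h1 := tendsto_Gamma_div_Gamma_mul_rpow (x := (d : ℝ) / 2 - s) (y := (d : ℝ) / 2 - 1 + s)
    (by linarith [hs.2]) (by linarith [hs.1])
  have h2 : Tendsto (fun k : ℕ => ((1 + (k : ℝ) * ((k : ℝ) + d - 2)) / (k : ℝ) ^ 2) ^ (s - 1 / 2))
      atTop (𝓝 1) := by
    have h0 : Tendsto (fun k : ℕ => ((k : ℝ))⁻¹) atTop (𝓝 0) :=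
      tendsto_inv_atTop_zero.comp tendsto_natCast_atTop_atTop
    have h3 : Tendsto (fun k : ℕ => ((k : ℝ))⁻¹ ^ 2 + 1 + ((d : ℝ) - 2) * ((k : ℝ))⁻¹) atTop
        (𝓝 ((0 : ℝ) ^ 2 + 1 + ((d : ℝ) - 2) * 0)) :=
      ((h0.pow 2).add tendsto_const_nhds).add (tendsto_const_nhds.mul h0)
    have e : (0 : ℝ) ^ 2 + 1 + ((d : ℝ) - 2) * 0 = 1 := by ring
    rw [e] at h3
    have h4 := h3.rpow_const (p := s - 1 / 2) (Or.inl one_ne_zero)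
    rw [Real.one_rpow] at h4
    refine h4.congr' ((eventually_gt_atTop 0).mono fun n hn => ?_)
    have hn' : (n : ℝ) ≠ 0 := by exact_mod_cast hn.ne'
    dsimp only
    congr 1
    field_simp
    ring
  have h5 := (h1.mul h2).const_mul ((2 * Real.pi) ^ d * (2 : ℝ) ^ (1 - 2 * s) *
      (Real.Gamma (2 * s - 1) / Real.Gamma s ^ 2))
  rw [mul_one, mul_one] at h5
  refine h5.congr' ((eventually_gt_atTop 0).mono fun n hn => ?_)
  have hn' : (0 : ℝ) < n := by exact_mod_cast hn
  have hp := one_add_eigenvalue_pos hd n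
  rw [lambdaTilde, Real.div_rpow hp.le (by positivity), ← Real.rpow_natCast,
    ← Real.rpow_natCast (n : ℝ) 2, ← Real.rpow_mul hn'.le,
    show ((2 : ℕ) : ℝ) * (s - 1 / 2) = (d : ℝ) / 2 - 1 + s - (d / 2 - s) by push_cast; ring]
  have p : 0 < (n : ℝ) ^ ((d : ℝ) / 2 - 1 + s - (d / 2 - s)) := by positivity
  rw [show (n : ℝ) + ((d : ℝ) / 2 - s) = n + d / 2 - s by ring,
    show (n : ℝ) + ((d : ℝ) / 2 - 1 + s) = n + d / 2 - 1 + s by ring]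
  field_simp

theorem bddAbove_lambdaTilde (hd : 2 ≤ d) (hs : s ∈ Set.Ioo (1 / 2 : ℝ) ((d : ℝ) / 2)) :
    BddAbove (Set.range (lambdaTilde d s)) :=
  (tendsto_lambdaTilde hd hs).bddAbove_range

theorem bddBelow_lambdaTilde (hd : 2 ≤ d) (hs : s ∈ Set.Ioo (1 / 2 : ℝ) ((d : ℝ) / 2)) :
    BddBelow (Set.range (lambdaTilde d s)) :=
  (tendsto_lambdaTilde hd hs).bddBelow_range

/-- A positive sequence with positive limit has bounded inverses. -/
theorem iInf_lambdaTilde_pos (hd : 2 ≤ d) (hs : s ∈ Set.Ioo (1 / 2 : ℝ) ((d : ℝ) / 2)) :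
    0 < ⨅ k, lambdaTilde d s k := by
  have hL : 0 < (2 * Real.pi) ^ d * (2 : ℝ) ^ (1 - 2 * s) *
      (Real.Gamma (2 * s - 1) / Real.Gamma s ^ 2) := by
    have := Real.pi_pos
    have := Real.Gamma_pos_of_pos (show 0 < 2 * s - 1 by linarith [hs.1])
    have := Real.Gamma_pos_of_pos (show 0 < s by linarith [hs.1])
    positivity
  obtain ⟨M, hM⟩ := ((tendsto_lambdaTilde hd hs).inv₀ hL.ne').bddAbove_range
  have hM' : ∀ k, (lambdaTilde d s k)⁻¹ ≤ M := fun k => hM ⟨k, rfl⟩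
  have hM0 : 0 < M := (inv_pos.mpr (lambdaTilde_pos hd hs 0)).trans_le (hM' 0)
  refine (inv_pos.mpr hM0).trans_le (le_ciInf fun k => ?_)
  exact inv_le_of_inv_le₀ (lambdaTilde_pos hd hs k) (hM' k)

end Eigenvalues

/-! ### Diagonal form of the weighted norm and sharpness. -/

section Main

variable {d : ℕ} {s : ℝ}

theorem harmonicDim_le_pow (hd : 2 ≤ d) (k : ℕ) : harmonicDim d k ≤ (2 * d : ℝ) ^ k := by
  have hd' : (2 : ℝ) ≤ d := by exact_mod_cast hd
  have key : ∀ k, harmonicDim d (k + 1) ≤ (2 * d : ℝ) ^ (k + 1) := by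
    intro k
    induction k with
    | zero => rw [zero_add, harmonicDim_one hd]; linarith
    | succ k ih =>
      have hk := Nat.cast_nonneg (α := ℝ) k
      have h := harmonicDim_add_two hd k
      have hN := harmonicDim_pos hd (k + 1)
      have h1 : (2 * (k : ℝ) + d) * (k + 2) * harmonicDim d (k + 2) ≤
          (2 * (k : ℝ) + d) * (k + 2) * (2 * d * harmonicDim d (k + 1)) := by
        rw [h]
        have : (2 * (k : ℝ) + 2 + d) * (k + d - 1) ≤ (2 * (2 * k + d)) * (d * (k + 2)) :=
          mul_le_mul (by linarith) (by nlinarith) (by linarith) (by linarith)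
        nlinarith
      have h2 := le_of_mul_le_mul_left h1 (by positivity)
      rw [pow_succ']
      exact h2.trans (by gcongr)
  cases k with
  | zero => rw [harmonicDim_zero, pow_zero]
  | succ k => exact key k

theorem fangWangSymbol_nonneg (hd : 2 ≤ d) (s : ℝ) (k : ℕ) :
    0 ≤ fangWangSymbol s ((k : ℝ) * ((k : ℝ) + d - 2)) :=
  Real.rpow_nonneg (one_add_eigenvalue_pos hd k).le _

/-- Bernoulli's inequality bounds 1+kd by (1+d)^k, whose square dominates the eigenvalue factor. As
for the dimension, only exponential growth matters. -/
theorem fangWangSymbol_le_pow (hd : 2 ≤ d) (hs : 1 / 2 ≤ s) (k : ℕ) :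
    fangWangSymbol s ((k : ℝ) * ((k : ℝ) + d - 2)) ≤
      (((1 + d : ℝ) ^ 2) ^ ((2 * s - 1) / 4)) ^ k := by
  have hd' : (2 : ℝ) ≤ d := by exact_mod_cast hd
  have hk := Nat.cast_nonneg (α := ℝ) k
  rw [Real.rpow_pow_comm (by positivity), fangWangSymbol]
  refine Real.rpow_le_rpow (one_add_eigenvalue_pos hd k).le ?_ (by linarith)
  have h : 1 + (k : ℝ) * d ≤ (1 + d : ℝ) ^ k := one_add_mul_le_pow (by linarith) k
  rw [pow_right_comm]
  refine le_trans ?_ (pow_le_pow_left₀ (by positivity) h 2)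
  have h1 : (k : ℝ) * k ≤ k * d * (k * d) := by
    have : (k : ℝ) ≤ k * d := by nlinarith
    exact mul_self_le_mul_self hk this
  nlinarith [mul_nonneg hk (show (0 : ℝ) ≤ d by linarith)]

/-- The coefficient of the degree `k` part of `(1-Λ)^{(2s-1)/4}` applied to a Fourier extension,
as a function of `z = -i|ξ|`. -/
noncomputable def extensionCoef (d : ℕ) (s : ℝ) (z : ℂ) (k : ℕ) : ℂ :=
  ((fangWangSymbol s ((k : ℝ) * ((k : ℝ) + d - 2)) : ℝ) : ℂ) * expMultiplier d k z

theorem norm_extensionCoef (hd : 2 ≤ d) (s : ℝ) (z : ℂ) (k : ℕ) : ‖extensionCoef d s z k‖ =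
    fangWangSymbol s ((k : ℝ) * ((k : ℝ) + d - 2)) * ‖expMultiplier d k z‖ := by
  rw [extensionCoef, norm_mul, Complex.norm_real, Real.norm_eq_abs,
    abs_of_nonneg (fangWangSymbol_nonneg hd s k)]

theorem summable_norm_extensionCoef_mul (hd : 2 ≤ d) (hs : 1 / 2 ≤ s) (z : ℂ) {M : ℝ}
    (hM : 0 ≤ M) : Summable fun k => ‖extensionCoef d s z k‖ *
      (harmonicDim d k / (surfaceMeasure d).real Set.univ * (3 ^ k * M)) := by
  have hS := surfaceMeasure_real_univ_pos hd
  set B : ℝ := ((1 + d : ℝ) ^ 2) ^ ((2 * s - 1) / 4) with hB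
  have hB0 : 0 ≤ B := by positivity
  refine Summable.of_nonneg_of_le (fun k => ?_) (fun k => ?_)
    ((Real.summable_pow_div_factorial (B * ‖z‖ * (2 * d) * 3)).mul_left (Real.exp ‖z‖ * M))
  · have := harmonicDim_pos hd k
    positivity
  · have hN := harmonicDim_pos hd k
    calc _ ≤ B ^ k * ((surfaceMeasure d).real Set.univ * Real.exp ‖z‖ * (‖z‖ ^ k / k !)) *
          ((2 * d : ℝ) ^ k / (surfaceMeasure d).real Set.univ * (3 ^ k * M)) := by
          rw [norm_extensionCoef hd]
          gcongr
          · exact fangWangSymbol_le_pow hd hs k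
          · exact norm_expMultiplier_le hd k z
          · exact harmonicDim_le_pow hd k
      _ = _ := by
          simp only [mul_pow]
          field_simp

theorem summable_extensionCoef_mul_zonalProj (hd : 2 ≤ d) (hs : 1 / 2 ≤ s) (z : ℂ)
    {G : USphere d → ℂ} (hG : Integrable G (surfaceMeasure d)) (x : EuclideanSpace ℝ (Fin d))
    (hx : ‖x‖ ≤ 1) : Summable fun k => extensionCoef d s z k * zonalProj k G x := by
  refine Summable.of_norm_bounded (summable_norm_extensionCoef_mul hd hs z
    (integral_nonneg (μ := surfaceMeasure d) fun η => norm_nonneg (G η))) fun k => ?_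
  rw [norm_mul]
  gcongr
  exact norm_zonalProj_le hd k hG x hx

theorem enorm_sq_Lp_eq_lintegral {α : Type*} [MeasurableSpace α] {μ : Measure α}
    (f : Lp ℂ 2 μ) : ‖f‖ₑ ^ 2 = ∫⁻ x, ‖f x‖ₑ ^ 2 ∂μ := by
  have h := eLpNorm_nnreal_pow_eq_lintegral (f := f) (μ := μ) (p := 2) two_ne_zero
  rw [Lp.enorm_def]
  simpa using h

/-- Parseval's identity on the sphere for a rapidly convergent expansion. -/
theorem lintegral_enorm_tsum_zonalProj (hd : 2 ≤ d) (G : Lp ℂ 2 (surfaceMeasure d)) {b : ℕ → ℂ}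
    (hb : Summable fun k => ‖b k‖ * (harmonicDim d k / (surfaceMeasure d).real Set.univ *
      (3 ^ k * ∫ η, ‖G η‖ ∂(surfaceMeasure d)))) :
    ∫⁻ ω : USphere d, ‖∑' k, b k * zonalProj k G ω‖ₑ ^ 2 ∂(surfaceMeasure d) =
      ∑' k, ENNReal.ofReal (‖b k‖ ^ 2 * ‖zonalProjLp hd k G‖ ^ 2) := by
  -- Convergence is uniform on the sphere, so the pointwise sum in the integrand represents the L²
  -- sum to which Parseval applies.
  have hsum : Summable fun k => b k • zonalProjC hd k G := by
    refine Summable.of_norm_bounded hb fun k => ?_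
    rw [norm_smul]
    gcongr
    have h0 := div_pos (harmonicDim_pos hd k) (surfaceMeasure_real_univ_pos hd)
    have h1 : 0 ≤ ∫ η, ‖G η‖ ∂(surfaceMeasure d) := integral_nonneg fun η => norm_nonneg _
    refine (ContinuousMap.norm_le _ (by positivity)).mpr fun ω => ?_
    exact norm_zonalProj_le hd k (integrable_Lp G) ω (USphere.norm_coe ω).le
  set F := ∑' k, b k • zonalProjC hd k G with hF
  have hFω : ∀ ω : USphere d, F ω = ∑' k, b k * zonalProj k G ω := by
    intro ω
    have h := (ContinuousMap.evalCLM ℂ ω).map_tsum hsum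
    exact h
  have hL := hsum.hasSum.mapL (ContinuousMap.toLp 2 (surfaceMeasure d) ℂ)
  simp only [map_smul] at hL
  have hP := hasSum_norm_sq_of_orthogonal hL fun i j hij => by
    rw [inner_smul_left, inner_smul_right]
    change _ * (_ * inner ℂ (zonalProjLp hd i G) (zonalProjLp hd j G)) = 0
    rw [inner_zonalProjLp, zonalProjLp_zonalProjLp, if_neg hij, inner_zero_right, mul_zero,
      mul_zero]
  simp only [norm_smul, mul_pow] at hP
  change HasSum (fun k => ‖b k‖ ^ 2 * ‖zonalProjLp hd k G‖ ^ 2) _ at hP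
  rw [← ENNReal.ofReal_tsum_of_nonneg (fun k => by positivity) hP.summable, hP.tsum_eq,
    ENNReal.ofReal_pow (norm_nonneg _), ofReal_norm, enorm_sq_Lp_eq_lintegral]
  refine lintegral_congr_ae ((ContinuousMap.coeFn_toLp (𝕜 := ℂ) (p := 2) (surfaceMeasure d)
    F).mono fun ω hω => ?_)
  dsimp only
  rw [← hFω, ← hω]

/-- The weighted extension in polar coordinates, away from the origin. -/
noncomputable def polarExtension (s : ℝ) (G : USphere d → ℂ) (ξ : EuclideanSpace ℝ (Fin d)) : ℂ :=
  ((‖ξ‖ ^ (-s) : ℝ) : ℂ) *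
    ∑' k, extensionCoef d s (-Complex.I * ‖ξ‖) k * zonalProj k G (‖ξ‖⁻¹ • ξ)

theorem angularTerm_fourierExtension (hd : 2 ≤ d) (s : ℝ) {G : USphere d → ℂ}
    (hG : Integrable G (surfaceMeasure d)) {ξ : EuclideanSpace ℝ (Fin d)} (hξ : ξ ≠ 0) :
    angularTerm (fangWangSymbol s) (fourierExtension G) ξ =
      fun k => extensionCoef d s (-Complex.I * ‖ξ‖) k * zonalProj k G (‖ξ‖⁻¹ • ξ) := by
  ext k
  rw [angularTerm, harmonicProj_fourierExtension hd k hG ξ hξ, extensionCoef, mul_assoc]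

/-- At ξ = 0 the vector is 0, not a unit vector; hence the pointwise bounds are stated for ‖x‖ ≤ 1,
and the polar series converges everywhere. -/
theorem norm_inv_norm_smul_le_one (ξ : EuclideanSpace ℝ (Fin d)) : ‖‖ξ‖⁻¹ • ξ‖ ≤ 1 := by
  rw [norm_smul, norm_inv, norm_norm]
  exact inv_mul_le_one

theorem ae_ne_zero (hd : 2 ≤ d) : ∀ᵐ ξ : EuclideanSpace ℝ (Fin d), ξ ≠ 0 := by
  have := nontrivial_euclideanSpace hd
  exact Measure.ae_ne volume 0

theorem ae_summable_angularTerm (hd : 2 ≤ d) (hs : 1 / 2 ≤ s) {G : USphere d → ℂ}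
    (hG : Integrable G (surfaceMeasure d)) : ∀ᵐ ξ : EuclideanSpace ℝ (Fin d),
      Summable (angularTerm (fangWangSymbol s) (fourierExtension G) ξ) := by
  filter_upwards [ae_ne_zero hd] with ξ hξ
  rw [angularTerm_fourierExtension hd s hG hξ]
  exact summable_extensionCoef_mul_zonalProj hd hs _ hG _ (norm_inv_norm_smul_le_one ξ)

theorem weightedExtension_ae_eq (hd : 2 ≤ d) (s : ℝ) {G : USphere d → ℂ}
    (hG : Integrable G (surfaceMeasure d)) :
    weightedExtension s G =ᵐ[volume] polarExtension s G := by
  filter_upwards [ae_ne_zero hd] with ξ hξ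
  rw [weightedExtension, angularMultiplier, angularTerm_fourierExtension hd s hG hξ,
    polarExtension]

theorem measurable_polarExtension (hd : 2 ≤ d) (hs : 1 / 2 ≤ s) {G : USphere d → ℂ}
    (hG : StronglyMeasurable G) (hGi : Integrable G (surfaceMeasure d)) :
    Measurable (polarExtension s G) := by
  have h : ∀ k, Measurable fun ξ : EuclideanSpace ℝ (Fin d) =>
      extensionCoef d s (-Complex.I * ‖ξ‖) k * zonalProj k G (‖ξ‖⁻¹ • ξ) := by
    intro k
    refine Measurable.mul (measurable_const.mul ?_)
      ((measurable_zonalProj k hG).comp (by fun_prop))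
    exact (measurable_expMultiplier hd k).comp
      (by fun_prop : Measurable fun ξ : EuclideanSpace ℝ (Fin d) => -Complex.I * (‖ξ‖ : ℂ))
  refine Measurable.mul (by fun_prop) (measurable_of_tendsto_metrizable
    (fun n => Finset.measurable_sum (Finset.range n) fun k _ => h k) (tendsto_pi_nhds.mpr
    fun ξ => ?_))
  exact (summable_extensionCoef_mul_zonalProj hd hs _ hGi _
    (norm_inv_norm_smul_le_one ξ)).hasSum.tendsto_sum_nat

theorem fangWangSymbol_sq (hd : 2 ≤ d) (s : ℝ) (k : ℕ) :
    fangWangSymbol s ((k : ℝ) * ((k : ℝ) + d - 2)) ^ 2 =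
      (1 + (k : ℝ) * ((k : ℝ) + d - 2)) ^ (s - 1 / 2) := by
  rw [fangWangSymbol, ← Real.rpow_natCast, ← Real.rpow_mul (one_add_eigenvalue_pos hd k).le]
  congr 1
  push_cast
  ring

/-- Parseval on the sphere of each radius r, then Tonelli in r and k; the remaining radial integral
is `besselConst d s k`, and the squared symbol completes it to λ̃_k. -/
theorem lintegral_enorm_weightedExtension (hd : 2 ≤ d)
    (hs : s ∈ Set.Ioo (1 / 2 : ℝ) ((d : ℝ) / 2)) (G : Lp ℂ 2 (surfaceMeasure d)) :
    ∫⁻ ξ, ‖weightedExtension s G ξ‖ₑ ^ 2 =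
      ∑' k, ENNReal.ofReal (lambdaTilde d s k * ‖zonalProjLp hd k G‖ ^ 2) := by
  have hGi := integrable_Lp G
  have hm := measurable_polarExtension hd hs.1.le (Lp.stronglyMeasurable G) hGi
  rw [lintegral_congr_ae ((weightedExtension_ae_eq hd s hGi).mono fun ξ h => by rw [h]),
    lintegral_eq_lintegral_polar hd _ (by fun_prop)]
  have hinner : ∀ r ∈ Set.Ioi (0 : ℝ), ENNReal.ofReal (r ^ (d - 1)) *
      ∫⁻ ω : USphere d, ‖polarExtension s G (r • (ω : EuclideanSpace ℝ (Fin d)))‖ₑ ^ 2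
        ∂(surfaceMeasure d) =
      ∑' k : ℕ, ENNReal.ofReal (fangWangSymbol s ((k : ℝ) * ((k : ℝ) + d - 2)) ^ 2 *
        ‖zonalProjLp hd k G‖ ^ 2) * (ENNReal.ofReal (r ^ (d - 1)) *
          (ENNReal.ofReal (r ^ (-s)) ^ 2 * ‖expMultiplier d k (-Complex.I * r)‖ₑ ^ 2)) := by
    intro r hr
    rw [Set.mem_Ioi] at hr
    have hpol : ∀ ω : USphere d, ‖polarExtension s G (r • (ω : EuclideanSpace ℝ (Fin d)))‖ₑ ^ 2 =
        ENNReal.ofReal (r ^ (-s)) ^ 2 *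
          ‖∑' k, extensionCoef d s (-Complex.I * r) k * zonalProj k G ω‖ₑ ^ 2 := by
      intro ω
      have hn : ‖r • (ω : EuclideanSpace ℝ (Fin d))‖ = r := by
        rw [norm_smul, USphere.norm_coe, mul_one, Real.norm_of_nonneg hr.le]
      rw [polarExtension, hn, inv_smul_smul₀ hr.ne', enorm_mul, mul_pow, ← ofReal_norm,
        Complex.norm_real, Real.norm_of_nonneg (by positivity)]
    simp_rw [hpol]
    rw [lintegral_const_mul' _ _ (by finiteness), lintegral_enorm_tsum_zonalProj hd G
      (summable_norm_extensionCoef_mul hd hs.1.le _ (integral_nonneg fun η => norm_nonneg _)),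
      ← ENNReal.tsum_mul_left, ← ENNReal.tsum_mul_left]
    refine tsum_congr fun k => ?_
    rw [norm_extensionCoef hd, mul_pow, mul_right_comm, ENNReal.ofReal_mul (by positivity),
      ENNReal.ofReal_pow (norm_nonneg (expMultiplier d k _)), ofReal_norm]
    ring
  rw [setLIntegral_congr_fun measurableSet_Ioi hinner, lintegral_tsum]
  · refine tsum_congr fun k => ?_
    rw [lintegral_const_mul' _ _ (by finiteness), lintegral_rpow_mul_expMultiplier hd hs,
      ← ENNReal.ofReal_mul (by positivity), fangWangSymbol_sq hd, lambdaTilde_eq]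
    congr 1
    ring
  · intro k
    have := (measurable_expMultiplier hd k).comp
      (by fun_prop : Measurable fun r : ℝ => -Complex.I * (r : ℂ))
    have h2 : Measurable fun r : ℝ => expMultiplier d k (-Complex.I * (r : ℂ)) := this
    fun_prop

theorem summable_lambdaTilde_mul (hd : 2 ≤ d)
    (hs : s ∈ Set.Ioo (1 / 2 : ℝ) ((d : ℝ) / 2)) (G : Lp ℂ 2 (surfaceMeasure d)) :
    Summable fun k => lambdaTilde d s k * ‖zonalProjLp hd k G‖ ^ 2 := by
  refine Summable.of_nonneg_of_le (fun k => ?_) (fun k => ?_)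
    ((hasSum_norm_sq_zonalProjLp hd G).summable.mul_left (⨆ k, lambdaTilde d s k))
  · have := lambdaTilde_pos hd hs k
    positivity
  · gcongr
    exact le_ciSup (bddAbove_lambdaTilde hd hs) k

theorem eLpNorm_weightedExtension_sq (hd : 2 ≤ d)
    (hs : s ∈ Set.Ioo (1 / 2 : ℝ) ((d : ℝ) / 2)) (G : Lp ℂ 2 (surfaceMeasure d)) :
    eLpNorm (weightedExtension s G) 2 volume ^ 2 =
      ENNReal.ofReal (∑' k, lambdaTilde d s k * ‖zonalProjLp hd k G‖ ^ 2) := by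
  have h := eLpNorm_nnreal_pow_eq_lintegral (f := weightedExtension s G) (μ := volume) (p := 2)
    two_ne_zero
  rw [ENNReal.ofReal_tsum_of_nonneg (fun k => mul_nonneg (lambdaTilde_pos hd hs k).le (sq_nonneg _))
    (summable_lambdaTilde_mul hd hs G), ← lintegral_enorm_weightedExtension hd hs]
  simpa using h

theorem memLp_weightedExtension (hd : 2 ≤ d)
    (hs : s ∈ Set.Ioo (1 / 2 : ℝ) ((d : ℝ) / 2)) (G : Lp ℂ 2 (surfaceMeasure d)) :
    MemLp (weightedExtension s G) 2 volume := by
  have hGi := integrable_Lp G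
  refine ⟨(measurable_polarExtension hd hs.1.le (Lp.stronglyMeasurable G)
    hGi).aestronglyMeasurable.congr (weightedExtension_ae_eq hd s hGi).symm, ?_⟩
  have h : eLpNorm (weightedExtension s G) 2 volume ^ 2 < ⊤ := by
    rw [eLpNorm_weightedExtension_sq hd hs]; exact ENNReal.ofReal_lt_top
  exact (ENNReal.pow_lt_top_iff.mp h).resolve_right two_ne_zero

theorem toReal_eLpNorm_weightedExtension_sq (hd : 2 ≤ d)
    (hs : s ∈ Set.Ioo (1 / 2 : ℝ) ((d : ℝ) / 2)) (G : Lp ℂ 2 (surfaceMeasure d)) :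
    (eLpNorm (weightedExtension s G) 2 volume).toReal ^ 2 =
      ∑' k, lambdaTilde d s k * ‖zonalProjLp hd k G‖ ^ 2 := by
  rw [← ENNReal.toReal_pow, eLpNorm_weightedExtension_sq hd hs, ENNReal.toReal_ofReal
    (tsum_nonneg fun k => mul_nonneg (lambdaTilde_pos hd hs k).le (sq_nonneg _))]

/-- The zonal harmonic of degree `k` with pole `x`. -/
noncomputable def zonalHarmonic (k : ℕ) (x : EuclideanSpace ℝ (Fin d)) : C(USphere d, ℂ) :=
  ⟨fun ω => (((legendrePoly d k).eval (inner ℝ (ω : EuclideanSpace ℝ (Fin d)) x) : ℝ) : ℂ),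
    by fun_prop⟩

/-- The reproducing property of the zonal kernel; these functions are the eigenvectors used for
sharpness. -/
theorem zonalProjLp_zonalHarmonic (hd : 2 ≤ d) (j k : ℕ) {x : EuclideanSpace ℝ (Fin d)}
    (hx : ‖x‖ = 1) :
    zonalProjLp hd j (ContinuousMap.toLp 2 (surfaceMeasure d) ℂ (zonalHarmonic k x)) =
      if j = k then ContinuousMap.toLp 2 (surfaceMeasure d) ℂ (zonalHarmonic k x) else 0 := by
  have hS := surfaceMeasure_real_univ_pos hd
  have hN := harmonicDim_pos hd k
  have h : ∀ ω : USphere d,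
      zonalProjC hd j (ContinuousMap.toLp 2 (surfaceMeasure d) ℂ (zonalHarmonic k x)) ω =
        if j = k then zonalHarmonic k x ω else 0 := by
    intro ω
    have h2 := zonalPairing_legendrePoly hd ω x (USphere.norm_coe ω) hx j k
    rw [zonalPairing_apply] at h2
    refine (zonalProj_congr_ae j (ContinuousMap.coeFn_toLp (𝕜 := ℂ) (p := 2) (surfaceMeasure d)
      (zonalHarmonic k x)) ω).trans ?_
    have h3 : ∫ η : USphere d, zonalHarmonic k x η * (((legendrePoly d j).eval
        (inner ℝ (ω : EuclideanSpace ℝ (Fin d)) (η : EuclideanSpace ℝ (Fin d))) : ℝ) : ℂ)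
          ∂(surfaceMeasure d) = ((if j = k then (surfaceMeasure d).real Set.univ /
            harmonicDim d k * (legendrePoly d k).eval
              (inner ℝ (ω : EuclideanSpace ℝ (Fin d)) x) else 0 : ℝ) : ℂ) := by
      rw [← h2, ← integral_complex_ofReal]
      congr 1; ext η
      simp only [zonalHarmonic, ContinuousMap.coe_mk, Complex.ofReal_mul]
      rw [mul_comm, real_inner_comm x]
    rw [zonalProj, h3]
    split_ifs with hjk
    · subst hjk
      rw [← Complex.ofReal_mul, ← mul_assoc, div_mul_div_cancel₀ hS.ne', div_self hN.ne', one_mul]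
      rfl
    · simp
  split_ifs with hjk
  · have : zonalProjC hd j (ContinuousMap.toLp 2 (surfaceMeasure d) ℂ (zonalHarmonic k x)) =
        zonalHarmonic k x := by
      ext ω; rw [h, if_pos hjk]
    rw [zonalProjLp, this]
  · have : zonalProjC hd j (ContinuousMap.toLp 2 (surfaceMeasure d) ℂ (zonalHarmonic k x)) = 0 := by
      ext ω; rw [h, if_neg hjk]; rfl
    rw [zonalProjLp, this, map_zero]

/-- Every `lambdaTilde d s k` is attained. -/
theorem exists_eLpNorm_weightedExtension_eq (hd : 2 ≤ d)
    (hs : s ∈ Set.Ioo (1 / 2 : ℝ) ((d : ℝ) / 2)) (k : ℕ) :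
    ∃ G : Lp ℂ 2 (surfaceMeasure d), 0 < ‖G‖ ∧
      (eLpNorm (weightedExtension s G) 2 volume).toReal ^ 2 = lambdaTilde d s k * ‖G‖ ^ 2 := by
  obtain ⟨x, hx⟩ := exists_unit_vector hd
  refine ⟨ContinuousMap.toLp 2 (surfaceMeasure d) ℂ (zonalHarmonic k x), ?_, ?_⟩
  · rw [norm_pos_iff]
    intro h0
    have h1 : zonalHarmonic k x = 0 := by
      refine ContinuousMap.toLp_injective (p := 2) (𝕜 := ℂ) (surfaceMeasure d) ?_
      rw [map_zero]; exact h0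
    have h2 := congrArg (fun f : C(USphere d, ℂ) => f ⟨x, by simpa using hx⟩) h1
    simp only [zonalHarmonic, ContinuousMap.coe_mk, real_inner_self_eq_norm_sq, hx, one_pow,
      (eval_one_legendrePoly hd k).1] at h2
    simp at h2
  · rw [toReal_eLpNorm_weightedExtension_sq hd hs, tsum_eq_single k fun j hj => ?_]
    · rw [zonalProjLp_zonalHarmonic hd k k hx, if_pos rfl]
    · rw [zonalProjLp_zonalHarmonic hd j k hx, if_neg hj, norm_zero]
      ring

end Main

theorem corollary4 (d : ℕ) (hd : 2 ≤ d) (s : ℝ) (hs : s ∈ Set.Ioo (1 / 2 : ℝ) ((d : ℝ) / 2)) :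
    -- the two constants are positive and finite
    0 < (⨅ k, lambdaTilde d s k) ∧
    BddAbove (Set.range (lambdaTilde d s)) ∧
    -- for every `G` in `L²(𝕊^{d-1})` the series defining `(1-Λ)^{(2s-1)/4} (G dσ)^` converges a.e.,
    -- the weighted function lies in `L²(ℝ^d)`, and the two-sided estimate holds
    (∀ G : Lp ℂ 2 (surfaceMeasure d),
      (∀ᵐ ξ : EuclideanSpace ℝ (Fin d),
        Summable (angularTerm (fangWangSymbol s) (fourierExtension G) ξ)) ∧
      MemLp (weightedExtension s G) 2 volume ∧
      (⨅ k, lambdaTilde d s k) * ‖G‖ ^ 2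
        ≤ (eLpNorm (weightedExtension s G) 2 volume).toReal ^ 2 ∧
      (eLpNorm (weightedExtension s G) 2 volume).toReal ^ 2
        ≤ (⨆ k, lambdaTilde d s k) * ‖G‖ ^ 2) ∧
    -- the lower constant is optimal
    (∀ c : ℝ, (∀ G : Lp ℂ 2 (surfaceMeasure d),
        c * ‖G‖ ^ 2 ≤ (eLpNorm (weightedExtension s G) 2 volume).toReal ^ 2) →
      c ≤ ⨅ k, lambdaTilde d s k) ∧
    -- the upper constant is optimal
    (∀ C : ℝ, (∀ G : Lp ℂ 2 (surfaceMeasure d),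
        (eLpNorm (weightedExtension s G) 2 volume).toReal ^ 2 ≤ C * ‖G‖ ^ 2) →
      (⨆ k, lambdaTilde d s k) ≤ C) := by
  have hup := bddAbove_lambdaTilde hd hs
  have hlow := bddBelow_lambdaTilde hd hs
  refine ⟨iInf_lambdaTilde_pos hd hs, hup, fun G => ⟨?_, memLp_weightedExtension hd hs G, ?_, ?_⟩,
    fun c hc => le_ciInf fun k => ?_, fun C hC => ciSup_le fun k => ?_⟩
  · exact ae_summable_angularTerm hd hs.1.le (integrable_Lp G)
  -- Both sides are series in ‖H_k G‖² and are compared term by term; likewise for the upper bound.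
  · have hG := hasSum_norm_sq_zonalProjLp hd G
    rw [toReal_eLpNorm_weightedExtension_sq hd hs, ← hG.tsum_eq, ← tsum_mul_left]
    refine (hG.summable.mul_left _).tsum_le_tsum (fun k => ?_) (summable_lambdaTilde_mul hd hs G)
    gcongr
    exact ciInf_le hlow k
  · have hG := hasSum_norm_sq_zonalProjLp hd G
    rw [toReal_eLpNorm_weightedExtension_sq hd hs, ← hG.tsum_eq, ← tsum_mul_left]
    refine (summable_lambdaTilde_mul hd hs G).tsum_le_tsum (fun k => ?_) (hG.summable.mul_left _)
    gcongr
    exact le_ciSup hup k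
  -- Testing with a zonal harmonic of degree k and dividing by its norm gives c ≤ λ̃_k for every k;
  -- the upper constant is handled in the same way.
  · obtain ⟨G, hG0, hG⟩ := exists_eLpNorm_weightedExtension_eq hd hs k
    have h := hc G
    rw [hG] at h
    exact le_of_mul_le_mul_right h (by positivity)
  · obtain ⟨G, hG0, hG⟩ := exists_eLpNorm_weightedExtension_eq hd hs k
    have h := hC G
    rw [hG] at h
    exact le_of_mul_le_mul_right h (by positivity)
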